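/- **Words and the operad.** A parenthesized word of length $m$ is a finite set $P$ of closed intervals of the linear order $x_1<\dots<x_m$, each with at least $2$ and fewer than $m$ elements, any two of which are nested or disjoint. These words form a poset $\mathfrak K_m$, where $P_2\le P_1$ iff $P_1\subseteq P_2$; it is regarded as a category. A word corresponds to a stable planar rooted tree with $m$ leaves: its nodes (for $m\ge 2$) are the elements of $P\cup\{\{x_1,\dots,x_m\}\}$, and the incoming edges of a node $p$ are the maximal elements among those intervals in $P$ and those one-letter sets that are properly contained in $p$. The functors $$\gamma:\mathfrak K_m\times\prod_{i=1}^m\mathfrak K_{k_i}\to\mathfrak K_{k_1+\dots+k_m}$$ graft the root of $T_i$ to the $i$-th leaf of $S$; for $T_i\in\mathfrak K_1$ the $i$-th leaf is left unchanged, and for $T_i\in\mathfrak K_0$ it is deleted, after which nodes without incoming edges are deleted and nodes with a single incoming edge are contracted. With the one-letter word $id\in\mathfrak K_1$ as unit this is a non-symmetric operad $\mathfrak K$ in categories. For $n\in\{2,3,\dots,\infty\}$ let $\mathfrak K^{(n)}\subseteq\mathfrak K$ be the suboperad of the words all of whose nodes have at most $n$ incoming edges, so $\mathfrak K^{(\infty)}=\mathfrak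 K$. A $\mathfrak K^{(n)}$-algebra structure on a category $\mathcal C$ consists of functors $\theta_m:\mathfrak K^{(n)}_m\times\mathcal C^m\to\mathcal C$, $m\ge 0$, with $\theta_1(id,-)=\mathrm{Id}_{\mathcal C}$ and $$\theta_{k_1+\dots+k_m}(\gamma(S;T_1,\dots,T_m),\bar A_1,\dots,\bar A_m)=\theta_m(S,\theta_{k_1}(T_1,\bar A_1),\dots,\theta_{k_m}(T_m,\bar A_m))$$ (strict equality of functors). **$A_n$-monoidal categories.** An $A_n$-monoidal structure on $\mathcal C$ consists of functors $\mu_k:\mathcal C^k\to\mathcal C$ for all integers $0\le k\le n$ ($0\le k<\infty$ if $n=\infty$) such that $\mu_1=\mathrm{Id}$ and the object $0=\mu_0$ is a strict unit, i.e. $\mu_{i+1+j}(\mathrm{Id}^i\times 0\times \mathrm{Id}^j)=\mu_{i+j}$ whenever $i+1+j\le n$, together with natural transformations $$\alpha^{i,j,k}:\mu_{i+1+k}\circ(\mathrm{Id}^i\times\mu_j\times\mathrm{Id}^k)\to\mu_{i+j+k}\qquad(i+j+k\le n,\ i+1+k\le n)$$ satisfying the following conditions for all tuples $\bar A\in\mathcal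 C^a$, $\bar B\in\mathcal C^b$, $\bar C\in\mathcal C^c$, $\bar D\in\mathcal C^d$, $\bar E\in\mathcal C^e$, whenever all the arities that occur are at most $n$: (i) $\alpha^{i,0,k}$, $\alpha^{i,1,k}$ and $\alpha^{0,j,0}$ are identities; (ii) $\alpha^{a+b+1,c,d}_{(\bar A,0,\bar B),\bar C,\bar D}=\alpha^{a+b,c,d}_{(\bar A,\bar B),\bar C,\bar D}$; (iii) $\alpha^{a,b,c+d+1}_{\bar A,\bar B,(\bar C,0,\bar D)}=\alpha^{a,b,c+d}_{\bar A,\bar B,(\bar C,\bar D)}$; (iv) $\alpha^{a,b+c+1,d}_{\bar A,(\bar B,0,\bar C),\bar D}=\alpha^{a,b+c,d}_{\bar A,(\bar B,\bar C),\bar D}$; (v) $\alpha^{a+b+c,d,e}_{(\bar A,\bar B,\bar C),\bar D,\bar E}\circ\alpha^{a,b,c+1+e}_{\bar A,\bar B,(\bar C,\mu_d(\bar D),\bar E)}=\alpha^{a,b,c+d+e}_{\bar A,\bar B,(\bar C,\bar D,\bar E)}\circ\alpha^{a+1+c,d,e}_{(\bar A,\mu_b(\bar B),\bar C),\bar D,\bar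 E}$; (vi) $\alpha^{a,b+c+d,e}_{\bar A,(\bar B,\bar C,\bar D),\bar E}\circ\mu_{a+1+e}(id_{\bar A},\alpha^{b,c,d}_{\bar B,\bar C,\bar D},id_{\bar E})=\alpha^{a+b,c,d+e}_{(\bar A,\bar B),\bar C,(\bar D,\bar E)}\circ\alpha^{a,b+1+d,e}_{\bar A,(\bar B,\mu_c(\bar C),\bar D),\bar E}$. **Theorem.** Let $n\in\{2,3,\dots,\infty\}$. A category $\mathcal C$ is a $\mathfrak K^{(n)}$-algebra if and only if it is an $A_n$-monoidal category. More precisely, for every category $\mathcal C$ there is a bijection between the $\mathfrak K^{(n)}$-algebra structures and the $A_n$-monoidal structures on $\mathcal C$, which sends $\theta$ to the structure with $\mu_k=\theta_k(x_1\cdots x_k,-)$ for $k\le n$, and with $\alpha^{i,j,k}$ given by applying $\theta_{i+j+k}$ to the morphism $$x_1\cdots x_i(x_{i+1}\cdots x_{i+j})x_{i+j+1}\cdots x_{i+j+k}\to x_1\cdots x_{i+j+k}$$ (an identity morphism if $j\le 1$ or $i=k=0$). -/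

import Mathlib

open CategoryTheory

universe v u

namespace Associahedral

/-! ## The posets of parenthesized words -/

/-- A parenthesized word on the linear order `x₁ < ⋯ < x_m`: a finite collection of closed
intervals, each with at least `2` and fewer than `m` elements, any two of which are nested or
disjoint. -/
@[ext]
structure PWord (m : ℕ) where
  parens : Finset (Finset (Fin m))
  interval : ∀ p ∈ parens, ∃ a b, p = Finset.Icc a b
  two_le : ∀ p ∈ parens, 2 ≤ p.card
  card_lt : ∀ p ∈ parens, p.card < m
  nested : ∀ p ∈ parens, ∀ q ∈ parens, p ⊆ q ∨ q ⊆ p ∨ Disjoint p q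

namespace PWord

/-- `w ≤ w'` if and only if `w'` is obtained from `w` by dropping parentheses. -/
instance (m : ℕ) : PartialOrder (PWord m) where
  le w w' := w'.parens ⊆ w.parens
  le_refl _ := Finset.Subset.refl _
  le_trans _ _ _ h h' := Finset.Subset.trans h' h
  le_antisymm _ _ h h' := PWord.ext (Finset.Subset.antisymm h' h)

/-- The word `x₁ x₂ ⋯ x_m` without parentheses. -/
def corolla (m : ℕ) : PWord m where
  parens := ∅
  interval := by simp
  two_le := by simp
  card_lt := by simp
  nested := by simp

theorem exists_eq_Icc {m : ℕ} {s : Finset (Fin m)} (hs : s.Nonempty)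
    (h : ∀ x ∈ s, ∀ z ∈ s, ∀ y, x ≤ y → y ≤ z → y ∈ s) : ∃ a b, s = Finset.Icc a b := by
  refine ⟨s.min' hs, s.max' hs, ?_⟩
  ext y
  rw [Finset.mem_Icc]
  exact ⟨fun hy => ⟨s.min'_le y hy, s.le_max' y hy⟩,
    fun hy => h _ (s.min'_mem hs) _ (s.max'_mem hs) y hy.1 hy.2⟩

/-- The word `x₁ ⋯ x_i (x_{i+1} ⋯ x_{i+j}) x_{i+j+1} ⋯ x_m`. Parentheses around fewer than two
letters or around the whole word are omitted. -/
def bracket (i j m : ℕ) : PWord m where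
  parens := ({Finset.univ.filter fun x : Fin m => i ≤ (x : ℕ) ∧ (x : ℕ) < i + j} :
    Finset (Finset (Fin m))).filter fun p => 2 ≤ p.card ∧ p.card < m
  interval := by
    intro p hp
    rw [Finset.mem_filter, Finset.mem_singleton] at hp
    obtain ⟨rfl, h2, -⟩ := hp
    refine exists_eq_Icc (Finset.card_pos.1 (by omega)) ?_
    intro x hx z hz y hxy hyz
    simp only [Finset.mem_filter, Finset.mem_univ, true_and] at hx hz ⊢
    rw [Fin.le_def] at hxy hyz
    omega
  two_le := by
    intro p hp
    exact (Finset.mem_filter.1 hp).2.1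
  card_lt := by
    intro p hp
    exact (Finset.mem_filter.1 hp).2.2
  nested := by
    intro p hp q hq
    rw [Finset.mem_filter, Finset.mem_singleton] at hp hq
    left
    rw [hp.1, hq.1]

theorem bracket_le_corolla (i j m : ℕ) : bracket i j m ≤ corolla m := Finset.empty_subset _

/-! ### Trees and the filtration by valence -/

/-- The edges, other than the root edge, of the stable tree of a word, each represented by the set
of leaves above it: the parentheses (internal edges) and the singletons (leaves). -/
def edges {m : ℕ} (w : PWord m) : Finset (Finset (Fin m)) :=
  w.parens ∪ Finset.univ.image fun x => {x}

/-- The nodes of the stable tree of a word (when `2 ≤ m`), each represented by the set of leaves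
above it: the parentheses and, for the root node, the whole word. -/
def nodes {m : ℕ} (w : PWord m) : Finset (Finset (Fin m)) :=
  insert Finset.univ w.parens

/-- The incoming edges of the node `p`: the maximal edges strictly above `p`. -/
def inputs {m : ℕ} (w : PWord m) (p : Finset (Fin m)) : Finset (Finset (Fin m)) :=
  w.edges.filter fun q => q ⊂ p ∧ ∀ r ∈ w.edges, q ⊂ r → ¬ r ⊂ p

/-- Every node of the tree of `w` has at most `n` incoming edges. -/
def InFiltration {m : ℕ} (n : ℕ∞) (w : PWord m) : Prop :=
  ∀ p ∈ w.nodes, ((w.inputs p).card : ℕ∞) ≤ n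

theorem mem_edges {m : ℕ} {w : PWord m} {q : Finset (Fin m)} :
    q ∈ w.edges ↔ q ∈ w.parens ∨ ∃ x, {x} = q := by
  simp [edges]

theorem edges_nonempty {m : ℕ} {w : PWord m} {q : Finset (Fin m)} (hq : q ∈ w.edges) :
    q.Nonempty := by
  rcases mem_edges.1 hq with h | ⟨x, rfl⟩
  · have := w.two_le q h
    exact Finset.card_pos.1 (by omega)
  · exact Finset.singleton_nonempty x

theorem edges_nested {m : ℕ} {w : PWord m} {p q : Finset (Fin m)} (hp : p ∈ w.edges)
    (hq : q ∈ w.edges) : p ⊆ q ∨ q ⊆ p ∨ Disjoint p q := by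
  rcases mem_edges.1 hp with h | ⟨x, rfl⟩
  · rcases mem_edges.1 hq with h' | ⟨y, rfl⟩
    · exact w.nested p h q h'
    · by_cases hy : y ∈ p
      · right; left; simpa using hy
      · right; right; simpa using hy
  · by_cases hx : x ∈ q
    · left; simpa using hx
    · right; right; simpa using hx

/-- Distinct incoming edges of a node have disjoint sets of leaves. -/
theorem inputs_eq {m : ℕ} {w : PWord m} {p q r : Finset (Fin m)} (hq : q ∈ w.inputs p)
    (hr : r ∈ w.inputs p) {x : Fin m} (hxq : x ∈ q) (hxr : x ∈ r) : q = r := by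
  rw [inputs, Finset.mem_filter] at hq hr
  rcases edges_nested hq.1 hr.1 with h | h | h
  · by_contra hne
    exact hq.2.2 r hr.1 (h.ssubset_of_ne hne) hr.2.1
  · by_contra hne
    exact hr.2.2 q hq.1 (h.ssubset_of_ne (Ne.symm hne)) hq.2.1
  · exact absurd hxr (Finset.disjoint_left.1 h hxq)

theorem card_inputs_le {m : ℕ} (w : PWord m) (p : Finset (Fin m)) :
    (w.inputs p).card ≤ p.card := by
  have hne : ∀ q ∈ w.inputs p, q.Nonempty := fun q hq =>
    edges_nonempty (Finset.mem_filter.1 hq).1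
  choose f hf using hne
  refine Finset.card_le_card_of_injective (f := fun q : w.inputs p => ⟨f q.1 q.2,
    (Finset.mem_filter.1 q.2).2.1.1 (hf q.1 q.2)⟩) ?_
  rintro ⟨q, hq⟩ ⟨r, hr⟩ hqr
  have hqr' : f q hq = f r hr := congrArg Subtype.val hqr
  exact Subtype.ext (inputs_eq hq hr (hf q hq) (hqr' ▸ hf r hr))

theorem inFiltration_of_le {m : ℕ} {n : ℕ∞} (h : (m : ℕ∞) ≤ n) (w : PWord m) :
    w.InFiltration n := by
  intro p _
  refine le_trans ?_ h
  have := (w.card_inputs_le p).trans (Finset.card_le_univ p)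
  rw [Fintype.card_fin] at this
  exact_mod_cast this

/-- The incoming edge of a node through a given leaf. -/
theorem exists_inputs {m : ℕ} (w : PWord m) {p : Finset (Fin m)} {x : Fin m} (hx : x ∈ p)
    (hp : p ≠ {x}) : ∃ q ∈ w.inputs p, x ∈ q := by
  have hS : (w.edges.filter fun q => q ⊂ p ∧ x ∈ q).Nonempty := by
    refine ⟨{x}, Finset.mem_filter.2 ⟨mem_edges.2 (Or.inr ⟨x, rfl⟩), ?_, by simp⟩⟩
    exact (Finset.singleton_subset_iff.2 hx).ssubset_of_ne (Ne.symm hp)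
  obtain ⟨q, hq, hmax⟩ := Finset.exists_max_image _ Finset.card hS
  rw [Finset.mem_filter] at hq
  refine ⟨q, Finset.mem_filter.2 ⟨hq.1, hq.2.1, ?_⟩, hq.2.2⟩
  intro r hr hqr hrp
  have := hmax r (Finset.mem_filter.2 ⟨hr, hrp, hqr.1 hq.2.2⟩)
  exact absurd (Finset.card_lt_card hqr) (by omega)

/-! ### The operad structure -/

/-- The index of the block in which a letter of a word of length `k₁ + ⋯ + k_m` lies. -/
def block {m : ℕ} (k : Fin m → ℕ) (x : Fin (∑ i, k i)) : Fin m := (finSigmaFinEquiv.symm x).1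

/-- The union of the blocks indexed by `p`. -/
def outer {m : ℕ} (k : Fin m → ℕ) (p : Finset (Fin m)) : Finset (Fin (∑ i, k i)) :=
  Finset.univ.filter fun x => block k x ∈ p

/-- The copy inside the `i`-th block of a set of letters of a word of length `k_i`. -/
def inner {m : ℕ} (k : Fin m → ℕ) (i : Fin m) (q : Finset (Fin (k i))) :
    Finset (Fin (∑ i, k i)) :=
  q.map ⟨fun j => finSigmaFinEquiv ⟨i, j⟩, fun _ _ h => by simpa using h⟩

theorem mem_outer {m : ℕ} {k : Fin m → ℕ} {p : Finset (Fin m)} {x : Fin (∑ i, k i)} :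
    x ∈ outer k p ↔ block k x ∈ p := by
  simp [outer]

theorem mem_inner {m : ℕ} {k : Fin m → ℕ} {i : Fin m} {q : Finset (Fin (k i))}
    {x : Fin (∑ i, k i)} : x ∈ inner k i q ↔ ∃ j ∈ q, finSigmaFinEquiv ⟨i, j⟩ = x :=
  Finset.mem_map

theorem block_apply {m : ℕ} {k : Fin m → ℕ} (i : Fin m) (j : Fin (k i)) :
    block k (finSigmaFinEquiv ⟨i, j⟩) = i := by
  simp [block]

theorem exists_eq_apply {m : ℕ} {k : Fin m → ℕ} (x : Fin (∑ i, k i)) :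
    ∃ j : Fin (k (block k x)), finSigmaFinEquiv ⟨block k x, j⟩ = x :=
  ⟨(finSigmaFinEquiv.symm x).2, finSigmaFinEquiv.apply_symm_apply x⟩

theorem lt_of_block_lt {m : ℕ} {k : Fin m → ℕ} {x y : Fin (∑ i, k i)}
    (h : block k x < block k y) : x < y := by
  obtain ⟨j, hj⟩ := exists_eq_apply x
  obtain ⟨j', hj'⟩ := exists_eq_apply y
  rw [← hj, ← hj', Fin.lt_def, finSigmaFinEquiv_apply, finSigmaFinEquiv_apply]
  let f : ℕ → ℕ := fun t => if ht : t < m then k ⟨t, ht⟩ else 0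
  have key : ∀ i : Fin m, ∑ t : Fin i, k (Fin.castLE i.2.le t) = ∑ t ∈ Finset.range i, f t := by
    intro i
    rw [← Fin.sum_univ_eq_sum_range]
    refine Finset.sum_congr rfl fun t _ => ?_
    have : (t : ℕ) < m := t.2.trans i.2
    simp only [f, this, dif_pos]
    rfl
  have h1 : ∑ t ∈ Finset.range ((block k x : ℕ) + 1), f t
      ≤ ∑ t ∈ Finset.range (block k y : ℕ), f t :=
    Finset.sum_le_sum_of_subset (Finset.range_subset_range.2 h)
  have h2 : f (block k x) = k (block k x) := by simp [f]
  rw [Finset.sum_range_succ, h2] at h1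
  have h3 := j.2
  rw [← key, ← key] at h1
  dsimp only
  omega

theorem block_mono {m : ℕ} {k : Fin m → ℕ} {x y : Fin (∑ i, k i)} (h : x ≤ y) :
    block k x ≤ block k y := by
  by_contra hlt
  exact absurd (lt_of_block_lt (not_le.1 hlt)) (not_lt.2 h)

theorem apply_le_apply {m : ℕ} {k : Fin m → ℕ} (i : Fin m) (j j' : Fin (k i)) :
    (finSigmaFinEquiv ⟨i, j⟩ : Fin (∑ i, k i)) ≤ finSigmaFinEquiv ⟨i, j'⟩ ↔ j ≤ j' := by
  rw [Fin.le_def, finSigmaFinEquiv_apply, finSigmaFinEquiv_apply, Fin.le_def]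
  dsimp only
  omega

theorem inner_subset_outer {m : ℕ} {k : Fin m → ℕ} {i : Fin m} {p : Finset (Fin m)} (hi : i ∈ p)
    (q : Finset (Fin (k i))) : inner k i q ⊆ outer k p := by
  intro x hx
  obtain ⟨j, -, rfl⟩ := mem_inner.1 hx
  rwa [mem_outer, block_apply]

theorem inner_univ {m : ℕ} {k : Fin m → ℕ} (i : Fin m) :
    inner k i Finset.univ = outer k {i} := by
  refine (inner_subset_outer (Finset.mem_singleton_self i) _).antisymm fun x hx => ?_
  rw [mem_outer, Finset.mem_singleton] at hx
  obtain ⟨j, hj⟩ := exists_eq_apply x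
  subst hx
  exact mem_inner.2 ⟨j, Finset.mem_univ _, hj⟩

theorem outer_mono {m : ℕ} {k : Fin m → ℕ} {p q : Finset (Fin m)} (h : p ⊆ q) :
    outer k p ⊆ outer k q := fun _ hx => mem_outer.2 (h (mem_outer.1 hx))

theorem outer_univ {m : ℕ} {k : Fin m → ℕ} : outer k Finset.univ = Finset.univ := by
  ext x; simp [mem_outer]

/-- The sets of leaves above the nodes of `S` and of the `T_i`, seen in the tree obtained by
grafting the root of `T_i` to the `i`-th leaf of `S` for all `i`. -/
def graft {m : ℕ} {k : Fin m → ℕ} (S : PWord m) (T : ∀ i, PWord (k i)) :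
    Finset (Finset (Fin (∑ i, k i))) :=
  S.nodes.image (outer k) ∪ Finset.univ.biUnion fun i => (T i).nodes.image (inner k i)

theorem mem_graft {m : ℕ} {k : Fin m → ℕ} {S : PWord m} {T : ∀ i, PWord (k i)}
    {s : Finset (Fin (∑ i, k i))} :
    s ∈ graft S T ↔ (∃ p ∈ S.nodes, outer k p = s) ∨ ∃ i, ∃ q ∈ (T i).nodes, inner k i q = s := by
  simp [graft]

theorem nodes_nested {m : ℕ} {w : PWord m} {p q : Finset (Fin m)} (hp : p ∈ w.nodes)
    (hq : q ∈ w.nodes) : p ⊆ q ∨ q ⊆ p ∨ Disjoint p q := by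
  rcases Finset.mem_insert.1 hp with rfl | hp
  · exact Or.inr (Or.inl (Finset.subset_univ _))
  rcases Finset.mem_insert.1 hq with rfl | hq
  · exact Or.inl (Finset.subset_univ _)
  exact w.nested p hp q hq

theorem nodes_interval {m : ℕ} {w : PWord m} {p : Finset (Fin m)} (hp : p ∈ w.nodes)
    {x y z : Fin m} (hx : x ∈ p) (hz : z ∈ p) (hxy : x ≤ y) (hyz : y ≤ z) : y ∈ p := by
  rcases Finset.mem_insert.1 hp with rfl | hp
  · exact Finset.mem_univ _
  obtain ⟨a, b, rfl⟩ := w.interval p hp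
  rw [Finset.mem_Icc] at hx hz ⊢
  exact ⟨hx.1.trans hxy, hyz.trans hz.2⟩

theorem graft_interval {m : ℕ} {k : Fin m → ℕ} {S : PWord m} {T : ∀ i, PWord (k i)}
    {s : Finset (Fin (∑ i, k i))} (hs : s ∈ graft S T) {x y z : Fin (∑ i, k i)}
    (hx : x ∈ s) (hz : z ∈ s) (hxy : x ≤ y) (hyz : y ≤ z) : y ∈ s := by
  rcases mem_graft.1 hs with ⟨p, hp, rfl⟩ | ⟨i, q, hq, rfl⟩
  · rw [mem_outer] at hx hz ⊢
    exact nodes_interval hp hx hz (block_mono hxy) (block_mono hyz)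
  · obtain ⟨j, hj, rfl⟩ := mem_inner.1 hx
    obtain ⟨j', hj', rfl⟩ := mem_inner.1 hz
    have h1 := block_mono hxy
    have h2 := block_mono hyz
    rw [block_apply] at h1 h2
    obtain ⟨l, hl⟩ := exists_eq_apply y
    obtain rfl : i = block k y := le_antisymm h1 h2
    have hxy' := (apply_le_apply _ _ _).1 (hxy.trans hl.ge)
    have hyz' := (apply_le_apply _ _ _).1 (hl.le.trans hyz)
    exact mem_inner.2 ⟨l, nodes_interval hq hj hj' hxy' hyz', hl⟩

theorem inner_nested_outer {m : ℕ} {k : Fin m → ℕ} (i : Fin m) (q : Finset (Fin (k i)))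
    (p : Finset (Fin m)) : inner k i q ⊆ outer k p ∨ Disjoint (inner k i q) (outer k p) := by
  by_cases hi : i ∈ p
  · exact Or.inl (inner_subset_outer hi q)
  · right
    rw [Finset.disjoint_left]
    intro x hx hx'
    obtain ⟨j, -, rfl⟩ := mem_inner.1 hx
    rw [mem_outer, block_apply] at hx'
    exact hi hx'

theorem graft_nested {m : ℕ} {k : Fin m → ℕ} {S : PWord m} {T : ∀ i, PWord (k i)}
    {s t : Finset (Fin (∑ i, k i))} (hs : s ∈ graft S T) (ht : t ∈ graft S T) :
    s ⊆ t ∨ t ⊆ s ∨ Disjoint s t := by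
  rcases mem_graft.1 hs with ⟨p, hp, rfl⟩ | ⟨i, q, hq, rfl⟩ <;>
    rcases mem_graft.1 ht with ⟨p', hp', rfl⟩ | ⟨i', q', hq', rfl⟩
  · rcases nodes_nested hp hp' with h | h | h
    · exact Or.inl (outer_mono h)
    · exact Or.inr (Or.inl (outer_mono h))
    · right; right
      rw [Finset.disjoint_left]
      intro x hx hx'
      exact Finset.disjoint_left.1 h (mem_outer.1 hx) (mem_outer.1 hx')
  · rcases inner_nested_outer i' q' p with h | h
    · exact Or.inr (Or.inl h)
    · exact Or.inr (Or.inr h.symm)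
  · rcases inner_nested_outer i q p' with h | h
    · exact Or.inl h
    · exact Or.inr (Or.inr h)
  · by_cases hii : i = i'
    · subst hii
      rcases nodes_nested hq hq' with h | h | h
      · exact Or.inl (Finset.map_subset_map.2 h)
      · exact Or.inr (Or.inl (Finset.map_subset_map.2 h))
      · exact Or.inr (Or.inr ((Finset.disjoint_map _).2 h))
    · right; right
      rw [Finset.disjoint_left]
      intro x hx hx'
      obtain ⟨j, -, rfl⟩ := mem_inner.1 hx
      obtain ⟨j', -, h⟩ := mem_inner.1 hx'
      have := congrArg (block k) h
      rw [block_apply, block_apply] at this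
      exact hii this.symm

/-- Operadic composition: substitute the word `T_i` for the `i`-th letter of `S`. In terms of
trees, graft the root of `T_i` to the `i`-th leaf of `S`, delete this leaf if `k_i = 0`, and then
delete nodes without incoming edges and contract nodes with a single incoming edge. As a node is
represented by the set of leaves above it, this amounts to keeping the sets with at least two
elements (a node with a single incoming edge has the same leaves above it as that edge has), the
full set again not being recorded. -/
def comp {m : ℕ} {k : Fin m → ℕ} (S : PWord m) (T : ∀ i, PWord (k i)) : PWord (∑ i, k i) where
  parens := (graft S T).filter fun s => 2 ≤ s.card ∧ s.card < ∑ i, k i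
  interval := by
    intro s hs
    rw [Finset.mem_filter] at hs
    exact exists_eq_Icc (Finset.card_pos.1 (by omega))
      fun x hx z hz y hxy hyz => graft_interval hs.1 hx hz hxy hyz
  two_le := fun s hs => (Finset.mem_filter.1 hs).2.1
  card_lt := fun s hs => (Finset.mem_filter.1 hs).2.2
  nested := fun s hs t ht => graft_nested (Finset.mem_filter.1 hs).1 (Finset.mem_filter.1 ht).1

theorem nodes_mono {m : ℕ} {w w' : PWord m} (h : w ≤ w') : w'.nodes ⊆ w.nodes :=
  Finset.insert_subset_insert _ h

theorem comp_mono {m : ℕ} {k : Fin m → ℕ} {S S' : PWord m} {T T' : ∀ i, PWord (k i)}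
    (hS : S ≤ S') (hT : ∀ i, T i ≤ T' i) : comp S T ≤ comp S' T' := by
  refine Finset.filter_subset_filter _ fun s hs => ?_
  rcases mem_graft.1 hs with ⟨p, hp, rfl⟩ | ⟨i, q, hq, rfl⟩
  · exact mem_graft.2 (Or.inl ⟨p, nodes_mono hS hp, rfl⟩)
  · exact mem_graft.2 (Or.inr ⟨i, q, nodes_mono (hT i) hq, rfl⟩)

/-- A nonempty proper subset in `graft S T` is an edge of the composite. -/
theorem mem_edges_comp {m : ℕ} {k : Fin m → ℕ} {S : PWord m} {T : ∀ i, PWord (k i)}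
    {s : Finset (Fin (∑ i, k i))} (hs : s ∈ graft S T) (hne : s.Nonempty)
    (hlt : s ⊂ Finset.univ) : s ∈ (comp S T).edges := by
  have h1 : s.card < ∑ i, k i := by simpa using Finset.card_lt_card hlt
  rcases Nat.lt_or_ge s.card 2 with h2 | h2
  · have h3 := Finset.card_pos.2 hne
    obtain ⟨x, rfl⟩ := Finset.card_eq_one.1 (by omega : s.card = 1)
    exact mem_edges.2 (Or.inr ⟨x, rfl⟩)
  · exact mem_edges.2 (Or.inl (Finset.mem_filter.2 ⟨hs, h2, h1⟩))

theorem inner_mem_edges_comp {m : ℕ} {k : Fin m → ℕ} {S : PWord m} {T : ∀ i, PWord (k i)}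
    {i : Fin m} {q : Finset (Fin (k i))} (hq : q ∈ (T i).edges)
    (hlt : inner k i q ⊂ Finset.univ) : inner k i q ∈ (comp S T).edges := by
  rcases mem_edges.1 hq with h | ⟨j, rfl⟩
  · refine mem_edges_comp (mem_graft.2 (Or.inr ⟨i, q, Finset.mem_insert_of_mem h, rfl⟩)) ?_ hlt
    exact (Finset.map_nonempty).2 (edges_nonempty hq)
  · exact mem_edges.2 (Or.inr ⟨finSigmaFinEquiv ⟨i, j⟩, (Finset.map_singleton (⟨fun j => finSigmaFinEquiv ⟨i, j⟩,
      fun _ _ h => by simpa using h⟩ : Fin (k i) ↪ Fin (∑ i, k i)) j).symm⟩)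

theorem outer_mem_edges_comp {m : ℕ} {k : Fin m → ℕ} {S : PWord m} {T : ∀ i, PWord (k i)}
    {p : Finset (Fin m)} (hp : p ∈ S.edges) (hne : (outer k p).Nonempty)
    (hlt : outer k p ⊂ Finset.univ) : outer k p ∈ (comp S T).edges := by
  rcases mem_edges.1 hp with h | ⟨i, rfl⟩
  · exact mem_edges_comp (mem_graft.2 (Or.inl ⟨p, Finset.mem_insert_of_mem h, rfl⟩)) hne hlt
  · rw [← inner_univ] at hne hlt ⊢
    exact mem_edges_comp
      (mem_graft.2 (Or.inr ⟨i, Finset.univ, Finset.mem_insert_self _ _, rfl⟩)) hne hlt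

theorem card_inputs_inner_le {m : ℕ} {k : Fin m → ℕ} (S : PWord m) (T : ∀ i, PWord (k i))
    (i : Fin m) (q : Finset (Fin (k i))) :
    ((comp S T).inputs (inner k i q)).card ≤ ((T i).inputs q).card := by
  have key : ∀ c ∈ (comp S T).inputs (inner k i q), ∃ r ∈ (T i).inputs q, inner k i r = c := by
    intro c hc
    have hc' := Finset.mem_filter.1 hc
    obtain ⟨x, hx⟩ := edges_nonempty hc'.1
    obtain ⟨j, hj, rfl⟩ := mem_inner.1 (hc'.2.1.1 hx)
    have hq : q ≠ {j} := by
      rintro rfl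
      have h1 := Finset.card_lt_card hc'.2.1
      have h2 := Finset.card_pos.2 (edges_nonempty hc'.1)
      rw [inner, Finset.card_map, Finset.card_singleton] at h1
      omega
    obtain ⟨r, hr, hjr⟩ := exists_inputs (T i) hj hq
    have hr' := Finset.mem_filter.1 hr
    have hss : inner k i r ⊂ inner k i q := Finset.map_ssubset_map.2 hr'.2.1
    have hre : inner k i r ∈ (comp S T).edges :=
      inner_mem_edges_comp hr'.1 (hss.trans_subset (Finset.subset_univ _))
    refine ⟨r, hr, inputs_eq (Finset.mem_filter.2 ⟨hre, hss, ?_⟩) hc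
      (mem_inner.2 ⟨j, hjr, rfl⟩) hx⟩
    intro t ht hrt htq
    rcases mem_edges.1 ht with h | ⟨y, rfl⟩
    · rcases mem_graft.1 (Finset.mem_filter.1 h).1 with ⟨p, hp, rfl⟩ | ⟨i', q', hq', rfl⟩
      · have hi : i ∈ p := by
          have := hrt.1 (mem_inner.2 ⟨j, hjr, rfl⟩)
          rwa [mem_outer, block_apply] at this
        exact htq.2 (inner_subset_outer hi q)
      · have hii : i = i' := by
          obtain ⟨l, -, hl⟩ := mem_inner.1 (hrt.1 (mem_inner.2 ⟨j, hjr, rfl⟩))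
          have := congrArg (block k) hl
          rw [block_apply, block_apply] at this
          exact this.symm
        subst hii
        have h1 : r ⊂ q' := Finset.map_ssubset_map.1 hrt
        have h2 : q' ⊂ q := Finset.map_ssubset_map.1 htq
        refine hr'.2.2 q' ?_ h1 h2
        rcases Finset.mem_insert.1 hq' with rfl | hq''
        · exact absurd (Finset.subset_univ q) h2.2
        · exact mem_edges.2 (Or.inl hq'')
    · have h1 := Finset.card_lt_card hrt
      have h2 := Finset.card_pos.2 (edges_nonempty hre)
      rw [Finset.card_singleton] at h1
      omega
  choose! f hf using key
  refine Finset.card_le_card_of_injOn f (fun c hc => (hf c hc).1) ?_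
  intro c hc d hd hcd
  rw [← (hf c hc).2, ← (hf d hd).2, hcd]

theorem card_inputs_outer_le {m : ℕ} {k : Fin m → ℕ} (S : PWord m) (T : ∀ i, PWord (k i))
    {p : Finset (Fin m)} (hp : p ∈ S.nodes)
    (hmin : ∀ p' ∈ S.edges, p' ⊂ p → outer k p' ≠ outer k p) :
    ((comp S T).inputs (outer k p)).card ≤ (S.inputs p).card ∨ ∃ i, p = {i} := by
  by_cases hsing : ∃ i, p = {i}
  · exact Or.inr hsing
  left
  have key : ∀ c ∈ (comp S T).inputs (outer k p), ∃ r ∈ S.inputs p, outer k r = c := by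
    intro c hc
    have hc' := Finset.mem_filter.1 hc
    obtain ⟨x, hx⟩ := edges_nonempty hc'.1
    have hxp := mem_outer.1 (hc'.2.1.1 hx)
    obtain ⟨r, hr, hxr⟩ := exists_inputs S hxp (fun h => hsing ⟨_, h⟩)
    have hr' := Finset.mem_filter.1 hr
    have hss : outer k r ⊂ outer k p :=
      (outer_mono hr'.2.1.1).ssubset_of_ne (hmin r hr'.1 hr'.2.1)
    have hre : outer k r ∈ (comp S T).edges :=
      outer_mem_edges_comp hr'.1 ⟨x, mem_outer.2 hxr⟩ (hss.trans_subset (Finset.subset_univ _))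
    refine ⟨r, hr, inputs_eq (Finset.mem_filter.2 ⟨hre, hss, ?_⟩) hc (mem_outer.2 hxr) hx⟩
    intro t ht hrt htp
    rcases mem_edges.1 ht with h | ⟨y, rfl⟩
    · rcases mem_graft.1 (Finset.mem_filter.1 h).1 with ⟨s, hs, rfl⟩ | ⟨i', q', hq', rfl⟩
      · have hxs : block k x ∈ s := mem_outer.1 (hrt.1 (mem_outer.2 hxr))
        have hsp : s ⊂ p := by
          rcases nodes_nested hs hp with h1 | h1 | h1
          · refine h1.ssubset_of_ne ?_
            rintro rfl
            exact htp.2 (Finset.Subset.refl _)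
          · exact absurd (outer_mono h1) htp.2
          · exact absurd hxp (Finset.disjoint_left.1 h1 hxs)
        have hse : s ∈ S.edges := by
          rcases Finset.mem_insert.1 hs with rfl | hs'
          · exact absurd (Finset.subset_univ p) hsp.2
          · exact mem_edges.2 (Or.inl hs')
        have hrs : r ⊂ s := by
          rcases edges_nested hr'.1 hse with h1 | h1 | h1
          · refine h1.ssubset_of_ne ?_
            rintro rfl
            exact hrt.2 (Finset.Subset.refl _)
          · exact absurd (outer_mono h1) hrt.2
          · exact absurd hxs (Finset.disjoint_left.1 h1 hxr)
        exact hr'.2.2 s hse hrs hsp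
      · obtain ⟨l, -, hl⟩ := mem_inner.1 (hrt.1 (mem_outer.2 hxr))
        have hb := congrArg (block k) hl
        rw [block_apply] at hb
        exact hrt.2 (inner_subset_outer (hb ▸ hxr) q')
    · have h1 := Finset.card_lt_card hrt
      have h2 := Finset.card_pos.2 (edges_nonempty hre)
      rw [Finset.card_singleton] at h1
      omega
  choose! f hf using key
  refine Finset.card_le_card_of_injOn f (fun c hc => (hf c hc).1) ?_
  intro c hc d hd hcd
  rw [← (hf c hc).2, ← (hf d hd).2, hcd]

theorem InFiltration.comp {m : ℕ} {k : Fin m → ℕ} {n : ℕ∞} {S : PWord m} {T : ∀ i, PWord (k i)}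
    (hS : S.InFiltration n) (hT : ∀ i, (T i).InFiltration n) :
    (PWord.comp S T).InFiltration n := by
  intro s hs
  have hsg : s ∈ graft S T := by
    rcases Finset.mem_insert.1 hs with rfl | h
    · exact mem_graft.2 (Or.inl ⟨Finset.univ, Finset.mem_insert_self _ _, outer_univ⟩)
    · exact (Finset.mem_filter.1 h).1
  have hinner : ∀ (i : Fin m) (q : Finset (Fin (k i))), q ∈ (T i).nodes →
      (((PWord.comp S T).inputs (inner k i q)).card : ℕ∞) ≤ n := fun i q hq =>
    le_trans (by exact_mod_cast card_inputs_inner_le S T i q) (hT i q hq)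
  rcases mem_graft.1 hsg with ⟨p, hp, rfl⟩ | ⟨i, q, hq, rfl⟩
  · have hne : ((insert Finset.univ S.edges).filter fun p' => outer k p' = outer k p).Nonempty := by
      refine ⟨p, Finset.mem_filter.2 ⟨?_, rfl⟩⟩
      rcases Finset.mem_insert.1 hp with rfl | h
      · exact Finset.mem_insert_self _ _
      · exact Finset.mem_insert_of_mem (mem_edges.2 (Or.inl h))
    obtain ⟨p₀, hp₀, hmin⟩ := Finset.exists_min_image _ Finset.card hne
    rw [Finset.mem_filter] at hp₀
    rw [← hp₀.2]
    by_cases hsing : ∃ i, p₀ = {i}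
    · obtain ⟨i, rfl⟩ := hsing
      rw [← inner_univ]
      exact hinner i _ (Finset.mem_insert_self _ _)
    · have hp₀n : p₀ ∈ S.nodes := by
        rcases Finset.mem_insert.1 hp₀.1 with rfl | h
        · exact Finset.mem_insert_self _ _
        · rcases mem_edges.1 h with h | ⟨x, rfl⟩
          · exact Finset.mem_insert_of_mem h
          · exact absurd ⟨x, rfl⟩ hsing
      rcases card_inputs_outer_le S T hp₀n (by
        intro p' hp' hlt heq
        have := hmin p' (Finset.mem_filter.2 ⟨Finset.mem_insert_of_mem hp', heq.trans hp₀.2⟩)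
        exact absurd (Finset.card_lt_card hlt) (by omega)) with h | h
      · exact le_trans (by exact_mod_cast h) (hS p₀ hp₀n)
      · exact absurd h hsing
  · exact hinner i q hq

end PWord

/-- The `m`-th category (poset) of the `n`-th filtration of the associahedral operad; for `n = ⊤`
this is the poset of all parenthesized words of length `m`. -/
abbrev Assoc (n : ℕ∞) (m : ℕ) : Type := {w : PWord m // w.InFiltration n}

namespace Assoc

/-- The word `x₁ ⋯ x_m` as an object of the `n`-th filtration, for `m ≤ n`. -/
def corolla {n : ℕ∞} (m : ℕ) (h : (m : ℕ∞) ≤ n) : Assoc n m :=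
  ⟨PWord.corolla m, PWord.inFiltration_of_le h _⟩

/-- The word `x₁ ⋯ x_i (x_{i+1} ⋯ x_{i+j}) x_{i+j+1} ⋯ x_m` as an object of the `n`-th
filtration, for `m ≤ n`. -/
def bracket {n : ℕ∞} (i j m : ℕ) (h : (m : ℕ∞) ≤ n) : Assoc n m :=
  ⟨PWord.bracket i j m, PWord.inFiltration_of_le h _⟩

/-- The morphism which drops the only pair of parentheses. -/
def drop {n : ℕ∞} (i j m : ℕ) (h : (m : ℕ∞) ≤ n) : bracket i j m h ⟶ corolla m h :=
  homOfLE (PWord.bracket_le_corolla i j m)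

/-- The operad unit, the one-letter word. -/
def one (n : ℕ∞) : Assoc n 1 :=
  ⟨PWord.corolla 1, fun p _ => by
    have h : (PWord.corolla 1).inputs p = ∅ := by
      refine Finset.eq_empty_of_forall_notMem fun q hq => ?_
      have hq' := Finset.mem_filter.1 hq
      have h1 := Finset.card_pos.2 (PWord.edges_nonempty hq'.1)
      have h2 := Finset.card_lt_card hq'.2.1
      have h3 := Finset.card_le_univ p
      rw [Fintype.card_fin] at h3
      omega
    simp [h]⟩

/-- The composition functors `γ` of the operad. -/
def γ (n : ℕ∞) {m : ℕ} (k : Fin m → ℕ) :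
    (Assoc n m × ∀ i, Assoc n (k i)) ⥤ Assoc n (∑ i, k i) where
  obj W := ⟨W.1.1.comp fun i => (W.2 i).1, W.1.2.comp fun i => (W.2 i).2⟩
  map f := homOfLE (PWord.comp_mono (leOfHom f.1) fun i => leOfHom (f.2 i))

end Assoc

/-! ## Algebras -/

section Algebra

variable (C : Type u) [Category.{v} C]

/-- The functor `(A₁, …, A_m) ↦ (A_{f 1}, …, A_{f j})`. -/
def reindex {m j : ℕ} (f : Fin j → Fin m) : (Fin m → C) ⥤ (Fin j → C) :=
  Functor.pi' fun t => Pi.eval (fun _ : Fin m => C) (f t)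

/-- The functor sending `((S, (T_i)_i), A)` to `(T_i, A_i)`, where `A_i` is the `i`-th block of
`A`. -/
def blockFunctor (n : ℕ∞) {m : ℕ} (k : Fin m → ℕ) (i : Fin m) :
    (Assoc n m × ∀ i, Assoc n (k i)) × (Fin (∑ i, k i) → C) ⥤ Assoc n (k i) × (Fin (k i) → C) :=
  Functor.prod
    (CategoryTheory.Prod.snd (Assoc n m) (∀ i, Assoc n (k i)) ⋙ Pi.eval (fun i => Assoc n (k i)) i)
    (reindex C fun j => finSigmaFinEquiv ⟨i, j⟩)

/-- The structure of an algebra over the `n`-th filtration of the associahedral operad on the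
category `C`: action functors compatible with the unit and the composition of the operad. -/
@[ext]
structure AssocAlgebra (n : ℕ∞) where
  θ : ∀ m : ℕ, Assoc n m × (Fin m → C) ⥤ C
  /-- `θ₁(id, A) = A` -/
  unit : CategoryTheory.Prod.sectR (Assoc.one n) (Fin 1 → C) ⋙ θ 1 = Pi.eval (fun _ => C) 0
  /-- `θ(γ(S; T₁, …, T_m), A₁, …, A_m) = θ(S, θ(T₁, A₁), …, θ(T_m, A_m))` -/
  comp : ∀ (m : ℕ) (k : Fin m → ℕ),
    Functor.prod (Assoc.γ n k) (𝟭 (Fin (∑ i, k i) → C)) ⋙ θ (∑ i, k i) =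
      Functor.prod' (CategoryTheory.Prod.fst _ _ ⋙ CategoryTheory.Prod.fst (Assoc n m) (∀ i, Assoc n (k i)))
        (Functor.pi' fun i => blockFunctor C n k i ⋙ θ (k i)) ⋙ θ m

end Algebra

/-! ## `A_n`-monoidal categories -/

section Monoidal

variable {C : Type u} [Category.{v} C]

/-- For `i + j + k = m` and `i + 1 + k = p`, the letter of `x₁ ⋯ x_m` in position `t` after
`x_{i+1} ⋯ x_{i+j}` has been replaced by one new letter; `none` is the new letter. -/
def slot {i j k m p : ℕ} (hm : i + j + k = m) (hp : i + 1 + k = p) (t : Fin p) :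
    Option (Fin m) :=
  if h : (t : ℕ) < i then some ⟨t, by omega⟩
  else if h' : (t : ℕ) = i then none
  else some ⟨(t : ℕ) - 1 + j, by omega⟩

/-- The middle block `(A_{i+1}, …, A_{i+j})` of `(A₁, …, A_m)`. -/
def middle (C : Type u) [Category.{v} C] {i j k m : ℕ} (hm : i + j + k = m) :
    (Fin m → C) ⥤ (Fin j → C) :=
  reindex C fun t => ⟨i + t, by omega⟩

/-- The components of `Id^i × F × Id^k`. -/
def plugComponent {i j k m : ℕ} (hm : i + j + k = m) (F : (Fin j → C) ⥤ C) :
    Option (Fin m) → ((Fin m → C) ⥤ C)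
  | some s => Pi.eval (fun _ => C) s
  | none => middle C hm ⋙ F

/-- The functor `Id^i × F × Id^k : C^m ⥤ C^p`, where `F : C^j ⥤ C`, `m = i + j + k` and
`p = i + 1 + k`. -/
def plug (i j k : ℕ) {m p : ℕ} (hm : i + j + k = m) (hp : i + 1 + k = p) (F : (Fin j → C) ⥤ C) :
    (Fin m → C) ⥤ (Fin p → C) :=
  Functor.pi' fun t => plugComponent hm F (slot hm hp t)

/-- The components of `id^i × τ × id^k`. -/
def plugMapComponent {i j k m : ℕ} (hm : i + j + k = m) {F G : (Fin j → C) ⥤ C} (τ : F ⟶ G) :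
    ∀ s : Option (Fin m), plugComponent hm F s ⟶ plugComponent hm G s
  | some _ => 𝟙 _
  | none => Functor.whiskerLeft (middle C hm) τ

/-- The natural transformation `id^i × τ × id^k : Id^i × F × Id^k ⟶ Id^i × G × Id^k`. -/
def plugMap (i j k : ℕ) {m p : ℕ} (hm : i + j + k = m) (hp : i + 1 + k = p) {F G : (Fin j → C) ⥤ C}
    (τ : F ⟶ G) : plug i j k hm hp F ⟶ plug i j k hm hp G :=
  NatTrans.pi' fun t => plugMapComponent hm τ (slot hm hp t)

theorem le_mid {i j k m : ℕ} {n : ℕ∞} (hm : i + j + k = m) (h : (m : ℕ∞) ≤ n) : (j : ℕ∞) ≤ n :=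
  le_trans (by exact_mod_cast (by omega : j ≤ m)) h

theorem le_pred {m : ℕ} {n : ℕ∞} (h : ((m + 1 : ℕ) : ℕ∞) ≤ n) : (m : ℕ∞) ≤ n :=
  le_trans (by exact_mod_cast Nat.le_succ m) h

theorem zero_le_enat {n : ℕ∞} : ((0 : ℕ) : ℕ∞) ≤ n := by simp

/-- The structure of an `A_n`-monoidal category on `C`. To avoid transports along equalities of
natural numbers, the associator `α^{i,j,k}` takes, besides `i`, `j`, `k`, its arities
`m = i + j + k` and `p = i + 1 + k` together with these equations as arguments. Equality in
`Arrow C` means that the sources, the targets and (modulo these) the morphisms are equal. An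
object `(A₁, …, A_r)` of a product of powers of `C` is given as one object `X` of a power of `C`. -/
structure AnMonoidal (C : Type u) [Category.{v} C] (n : ℕ∞) where
  /-- the multiplications `μ_k : C^k ⥤ C` -/
  μ : ∀ k : ℕ, (k : ℕ∞) ≤ n → ((Fin k → C) ⥤ C)
  μ_one : ∀ h, μ 1 h = Pi.eval (fun _ => C) 0
  /-- `μ_p (Id^i × 0 × Id^j) = μ_{p-1}`, where `0` is `μ₀` -/
  μ_unit : ∀ {i j m p : ℕ} (hm : i + 0 + j = m) (hp : i + 1 + j = p) (hmn : (m : ℕ∞) ≤ n)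
    (hpn : (p : ℕ∞) ≤ n), plug i 0 j hm hp (μ 0 zero_le_enat) ⋙ μ p hpn = μ m hmn
  /-- `α^{i,j,k} : μ_{i+1+k} ∘ (Id^i × μ_j × Id^k) ⟶ μ_{i+j+k}` -/
  α : ∀ (i j k : ℕ) {m p : ℕ} (hm : i + j + k = m) (hp : i + 1 + k = p) (hmn : (m : ℕ∞) ≤ n)
    (hpn : (p : ℕ∞) ≤ n), plug i j k hm hp (μ j (le_mid hm hmn)) ⋙ μ p hpn ⟶ μ m hmn
  /-- condition (i) -/
  α_zero : ∀ {i k m p : ℕ} (hm : i + 0 + k = m) (hp : i + 1 + k = p) (hmn : (m : ℕ∞) ≤ n)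
    (hpn : (p : ℕ∞) ≤ n) (X : Fin m → C),
    Arrow.mk ((α i 0 k hm hp hmn hpn).app X) = Arrow.mk (𝟙 ((μ m hmn).obj X))
  /-- condition (i) -/
  α_one : ∀ {i k m p : ℕ} (hm : i + 1 + k = m) (hp : i + 1 + k = p) (hmn : (m : ℕ∞) ≤ n)
    (hpn : (p : ℕ∞) ≤ n) (X : Fin m → C),
    Arrow.mk ((α i 1 k hm hp hmn hpn).app X) = Arrow.mk (𝟙 ((μ m hmn).obj X))
  /-- condition (i) -/
  α_all : ∀ {j m p : ℕ} (hm : 0 + j + 0 = m) (hp : 0 + 1 + 0 = p) (hmn : (m : ℕ∞) ≤ n)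
    (hpn : (p : ℕ∞) ≤ n) (X : Fin m → C),
    Arrow.mk ((α 0 j 0 hm hp hmn hpn).app X) = Arrow.mk (𝟙 ((μ m hmn).obj X))
  /-- condition (ii): for `X = (A, B, C, D)`,
  `α^{a+b+1,c,d}` at `(A, 0, B, C, D)` is `α^{a+b,c,d}` at `X` -/
  α_unit_left : ∀ {a b c d m q : ℕ} (hm : a + b + c + d = m) (hq : a + b + 1 + d = q)
    (hmn : ((m + 1 : ℕ) : ℕ∞) ≤ n) (hqn : ((q + 1 : ℕ) : ℕ∞) ≤ n) (X : Fin m → C),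
    Arrow.mk ((α (a + b + 1) c d (by omega) (by omega) hmn hqn).app
        ((plug a 0 (b + c + d) (by omega) (by omega) (μ 0 zero_le_enat)).obj X)) =
      Arrow.mk ((α (a + b) c d hm hq (le_pred hmn) (le_pred hqn)).app X)
  /-- condition (iii): for `X = (A, B, C, D)`,
  `α^{a,b,c+d+1}` at `(A, B, C, 0, D)` is `α^{a,b,c+d}` at `X` -/
  α_unit_right : ∀ {a b c d m q : ℕ} (hm : a + b + (c + d) = m) (hq : a + 1 + (c + d) = q)
    (hmn : ((m + 1 : ℕ) : ℕ∞) ≤ n) (hqn : ((q + 1 : ℕ) : ℕ∞) ≤ n) (X : Fin m → C),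
    Arrow.mk ((α a b (c + d + 1) (by omega) (by omega) hmn hqn).app
        ((plug (a + b + c) 0 d (by omega) (by omega) (μ 0 zero_le_enat)).obj X)) =
      Arrow.mk ((α a b (c + d) hm hq (le_pred hmn) (le_pred hqn)).app X)
  /-- condition (iv): for `X = (A, B, C, D)`,
  `α^{a,b+c+1,d}` at `(A, B, 0, C, D)` is `α^{a,b+c,d}` at `X` -/
  α_unit_mid : ∀ {a b c d m q : ℕ} (hm : a + (b + c) + d = m) (hq : a + 1 + d = q)
    (hmn : ((m + 1 : ℕ) : ℕ∞) ≤ n) (hqn : (q : ℕ∞) ≤ n) (X : Fin m → C),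
    Arrow.mk ((α a (b + c + 1) d (by omega) hq hmn hqn).app
        ((plug (a + b) 0 (c + d) (by omega) (by omega) (μ 0 zero_le_enat)).obj X)) =
      Arrow.mk ((α a (b + c) d hm hq (le_pred hmn) hqn).app X)
  /-- condition (v), for `X = (A, B, C, D, E)`: the two ways
  `μ(A, μ_b B, C, μ_d D, E) ⟶ μ(A, B, C, D, E)` of removing two disjoint pairs of parentheses
  agree -/
  α_disjoint : ∀ {a b c d e m p q r : ℕ} (hm : a + b + c + d + e = m)
    (hp : a + b + c + 1 + e = p) (hq : a + 1 + c + d + e = q) (hr : a + 1 + c + 1 + e = r)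
    (hmn : (m : ℕ∞) ≤ n) (hpn : (p : ℕ∞) ≤ n) (hqn : (q : ℕ∞) ≤ n) (hrn : (r : ℕ∞) ≤ n)
    (hbn : (b : ℕ∞) ≤ n) (hdn : (d : ℕ∞) ≤ n) (X : Fin m → C),
    Arrow.mk
        ((α a b (c + 1 + e) (by omega) (by omega) hpn hrn).app
            ((plug (a + b + c) d e hm hp (μ d hdn)).obj X) ≫
          (α (a + b + c) d e hm hp hmn hpn).app X) =
      Arrow.mk
        ((α (a + 1 + c) d e hq hr hqn hrn).app
            ((plug a b (c + d + e) (by omega) (by omega) (μ b hbn)).obj X) ≫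
          (α a b (c + d + e) (by omega) (by omega) hmn hqn).app X)
  /-- condition (vi), for `X = (A, B, C, D, E)`: the two ways
  `μ(A, μ(B, μ_c C, D), E) ⟶ μ(A, B, C, D, E)` of removing two nested pairs of parentheses
  agree -/
  α_nested : ∀ {a b c d e m p q s t : ℕ} (hm : a + b + c + d + e = m)
    (hp : a + b + 1 + d + e = p) (hq : a + 1 + e = q) (hs : b + c + d = s) (ht : b + 1 + d = t)
    (hmn : (m : ℕ∞) ≤ n) (hpn : (p : ℕ∞) ≤ n) (hqn : (q : ℕ∞) ≤ n) (hsn : (s : ℕ∞) ≤ n)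
    (htn : (t : ℕ∞) ≤ n) (hcn : (c : ℕ∞) ≤ n) (X : Fin m → C),
    Arrow.mk
        ((μ q hqn).map ((plugMap a s e (by omega) hq (α b c d hs ht hsn htn)).app X) ≫
          (α a s e (by omega) hq hmn hqn).app X) =
      Arrow.mk
        ((α a t e (by omega) hq hpn hqn).app
            ((plug (a + b) c (d + e) (by omega) (by omega) (μ c hcn)).obj X) ≫
          (α (a + b) c (d + e) (by omega) (by omega) hmn hpn).app X)

end Monoidal

end Associahedral

/-! From algebras to `A_n`-monoidal structures (`AssocAlgebra.toMonoidal`), one restricts the action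
to corollas and to words with one pair of parentheses. By compatibility with partial composition
(`AssocAlgebra.app_subst`), every composite of associators in conditions (i)–(vi) is the action of a
single morphism of words. Words form posets, so two such morphisms agree as soon as their sources
and targets do, and this is a comparison of sets of intervals.

The restriction is injective (`AssocAlgebra.toMonoidal_injective`). Cutting a tree at an internal
edge writes a word as a substitution of two words with fewer parentheses. By induction the action on
`w ≤ w'` is thereby reduced to the case where `w'` is a corolla; there one factors through a word
with one pair of parentheses, whose removal is an associator.

The restriction is surjective because of a coherence argument. Choosing an order of removing
parentheses and proving independence of it is avoided by evaluating trees recursively. The basic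
objects are morphisms `c ⟶ μ(y₁, …, y_k)`, seen as operations with one input and a list of outputs
(`Mor`). A morphism `d ⟶ μ(y)` is substituted for an output `d` by whiskering it and then applying
an associator. Condition (v) and naturality make substitutions at different letters commute
(`ins_par`), condition (vi) makes nested ones associate (`ins_seq`), and together they give the
associativity of simultaneous substitution (`insAll_assoc`).

For `w ≤ w'` and an edge `p` of `w`, `eval` is a morphism from the value of `w` at `p` to the list
of the values of `w'` at the nearest edges. It is composed from the morphisms at the incoming edges
of `p`; if `p` is itself an edge of `w'`, the result is then regarded as a morphism to one object.
The incoming edges in `w'` arise from those in `w` by replacing each dropped edge by its own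
incoming edges in `w'` (`children_eq_flatMap`). Hence associativity gives functoriality by induction
on the tree (`isComp_eval`). The filtration enters through `length_children_le`: the lists that
occur have at most `n` members.

In the compatibility with `γ`, the difficulty comes from empty words. Grafting them deletes edges,
whose values are unit objects, and contracts nodes. The evaluation of the grafted tree then agrees
with the iterated evaluation only up to unit objects in the target lists. Strictness of the unit and
conditions (ii)–(iv) say that products and associators ignore these (`arrow_insAll_reduces`), which
yields `eval_outer` and, at the root, `arrow_eval_comp`. Finally, evaluating corollas and words with
one pair of parentheses gives back `μ` and `α` (`toMonoidal_toAlgebra`).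

Morphisms whose ends are only provably equal are compared in `Arrow C`, and tuples are compared
through the lists of their entries. -/

namespace Associahedral

/-! ### Tuples of objects and of morphisms as lists. -/

section Tuples

variable {C : Type u} [Category.{v} C]

theorem arrow_comp_congr {X Y Z X' Y' Z' : C} {f : X ⟶ Y} {g : Y ⟶ Z} {f' : X' ⟶ Y'}
    {g' : Y' ⟶ Z'} (hf : Arrow.mk f = Arrow.mk f') (hg : Arrow.mk g = Arrow.mk g') :
    Arrow.mk (f ≫ g) = Arrow.mk (f' ≫ g') := by
  cases hf
  cases hg
  rfl

theorem arrow_id_congr {X Y : C} (h : X = Y) : Arrow.mk (𝟙 X) = Arrow.mk (𝟙 Y) := by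
  rw [h]

theorem apply_of_ofFn_eq {α : Type*} {m : ℕ} {X : Fin m → α} {l : List α} (h : List.ofFn X = l)
    (s : ℕ) (hs : s < m) : X ⟨s, hs⟩ = l[s]'(by rw [← h]; simpa using hs) := by
  subst h
  simp

theorem length_of_ofFn_eq {α : Type*} {m : ℕ} {X : Fin m → α} {l : List α}
    (h : List.ofFn X = l) : l.length = m := by
  rw [← h, List.length_ofFn]

theorem eq_of_ofFn_eq {α : Type*} {m : ℕ} {X Y : Fin m → α} {l : List α} (hX : List.ofFn X = l)
    (hY : List.ofFn Y = l) : X = Y :=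
  List.ofFn_injective (hX.trans hY.symm)

theorem exists_ofFn_obj {α : Type*} (l : List α) {k : ℕ} (hk : l.length = k) :
    ∃ X : Fin k → α, List.ofFn X = l := by
  subst hk
  exact ⟨l.get, List.ofFn_get l⟩

/-- The list obtained from `x` by replacing a block in the middle by one letter. -/
theorem ofFn_slot {α : Type*} {i j k m p : ℕ} (hm : i + j + k = m) (hp : i + 1 + k = p)
    {x : Fin m → α} {z : Fin p → α} {a : α} {xs ys zs : List α} (hx : List.ofFn x = xs ++ ys ++ zs)
    (hi : xs.length = i) (hj : ys.length = j)
    (hz : ∀ t, z t = (slot hm hp t).elim a x) : List.ofFn z = xs ++ a :: zs := by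
  have hl := length_of_ofFn_eq hx
  simp only [List.length_append] at hl
  apply List.ext_getElem
  · simp; omega
  intro t h1 h2
  rw [List.getElem_ofFn, hz]
  unfold slot
  dsimp only
  split_ifs with h h'
  · rw [Option.elim_some, apply_of_ofFn_eq hx, List.getElem_append_left (by simp; omega),
      List.getElem_append_left (by omega), List.getElem_append_left (by omega)]
  · subst h'
    rw [Option.elim_none, List.getElem_append_right (by omega)]
    simp [hi]
  · rw [Option.elim_some, apply_of_ofFn_eq hx, List.getElem_append_right (by simp; omega),
      List.getElem_append_right (by omega), List.getElem_cons]
    rw [dif_neg (by omega)]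
    congr 1
    simp; omega

theorem ofFn_middle {α : Type*} {i j k m : ℕ} (hm : i + j + k = m) {x : Fin m → α}
    {xs ys zs : List α} (hx : List.ofFn x = xs ++ ys ++ zs) (hi : xs.length = i)
    (hj : ys.length = j) : List.ofFn (fun t : Fin j => x ⟨i + t, by omega⟩) = ys := by
  have hl := length_of_ofFn_eq hx
  simp only [List.length_append] at hl
  apply List.ext_getElem
  · simp; omega
  intro t h1 h2
  rw [List.getElem_ofFn, apply_of_ofFn_eq hx, List.getElem_append_left (by simp; omega),
    List.getElem_append_right (by simp; omega)]
  simp [hi]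

theorem ofFn_plug_obj {i j k m p : ℕ} (hm : i + j + k = m) (hp : i + 1 + k = p)
    (F : (Fin j → C) ⥤ C) {X : Fin m → C} {Y : Fin j → C} {xs ys zs : List C}
    (hX : List.ofFn X = xs ++ ys ++ zs) (hi : xs.length = i) (hY : List.ofFn Y = ys) :
    List.ofFn ((plug i j k hm hp F).obj X) = xs ++ F.obj Y :: zs := by
  have hj := length_of_ofFn_eq hY
  refine ofFn_slot hm hp hX hi hj fun t => ?_
  have hmid : (middle C hm).obj X = Y := eq_of_ofFn_eq (ofFn_middle hm hX hi hj) hY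
  change (plugComponent hm F (slot hm hp t)).obj X = _
  rcases slot hm hp t with _ | s
  · change F.obj ((middle C hm).obj X) = F.obj Y
    rw [hmid]
  · rfl

/-- A morphism of tuples is determined by its family of arrows, sources and targets included, so no
transport is needed to compare images. -/
theorem map_eq_of_arrows_eq {D : Type*} [Category D] {j : ℕ} (F : (Fin j → C) ⥤ D) {X X' Y Y' : Fin j → C}
    {f : X ⟶ X'} {g : Y ⟶ Y'} (h : (fun t => Arrow.mk (f t)) = fun t => Arrow.mk (g t)) :
    Arrow.mk (F.map f) = Arrow.mk (F.map g) := by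
  have h1 : X = Y := funext fun t => congrArg Arrow.leftFunc.obj (congrFun h t)
  have h2 : X' = Y' := funext fun t => congrArg Arrow.rightFunc.obj (congrFun h t)
  subst h1 h2
  have h3 : f = g := funext fun t => Arrow.mk_injective _ _ (congrFun h t)
  rw [h3]

theorem ofFn_plug_map {i j k m p : ℕ} (hm : i + j + k = m) (hp : i + 1 + k = p)
    (F : (Fin j → C) ⥤ C) {X X' : Fin m → C} {Y Y' : Fin j → C} {f : X ⟶ X'} {g : Y ⟶ Y'}
    {xs ys zs : List (Arrow C)} (hX : List.ofFn (fun t => Arrow.mk (f t)) = xs ++ ys ++ zs)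
    (hi : xs.length = i) (hY : List.ofFn (fun t => Arrow.mk (g t)) = ys) :
    List.ofFn (fun t => Arrow.mk ((plug i j k hm hp F).map f t)) =
      xs ++ Arrow.mk (F.map g) :: zs := by
  have hj := length_of_ofFn_eq hY
  refine ofFn_slot hm hp hX hi hj fun t => ?_
  have hmid : (fun t => Arrow.mk ((middle C hm).map f t)) = fun t => Arrow.mk (g t) :=
    eq_of_ofFn_eq (ofFn_middle hm hX hi hj) hY
  change Arrow.mk ((plugComponent hm F (slot hm hp t)).map f) = _
  rcases slot hm hp t with _ | s
  · exact map_eq_of_arrows_eq F hmid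
  · rfl

theorem ofFn_plugMap {i j k m p : ℕ} (hm : i + j + k = m) (hp : i + 1 + k = p)
    {F G : (Fin j → C) ⥤ C} (τ : F ⟶ G) {X : Fin m → C} {Y : Fin j → C} {xs ys zs : List C}
    (hX : List.ofFn X = xs ++ ys ++ zs) (hi : xs.length = i) (hY : List.ofFn Y = ys) :
    List.ofFn (fun t => Arrow.mk ((plugMap i j k hm hp τ).app X t)) =
      xs.map (fun c => Arrow.mk (𝟙 c)) ++ Arrow.mk (τ.app Y) :: zs.map (fun c => Arrow.mk (𝟙 c)) := by
  have hj := length_of_ofFn_eq hY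
  have hX' : List.ofFn (fun t => Arrow.mk (𝟙 (X t))) = xs.map (fun c => Arrow.mk (𝟙 c)) ++
      ys.map (fun c => Arrow.mk (𝟙 c)) ++ zs.map (fun c => Arrow.mk (𝟙 c)) := by
    rw [← List.map_append, ← List.map_append, ← hX, List.map_ofFn]
    rfl
  refine ofFn_slot hm hp hX' (by simpa using hi) (by simpa using hj) fun t => ?_
  have hmid : (middle C hm).obj X = Y := eq_of_ofFn_eq (ofFn_middle hm hX hi hj) hY
  change Arrow.mk ((plugMapComponent hm τ (slot hm hp t)).app X) = _
  rcases slot hm hp t with _ | s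
  · change Arrow.mk (τ.app ((middle C hm).obj X)) = Arrow.mk (τ.app Y)
    rw [hmid]
  · rfl

end Tuples

/-! ### The multiplications as operations on lists. -/

namespace AnMonoidal

variable {C : Type u} [Category.{v} C] {n : ℕ∞} (Q : AnMonoidal C n)

/-- The unit object. -/
def zero : C := (Q.μ 0 zero_le_enat).obj Fin.elim0

open Classical in
/-- The multiplications as one operation on lists; lists of more than `n` objects are sent to the
unit object. -/
def mu (l : List C) : C :=
  if h : (l.length : ℕ∞) ≤ n then (Q.μ l.length h).obj l.get else Q.zero

open Classical in
/-- The multiplications on lists of morphisms. -/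
def muA (fs : List (Arrow C)) : Arrow C :=
  if h : (fs.length : ℕ∞) ≤ n then
    Arrow.mk ((Q.μ fs.length h).map (X := fun i => (fs.get i).left)
      (Y := fun i => (fs.get i).right) fun i => (fs.get i).hom)
  else Arrow.mk (𝟙 Q.zero)

theorem mu_ofFn {k : ℕ} (h : (k : ℕ∞) ≤ n) {X : Fin k → C} {l : List C} (hl : List.ofFn X = l) :
    Q.mu l = (Q.μ k h).obj X := by
  have hk := length_of_ofFn_eq hl
  subst hk
  have : X = l.get := eq_of_ofFn_eq hl (List.ofFn_get l)
  rw [mu, dif_pos h, this]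

theorem mu_of_not_le {l : List C} (h : ¬ (l.length : ℕ∞) ≤ n) : Q.mu l = Q.zero := by
  rw [mu, dif_neg h]

theorem muA_ofFn {k : ℕ} (h : (k : ℕ∞) ≤ n) {X Y : Fin k → C} {f : X ⟶ Y} {fs : List (Arrow C)}
    (hf : List.ofFn (fun t => Arrow.mk (f t)) = fs) :
    Q.muA fs = Arrow.mk ((Q.μ k h).map f) := by
  have hk := length_of_ofFn_eq hf
  subst hk
  rw [muA, dif_pos h]
  apply map_eq_of_arrows_eq
  exact eq_of_ofFn_eq (List.ofFn_get fs) hf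

theorem exists_ofFn (fs : List (Arrow C)) {k : ℕ} (hk : fs.length = k) :
    ∃ (X Y : Fin k → C) (f : X ⟶ Y), List.ofFn (fun t => Arrow.mk (f t)) = fs := by
  subst hk
  exact ⟨fun i => (fs.get i).left, fun i => (fs.get i).right, fun i => (fs.get i).hom,
    List.ofFn_get fs⟩

theorem ofFn_left {k : ℕ} {X Y : Fin k → C} {f : X ⟶ Y} {fs : List (Arrow C)}
    (hf : List.ofFn (fun t => Arrow.mk (f t)) = fs) : List.ofFn X = fs.map (·.left) := by
  rw [← hf, List.map_ofFn]; rfl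

theorem ofFn_right {k : ℕ} {X Y : Fin k → C} {f : X ⟶ Y} {fs : List (Arrow C)}
    (hf : List.ofFn (fun t => Arrow.mk (f t)) = fs) : List.ofFn Y = fs.map (·.right) := by
  rw [← hf, List.map_ofFn]; rfl

theorem ofFn_id {k : ℕ} {X : Fin k → C} {l : List C}
    (hl : List.ofFn X = l) :
    List.ofFn (fun t => Arrow.mk (𝟙 X t)) = l.map fun c => Arrow.mk (𝟙 c) := by
  rw [← hl, List.map_ofFn]; rfl

/-- No bound on the length is required, because the default values of `mu` and `muA` match. -/
theorem muA_left (fs : List (Arrow C)) : (Q.muA fs).left = Q.mu (fs.map (·.left)) := by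
  by_cases h : (fs.length : ℕ∞) ≤ n
  · obtain ⟨X, Y, f, hf⟩ := exists_ofFn fs rfl
    rw [Q.muA_ofFn h hf, Q.mu_ofFn h (ofFn_left hf)]
    rfl
  · rw [muA, dif_neg h, mu_of_not_le _ (by simpa using h)]
    rfl

theorem muA_right (fs : List (Arrow C)) : (Q.muA fs).right = Q.mu (fs.map (·.right)) := by
  by_cases h : (fs.length : ℕ∞) ≤ n
  · obtain ⟨X, Y, f, hf⟩ := exists_ofFn fs rfl
    rw [Q.muA_ofFn h hf, Q.mu_ofFn h (ofFn_right hf)]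
    rfl
  · rw [muA, dif_neg h, mu_of_not_le _ (by simpa using h)]
    rfl

theorem muA_id (l : List C) :
    Q.muA (l.map fun c => Arrow.mk (𝟙 c)) = Arrow.mk (𝟙 (Q.mu l)) := by
  by_cases h : (l.length : ℕ∞) ≤ n
  · obtain ⟨X, hX⟩ := exists_ofFn_obj l rfl
    rw [Q.muA_ofFn h (f := 𝟙 X) (ofFn_id hX), CategoryTheory.Functor.map_id, Q.mu_ofFn h hX]
  · rw [muA, dif_neg (by simpa using h), mu_of_not_le _ h]

theorem mu_nil : Q.mu [] = Q.zero := Q.mu_ofFn zero_le_enat (by simp)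

theorem mu_singleton (h : ((1 : ℕ) : ℕ∞) ≤ n) (c : C) : Q.mu [c] = c := by
  rw [Q.mu_ofFn h (X := fun _ => c) (by simp), Q.μ_one h]
  rfl

theorem muA_singleton (h : ((1 : ℕ) : ℕ∞) ≤ n) (f : Arrow C) : Q.muA [f] = f := by
  rw [Q.muA_ofFn h (X := fun _ => f.left) (Y := fun _ => f.right) (f := fun _ => f.hom) (by simp),
    Q.μ_one h]
  rfl

/-- Strictness of the unit is an equality of functors, so it can be applied to morphisms as well as
to objects. -/
theorem muA_zero_mid {fs gs : List (Arrow C)} (h : (((fs ++ gs).length + 1 : ℕ) : ℕ∞) ≤ n) :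
    Q.muA (fs ++ Arrow.mk (𝟙 Q.zero) :: gs) = Q.muA (fs ++ gs) := by
  obtain ⟨X, Y, f, hf⟩ := exists_ofFn (fs ++ gs) rfl
  have hm : fs.length + 0 + gs.length = (fs ++ gs).length := by simp
  have hp : fs.length + 1 + gs.length = (fs ++ gs).length + 1 := by simp; omega
  rw [Q.muA_ofFn (le_pred h) hf, ← Q.μ_unit hm hp (le_pred h) h, Functor.comp_map]
  refine Q.muA_ofFn h ?_
  rw [ofFn_plug_map hm hp (Q.μ 0 zero_le_enat) (g := 𝟙 Fin.elim0) (ys := []) (by simpa using hf) rfl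
    (by simp), CategoryTheory.Functor.map_id]
  rfl

end AnMonoidal
end Associahedral

/-! ### The associators as operations on lists. -/

namespace Associahedral
namespace AnMonoidal

variable {C : Type u} [Category.{v} C] {n : ℕ∞} (Q : AnMonoidal C n)

open Classical in
/-- The associators at lists of objects. -/
def alA (xs ys zs : List C) : Arrow C :=
  if h : ((xs.length + ys.length + zs.length : ℕ) : ℕ∞) ≤ n ∧
      ((xs.length + 1 + zs.length : ℕ) : ℕ∞) ≤ n then
    Arrow.mk ((Q.α xs.length ys.length zs.length rfl rfl h.1 h.2).app
      fun t => (xs ++ ys ++ zs).get (Fin.cast (by simp [add_assoc]) t))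
  else Arrow.mk (𝟙 Q.zero)

theorem alA_ofFn {i j k m p : ℕ} {hm : i + j + k = m} {hp : i + 1 + k = p}
    {hmn : (m : ℕ∞) ≤ n} {hpn : (p : ℕ∞) ≤ n} {X : Fin m → C} {xs ys zs : List C}
    (hX : List.ofFn X = xs ++ ys ++ zs) (hi : xs.length = i) (hj : ys.length = j) :
    Q.alA xs ys zs = Arrow.mk ((Q.α i j k hm hp hmn hpn).app X) := by
  have hl := length_of_ofFn_eq hX
  simp only [List.length_append] at hl
  have hk : zs.length = k := by omega
  subst hi hj hk hm hp
  rw [alA, dif_pos ⟨hmn, hpn⟩]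
  have hX' : (fun t => (xs ++ ys ++ zs).get (Fin.cast (by simp [add_assoc]) t)) = X := ?_
  · rw [hX']
  refine eq_of_ofFn_eq ?_ hX
  apply List.ext_getElem
  · simp [add_assoc]
  · intro t _ _
    simp

theorem alA_left {xs ys zs : List C} (h : (((xs ++ ys ++ zs).length : ℕ) : ℕ∞) ≤ n)
    (h' : (((xs ++ Q.mu ys :: zs).length : ℕ) : ℕ∞) ≤ n) :
    (Q.alA xs ys zs).left = Q.mu (xs ++ Q.mu ys :: zs) := by
  obtain ⟨X, hX⟩ := exists_ofFn_obj (xs ++ ys ++ zs) rfl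
  obtain ⟨Y, hY⟩ := exists_ofFn_obj ys rfl
  have hm : xs.length + ys.length + zs.length = (xs ++ ys ++ zs).length := by simp [add_assoc]
  have hp : xs.length + 1 + zs.length = (xs ++ Q.mu ys :: zs).length := by simp; omega
  rw [Q.alA_ofFn (hm := hm) (hp := hp) (hmn := h) (hpn := h') hX rfl rfl]
  symm
  refine Q.mu_ofFn h' ?_
  rw [ofFn_plug_obj hm hp _ hX rfl hY, Q.mu_ofFn (le_mid hm h) hY]

theorem alA_right {xs ys zs : List C} (h : (((xs ++ ys ++ zs).length : ℕ) : ℕ∞) ≤ n)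
    (h' : (((xs ++ Q.mu ys :: zs).length : ℕ) : ℕ∞) ≤ n) :
    (Q.alA xs ys zs).right = Q.mu (xs ++ ys ++ zs) := by
  obtain ⟨X, hX⟩ := exists_ofFn_obj (xs ++ ys ++ zs) rfl
  have hm : xs.length + ys.length + zs.length = (xs ++ ys ++ zs).length := by simp [add_assoc]
  have hp : xs.length + 1 + zs.length = (xs ++ Q.mu ys :: zs).length := by simp; omega
  rw [Q.alA_ofFn (hm := hm) (hp := hp) (hmn := h) (hpn := h') hX rfl rfl]
  symm
  exact Q.mu_ofFn h hX

/-- Multiplication of a list of morphisms. -/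
def mapL (fs : List (Arrow C)) {src tgt : List C} (hs : src = fs.map (·.left))
    (ht : tgt = fs.map (·.right)) : Q.mu src ⟶ Q.mu tgt :=
  eqToHom (by rw [hs, muA_left]) ≫ (Q.muA fs).hom ≫ eqToHom (by rw [ht, muA_right])

/-- In `mapL` and `al` the lists at both ends are variables tied by equations, so composability does
not depend on how concatenations are bracketed. The price is a pair of `eqToHom`s, which disappear
in `Arrow C`. -/
theorem mk_mapL (fs : List (Arrow C)) {src tgt : List C} (hs : src = fs.map (·.left))
    (ht : tgt = fs.map (·.right)) : Arrow.mk (Q.mapL fs hs ht) = Q.muA fs := by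
  exact (Arrow.mk_eq_mk_iff _ (Q.muA fs).hom).2
    ⟨by rw [hs, muA_left], by rw [ht, muA_right], rfl⟩

/-- The associator at lists of objects. -/
def al (xs ys zs : List C) {src tgt : List C} (hs : src = xs ++ Q.mu ys :: zs)
    (ht : tgt = xs ++ ys ++ zs) (h : (tgt.length : ℕ∞) ≤ n) (h' : (src.length : ℕ∞) ≤ n) :
    Q.mu src ⟶ Q.mu tgt :=
  eqToHom (by subst hs ht; rw [alA_left _ h h']) ≫ (Q.alA xs ys zs).hom ≫
    eqToHom (by subst hs ht; rw [alA_right _ h h'])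

theorem mk_al (xs ys zs : List C) {src tgt : List C} (hs : src = xs ++ Q.mu ys :: zs)
    (ht : tgt = xs ++ ys ++ zs) (h : (tgt.length : ℕ∞) ≤ n) (h' : (src.length : ℕ∞) ≤ n) :
    Arrow.mk (Q.al xs ys zs hs ht h h') = Q.alA xs ys zs := by
  exact (Arrow.mk_eq_mk_iff _ (Q.alA xs ys zs).hom).2
    ⟨by subst hs ht; rw [alA_left _ h h'], by subst hs ht; rw [alA_right _ h (by assumption)], rfl⟩

/-- A list of composable pairs of morphisms is multiplied componentwise. -/
theorem mapL_comp (L : List (Σ X Y Z : C, (X ⟶ Y) × (Y ⟶ Z))) {fs gs es : List (Arrow C)}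
    (hf : fs = L.map fun a => Arrow.mk a.2.2.2.1) (hg : gs = L.map fun a => Arrow.mk a.2.2.2.2)
    (he : es = L.map fun a => Arrow.mk (a.2.2.2.1 ≫ a.2.2.2.2)) {l₁ l₂ l₃ : List C}
    (h₁ : l₁ = fs.map (·.left)) (h₂ : l₂ = fs.map (·.right)) (h₂' : l₂ = gs.map (·.left))
    (h₃ : l₃ = gs.map (·.right)) (h₁' : l₁ = es.map (·.left)) (h₃' : l₃ = es.map (·.right)) :
    Q.mapL fs h₁ h₂ ≫ Q.mapL gs h₂' h₃ = Q.mapL es h₁' h₃' := by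
  apply Arrow.mk_injective
  by_cases h : (L.length : ℕ∞) ≤ n
  · let f : (fun i : Fin L.length => (L.get i).1) ⟶ (fun i => (L.get i).2.1) :=
      fun i => (L.get i).2.2.2.1
    let g : (fun i : Fin L.length => (L.get i).2.1) ⟶ (fun i => (L.get i).2.2.1) :=
      fun i => (L.get i).2.2.2.2
    have key : ∀ F : (Σ X Y Z : C, (X ⟶ Y) × (Y ⟶ Z)) → Arrow C,
        List.ofFn (fun t => F (L.get t)) = L.map F := fun F => by
      conv_rhs => rw [← List.ofFn_get L, List.map_ofFn]
      rfl
    have e3 : Q.muA es = Arrow.mk ((Q.μ _ h).map (f ≫ g)) := by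
      rw [he]
      exact Q.muA_ofFn h (key fun a => Arrow.mk (a.2.2.2.1 ≫ a.2.2.2.2))
    rw [mk_mapL Q es, e3, Functor.map_comp]
    refine arrow_comp_congr ?_ ?_
    · rw [mk_mapL, hf]
      exact Q.muA_ofFn h (key fun a => Arrow.mk a.2.2.2.1)
    · rw [mk_mapL, hg]
      exact Q.muA_ofFn h (key fun a => Arrow.mk a.2.2.2.2)
  -- Beyond length `n` all three products are the default identity.
  · have e1 : Arrow.mk (Q.mapL fs h₁ h₂) = Arrow.mk (𝟙 Q.zero) := by
      rw [mk_mapL, muA, dif_neg (by simpa [hf] using h)]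
    have e2 : Arrow.mk (Q.mapL gs h₂' h₃) = Arrow.mk (𝟙 Q.zero) := by
      rw [mk_mapL, muA, dif_neg (by simpa [hg] using h)]
    rw [arrow_comp_congr e1 e2, mk_mapL, muA, dif_neg (by simpa [he] using h), Category.comp_id]

/-- Naturality of the associators. -/
theorem al_natural (fs gs es : List (Arrow C)) {xs ys zs xs' ys' zs' s t s' t' : List C}
    (hx : xs = fs.map (·.left)) (hy : ys = gs.map (·.left)) (hz : zs = es.map (·.left))
    (hx' : xs' = fs.map (·.right)) (hy' : ys' = gs.map (·.right)) (hz' : zs' = es.map (·.right))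
    (hs : s = xs ++ Q.mu ys :: zs) (ht : t = xs ++ ys ++ zs) (hs' : s' = xs' ++ Q.mu ys' :: zs')
    (ht' : t' = xs' ++ ys' ++ zs') (h : (t.length : ℕ∞) ≤ n) (h' : (s.length : ℕ∞) ≤ n)
    (k : (t'.length : ℕ∞) ≤ n) (k' : (s'.length : ℕ∞) ≤ n) 
    (a₁ : s = (fs ++ Q.muA gs :: es).map (·.left)) (a₂ : s' = (fs ++ Q.muA gs :: es).map (·.right))
    (a₃ : t = (fs ++ gs ++ es).map (·.left)) (a₄ : t' = (fs ++ gs ++ es).map (·.right)) :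
    Q.mapL (fs ++ Q.muA gs :: es) a₁ a₂ ≫ Q.al xs' ys' zs' hs' ht' k k' =
      Q.al xs ys zs hs ht h h' ≫ Q.mapL (fs ++ gs ++ es) a₃ a₄ := by
  apply Arrow.mk_injective
  obtain ⟨X, Y, f, hf⟩ := exists_ofFn (fs ++ gs ++ es) rfl
  obtain ⟨X', Y', g, hg⟩ := exists_ofFn gs rfl
  have e : (fs ++ gs ++ es).length = t.length := by rw [a₃]; simp
  have e' : fs.length + 1 + es.length = s.length := by rw [a₁]; simp; omega
  have hm : fs.length + gs.length + es.length = (fs ++ gs ++ es).length := by simp [add_assoc]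
  have hmn : ((fs ++ gs ++ es).length : ℕ∞) ≤ n := by rw [e]; exact h
  have hpn : ((fs.length + 1 + es.length : ℕ) : ℕ∞) ≤ n := by rw [e']; exact h'
  have hXl := ofFn_left hf
  have hXr := ofFn_right hf
  have nat := (Q.α fs.length gs.length es.length hm rfl hmn hpn).naturality f
  have e1 : Arrow.mk (Q.mapL (fs ++ Q.muA gs :: es) a₁ a₂) = Arrow.mk ((plug fs.length gs.length
      es.length hm rfl (Q.μ gs.length (le_mid hm hmn)) ⋙ Q.μ _ hpn).map f) := by
    rw [mk_mapL, Functor.comp_map]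
    refine Q.muA_ofFn hpn ?_
    rw [ofFn_plug_map hm rfl _ hf rfl hg, Q.muA_ofFn (le_mid hm hmn) hg]
  have e2 : Arrow.mk (Q.al xs' ys' zs' hs' ht' k k') =
      Arrow.mk ((Q.α fs.length gs.length es.length hm rfl hmn hpn).app Y) := by
    rw [mk_al]
    refine Q.alA_ofFn ?_ (by simp [hx']) (by simp [hy'])
    rw [hXr, hx', hy', hz']; simp
  have e3 : Arrow.mk (Q.al xs ys zs hs ht h h') =
      Arrow.mk ((Q.α fs.length gs.length es.length hm rfl hmn hpn).app X) := by
    rw [mk_al]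
    refine Q.alA_ofFn ?_ (by simp [hx]) (by simp [hy])
    rw [hXl, hx, hy, hz]; simp
  have e4 : Arrow.mk (Q.mapL (fs ++ gs ++ es) a₃ a₄) = Arrow.mk ((Q.μ _ hmn).map f) := by
    rw [mk_mapL, Q.muA_ofFn hmn hf]
  rw [arrow_comp_congr e1 e2, arrow_comp_congr e3 e4, nat]

/-! ### The conditions in terms of lists -/

theorem alA_nil {xs zs : List C} (h : (((xs ++ Q.zero :: zs).length : ℕ) : ℕ∞) ≤ n) :
    Q.alA xs [] zs = Arrow.mk (𝟙 (Q.mu (xs ++ zs))) := by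
  obtain ⟨X, hX⟩ := exists_ofFn_obj (xs ++ zs) rfl
  have hm : xs.length + 0 + zs.length = (xs ++ zs).length := by simp
  have hp : xs.length + 1 + zs.length = (xs ++ zs).length + 1 := by simp; omega
  have hpn : (((xs ++ zs).length + 1 : ℕ) : ℕ∞) ≤ n := by simpa [add_assoc] using h
  rw [Q.alA_ofFn (hm := hm) (hp := hp) (hmn := le_pred hpn) (hpn := hpn) (by simpa using hX) rfl rfl,
    Q.α_zero, Q.mu_ofFn (le_pred hpn) hX]

theorem alA_singleton {xs zs : List C} {y : C} (h : (((xs ++ y :: zs).length : ℕ) : ℕ∞) ≤ n) :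
    Q.alA xs [y] zs = Arrow.mk (𝟙 (Q.mu (xs ++ y :: zs))) := by
  obtain ⟨X, hX⟩ := exists_ofFn_obj (xs ++ y :: zs) rfl
  have hm : xs.length + 1 + zs.length = (xs ++ y :: zs).length := by simp; omega
  rw [Q.alA_ofFn (hm := hm) (hp := hm) (hmn := h) (hpn := h) (by simpa using hX) rfl rfl,
    Q.α_one, Q.mu_ofFn h hX]

theorem alA_all {ys : List C} (h : (ys.length : ℕ∞) ≤ n) (h' : ((1 : ℕ) : ℕ∞) ≤ n) :
    Q.alA [] ys [] = Arrow.mk (𝟙 (Q.mu ys)) := by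
  obtain ⟨X, hX⟩ := exists_ofFn_obj ys rfl
  rw [Q.alA_ofFn (i := 0) (j := ys.length) (k := 0) (hm := by simp) (hp := rfl) (hmn := h) (hpn := h') (by simpa using hX) rfl rfl,
    Q.α_all, Q.mu_ofFn h hX]

theorem alA_unit_left {as bs cs ds : List C}
    (hm : (((as ++ bs ++ cs ++ ds).length + 1 : ℕ) : ℕ∞) ≤ n)
    (hq : ((as.length + bs.length + 1 + ds.length + 1 : ℕ) : ℕ∞) ≤ n) :
    Q.alA (as ++ Q.zero :: bs) cs ds = Q.alA (as ++ bs) cs ds := by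
  obtain ⟨X, hX⟩ := exists_ofFn_obj (as ++ bs ++ cs ++ ds) rfl
  refine Eq.trans (Q.alA_ofFn ?_ (by simp; omega) rfl) ((Q.α_unit_left (a := as.length)
    (b := bs.length) (by simp [add_assoc]) rfl hm hq X).trans (Q.alA_ofFn hX (by simp) rfl).symm)
  rw [ofFn_plug_obj _ _ _ (xs := as) (ys := []) (zs := bs ++ cs ++ ds) (Y := Fin.elim0)
    (by simpa using hX) rfl (by simp)]
  simp [zero]

theorem alA_unit_right {as bs cs ds : List C}
    (hm : (((as ++ bs ++ cs ++ ds).length + 1 : ℕ) : ℕ∞) ≤ n)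
    (hq : ((as.length + 1 + (cs.length + ds.length) + 1 : ℕ) : ℕ∞) ≤ n) :
    Q.alA as bs (cs ++ Q.zero :: ds) = Q.alA as bs (cs ++ ds) := by
  obtain ⟨X, hX⟩ := exists_ofFn_obj (as ++ bs ++ cs ++ ds) rfl
  refine Eq.trans (Q.alA_ofFn ?_ rfl rfl) ((Q.α_unit_right (c := cs.length) (d := ds.length)
    (by simp [add_assoc]) rfl hm hq X).trans (Q.alA_ofFn (by rw [hX]; simp) rfl rfl).symm)
  rw [ofFn_plug_obj _ _ _ (xs := as ++ bs ++ cs) (ys := []) (zs := ds) (Y := Fin.elim0)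
    (by simpa using hX) (by simp [add_assoc]) (by simp)]
  simp [zero]

theorem alA_unit_mid {as bs cs ds : List C}
    (hm : (((as ++ bs ++ cs ++ ds).length + 1 : ℕ) : ℕ∞) ≤ n)
    (hq : ((as.length + 1 + ds.length : ℕ) : ℕ∞) ≤ n) :
    Q.alA as (bs ++ Q.zero :: cs) ds = Q.alA as (bs ++ cs) ds := by
  obtain ⟨X, hX⟩ := exists_ofFn_obj (as ++ bs ++ cs ++ ds) rfl
  refine Eq.trans (Q.alA_ofFn ?_ rfl (by simp; omega)) ((Q.α_unit_mid (b := bs.length)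
    (c := cs.length) (by simp [add_assoc]) rfl hm hq X).trans
    (Q.alA_ofFn (by rw [hX]; simp) rfl (by simp)).symm)
  rw [ofFn_plug_obj _ _ _ (xs := as ++ bs) (ys := []) (zs := cs ++ ds) (Y := Fin.elim0)
    (by simpa using hX) (by simp) (by simp)]
  simp [zero]

/-- Condition (v). -/
theorem al_disjoint {as bs cs ds es m p q r : List C} 
    (hm : m = as ++ bs ++ cs ++ ds ++ es) (hp : p = as ++ bs ++ cs ++ Q.mu ds :: es)
    (hq : q = as ++ Q.mu bs :: cs ++ ds ++ es) (hr : r = as ++ Q.mu bs :: cs ++ Q.mu ds :: es)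
    (hmn : (m.length : ℕ∞) ≤ n) (hpn : (p.length : ℕ∞) ≤ n) (hqn : (q.length : ℕ∞) ≤ n)
    (hrn : (r.length : ℕ∞) ≤ n) 
    (a₁ : r = as ++ Q.mu bs :: (cs ++ Q.mu ds :: es)) (a₂ : p = as ++ bs ++ (cs ++ Q.mu ds :: es))
    (a₃ : p = (as ++ bs ++ cs) ++ Q.mu ds :: es) (a₄ : m = (as ++ bs ++ cs) ++ ds ++ es)
    (b₁ : r = (as ++ Q.mu bs :: cs) ++ Q.mu ds :: es) (b₂ : q = (as ++ Q.mu bs :: cs) ++ ds ++ es)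
    (b₃ : q = as ++ Q.mu bs :: (cs ++ ds ++ es)) (b₄ : m = as ++ bs ++ (cs ++ ds ++ es)) :
    Q.al as bs (cs ++ Q.mu ds :: es) a₁ a₂ hpn hrn ≫ Q.al (as ++ bs ++ cs) ds es a₃ a₄ hmn hpn =
      Q.al (as ++ Q.mu bs :: cs) ds es b₁ b₂ hqn hrn ≫ 
        Q.al as bs (cs ++ ds ++ es) b₃ b₄ hmn hqn := by
  apply Arrow.mk_injective
  obtain ⟨X, hX⟩ := exists_ofFn_obj m rfl
  obtain ⟨Y, hY⟩ := exists_ofFn_obj bs rfl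
  obtain ⟨Z, hZ⟩ := exists_ofFn_obj ds rfl
  have lm : as.length + bs.length + cs.length + ds.length + es.length = m.length := by
    rw [hm]; simp [add_assoc]
  have lp : as.length + bs.length + cs.length + 1 + es.length = p.length := by
    rw [hp]; simp; omega
  have lq : as.length + 1 + cs.length + ds.length + es.length = q.length := by
    rw [hq]; simp; omega
  have lr : as.length + 1 + cs.length + 1 + es.length = r.length := by
    rw [hr]; simp; omega
  have hbn : (bs.length : ℕ∞) ≤ n := le_trans (by exact_mod_cast (by omega)) hmn
  have hdn : (ds.length : ℕ∞) ≤ n := le_trans (by exact_mod_cast (by omega)) hmn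
  have key := Q.α_disjoint lm lp lq lr hmn hpn hqn hrn hbn hdn X
  refine Eq.trans (arrow_comp_congr ?_ ?_) (key.trans (arrow_comp_congr ?_ ?_).symm)
  · rw [mk_al]
    refine Q.alA_ofFn ?_ rfl rfl
    rw [ofFn_plug_obj _ _ _ (xs := as ++ bs ++ cs) (zs := es) (hX.trans hm) (by simp [add_assoc]) hZ,
      Q.mu_ofFn hdn hZ]
    simp
  · rw [mk_al]
    exact Q.alA_ofFn (hX.trans hm) (by simp [add_assoc]) rfl
  · rw [mk_al]
    refine Q.alA_ofFn ?_ (by simp; omega) rfl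
    rw [ofFn_plug_obj _ _ _ (xs := as) (zs := cs ++ ds ++ es) (by rw [hX, hm]; simp) rfl hY,
      Q.mu_ofFn hbn hY]
    simp
  · rw [mk_al]
    exact Q.alA_ofFn (by rw [hX, hm]; simp) rfl rfl

/-- Condition (vi). The inner associator leads from the product of `t` to that of `s`. -/
theorem al_nested {as bs cs ds es m p q s t : List C}
    (hm : m = as ++ bs ++ cs ++ ds ++ es) (hs : s = bs ++ cs ++ ds) (ht : t = bs ++ Q.mu cs :: ds)
    (hmn : (m.length : ℕ∞) ≤ n) (hpn : (p.length : ℕ∞) ≤ n) (hqn : (q.length : ℕ∞) ≤ n)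
    (hsn : (s.length : ℕ∞) ≤ n) (htn : (t.length : ℕ∞) ≤ n) {q' : List C} 
    (hqn' : (q'.length : ℕ∞) ≤ n)
    (c₁ : q' = ((as.map fun c => Arrow.mk (𝟙 c)) ++ Q.alA bs cs ds ::
      es.map fun c => Arrow.mk (𝟙 c)).map (·.left))
    (c₂ : q = ((as.map fun c => Arrow.mk (𝟙 c)) ++ Q.alA bs cs ds ::
      es.map fun c => Arrow.mk (𝟙 c)).map (·.right))
    (a₁ : q = as ++ Q.mu s :: es) (a₂ : m = as ++ s ++ es)
    (b₁ : q' = as ++ Q.mu t :: es) (b₂ : p = as ++ t ++ es)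
    (b₃ : p = (as ++ bs) ++ Q.mu cs :: (ds ++ es)) (b₄ : m = (as ++ bs) ++ cs ++ (ds ++ es)) :
    Q.mapL ((as.map fun c => Arrow.mk (𝟙 c)) ++ Q.alA bs cs ds ::
        es.map fun c => Arrow.mk (𝟙 c)) c₁ c₂ ≫ Q.al as s es a₁ a₂ hmn hqn =
      Q.al as t es b₁ b₂ hpn hqn' ≫ Q.al (as ++ bs) cs (ds ++ es) b₃ b₄ hmn hpn := by
  apply Arrow.mk_injective
  obtain ⟨X, hX⟩ := exists_ofFn_obj m rfl
  obtain ⟨Y, hY⟩ := exists_ofFn_obj s rfl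
  obtain ⟨Z, hZ⟩ := exists_ofFn_obj cs rfl
  have lm : as.length + bs.length + cs.length + ds.length + es.length = m.length := by
    rw [hm]; simp [add_assoc]
  have lp : as.length + bs.length + 1 + ds.length + es.length = p.length := by
    rw [b₃]; simp; omega
  have lq : as.length + 1 + es.length = q.length := by
    rw [a₁]; simp; omega
  have ls : bs.length + cs.length + ds.length = s.length := by
    rw [hs]; simp [add_assoc]
  have lt : bs.length + 1 + ds.length = t.length := by
    rw [ht]; simp; omega
  have hcn : (cs.length : ℕ∞) ≤ n := le_trans (by exact_mod_cast (by omega)) hmn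
  have key := Q.α_nested lm lp lq ls lt hmn hpn hqn hsn htn hcn X
  refine Eq.trans (arrow_comp_congr ?_ ?_) (key.trans (arrow_comp_congr ?_ ?_).symm)
  · rw [mk_mapL]
    refine Q.muA_ofFn hqn ?_
    rw [ofFn_plugMap _ _ _ (hX.trans a₂) rfl hY]
    congr 2
    exact (Q.alA_ofFn (hY.trans hs) rfl rfl).symm
  · rw [mk_al]
    exact Q.alA_ofFn (hX.trans a₂) rfl rfl
  · rw [mk_al]
    refine Q.alA_ofFn ?_ rfl rfl
    rw [ofFn_plug_obj _ _ _ (hX.trans b₄) (by simp) hZ, ← Q.mu_ofFn hcn hZ, ← b₃, b₂]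
  · rw [mk_al]
    exact Q.alA_ofFn (hX.trans b₄) (by simp) rfl

end AnMonoidal
end Associahedral

/-! ### Whiskering, and substitution of one morphism for a letter. -/

namespace Associahedral

theorem cast_le_of_le {a b : ℕ} {n : ℕ∞} (h : (b : ℕ∞) ≤ n) (hab : a ≤ b) : (a : ℕ∞) ≤ n :=
  le_trans (by exact_mod_cast hab) h

namespace AnMonoidal

variable {C : Type u} [Category.{v} C] {n : ℕ∞} (Q : AnMonoidal C n)

/-- A list of identity morphisms. -/
def idl (xs : List C) : List (Arrow C) := xs.map fun c => Arrow.mk (𝟙 c)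

@[simp]
theorem idl_left (xs : List C) : (idl xs).map (·.left) = xs := by
  simp [idl, Function.comp_def]

@[simp]
theorem idl_right (xs : List C) : (idl xs).map (·.right) = xs := by
  simp [idl, Function.comp_def]

@[simp]
theorem idl_append (xs ys : List C) : idl (xs ++ ys) = idl xs ++ idl ys := by
  simp [idl]

@[simp]
theorem idl_cons (x : C) (ys : List C) : idl (x :: ys) = Arrow.mk (𝟙 x) :: idl ys := by
  simp [idl]

/-- Multiplication of one morphism with identity morphisms. -/
def wh (xs : List C) {c d : C} (f : c ⟶ d) (zs : List C) {src tgt : List C}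
    (hs : src = xs ++ c :: zs) (ht : tgt = xs ++ d :: zs) : Q.mu src ⟶ Q.mu tgt :=
  Q.mapL (idl xs ++ Arrow.mk f :: idl zs) (by simp [hs]) (by simp [ht])

theorem mk_wh (xs : List C) {c d : C} (f : c ⟶ d) (zs : List C) {src tgt : List C}
    (hs : src = xs ++ c :: zs) (ht : tgt = xs ++ d :: zs) :
    Arrow.mk (Q.wh xs f zs hs ht) = Q.muA (idl xs ++ Arrow.mk f :: idl zs) :=
  Q.mk_mapL _ _ _

theorem mapL_congr {fs gs : List (Arrow C)} (h : fs = gs) {src tgt : List C}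
    (hs : src = fs.map (·.left)) (ht : tgt = fs.map (·.right)) :
    Q.mapL fs hs ht = Q.mapL gs (h ▸ hs) (h ▸ ht) := by
  subst h
  rfl

/-- The composable pairs of identity morphisms. -/
def idPairs (xs : List C) : List (Σ X Y Z : C, (X ⟶ Y) × (Y ⟶ Z)) :=
  xs.map fun c => ⟨c, c, c, 𝟙 c, 𝟙 c⟩

theorem wh_comp (xs : List C) {c d e : C} (f : c ⟶ d) (g : d ⟶ e) (zs : List C)
    {l₁ l₂ l₃ : List C} (h₁ : l₁ = xs ++ c :: zs) (h₂ : l₂ = xs ++ d :: zs)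
    (h₃ : l₃ = xs ++ e :: zs) :
    Q.wh xs f zs h₁ h₂ ≫ Q.wh xs g zs h₂ h₃ = Q.wh xs (f ≫ g) zs h₁ h₃ :=
  Q.mapL_comp (idPairs xs ++ ⟨c, d, e, f, g⟩ :: idPairs zs) (by simp [idPairs, idl, Function.comp_def])
    (by simp [idPairs, idl, Function.comp_def]) (by simp [idPairs, idl, Function.comp_def]) _ _ _ _ _ _

theorem wh_id (xs : List C) (c : C) (zs : List C) {src : List C} (hs : src = xs ++ c :: zs) :
    Q.wh xs (𝟙 c) zs hs hs = 𝟙 _ := by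
  apply Arrow.mk_injective
  rw [mk_wh, ← Q.muA_id, hs]
  congr 1
  simp [idl]

/-- Interchange law: by functoriality of the multiplication, both composites are the product of the
list in which `f` and `g` occur together. -/
theorem wh_swap (xs : List C) {c d c' d' : C} (f : c ⟶ d) (g : c' ⟶ d') (ys zs : List C)
    {l₁ l₂ l₃ l₄ : List C} (h₁ : l₁ = xs ++ c :: (ys ++ c' :: zs))
    (h₂ : l₂ = xs ++ d :: (ys ++ c' :: zs)) (h₂' : l₂ = (xs ++ d :: ys) ++ c' :: zs)
    (h₄ : l₄ = (xs ++ d :: ys) ++ d' :: zs) (h₁' : l₁ = (xs ++ c :: ys) ++ c' :: zs)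
    (h₃ : l₃ = (xs ++ c :: ys) ++ d' :: zs) (h₃' : l₃ = xs ++ c :: (ys ++ d' :: zs))
    (h₄' : l₄ = xs ++ d :: (ys ++ d' :: zs)) :
    Q.wh xs f (ys ++ c' :: zs) h₁ h₂ ≫ Q.wh (xs ++ d :: ys) g zs h₂' h₄ =
      Q.wh (xs ++ c :: ys) g zs h₁' h₃ ≫ Q.wh xs f (ys ++ d' :: zs) h₃' h₄' := by
  have e1 := Q.mapL_comp
    (idPairs xs ++ ⟨c, d, d, f, 𝟙 d⟩ :: (idPairs ys ++ ⟨c', c', d', 𝟙 c', g⟩ :: idPairs zs))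
    (fs := idl xs ++ Arrow.mk f :: idl (ys ++ c' :: zs))
    (gs := idl (xs ++ d :: ys) ++ Arrow.mk g :: idl zs)
    (es := idl xs ++ Arrow.mk f :: idl ys ++ Arrow.mk g :: idl zs) (l₁ := l₁) (l₂ := l₂) (l₃ := l₄)
    (by simp [idPairs, idl, Function.comp_def]) (by simp [idPairs, idl, Function.comp_def]) (by simp [idPairs, idl, Function.comp_def])
    (by simp [h₁]) (by simp [h₂]) (by simp [h₂]) (by simp [h₄]) (by simp [h₁]) (by simp [h₄])
  have e2 := Q.mapL_comp
    (idPairs xs ++ ⟨c, c, d, 𝟙 c, f⟩ :: (idPairs ys ++ ⟨c', d', d', g, 𝟙 d'⟩ :: idPairs zs))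
    (fs := idl (xs ++ c :: ys) ++ Arrow.mk g :: idl zs)
    (gs := idl xs ++ Arrow.mk f :: idl (ys ++ d' :: zs))
    (es := idl xs ++ Arrow.mk f :: idl ys ++ Arrow.mk g :: idl zs) (l₁ := l₁) (l₂ := l₃) (l₃ := l₄)
    (by simp [idPairs, idl, Function.comp_def]) (by simp [idPairs, idl, Function.comp_def]) (by simp [idPairs, idl, Function.comp_def])
    (by simp [h₁]) (by simp [h₃]) (by simp [h₃]) (by simp [h₄]) (by simp [h₁]) (by simp [h₄])
  exact e1.trans e2.symm

/-- Naturality of the associator in a letter before the bracketed block. -/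
theorem al_wh_pre (xs : List C) {c d : C} (f : c ⟶ d) (xs' ys zs : List C) {s t s' t' : List C}
    (a₁ : s = xs ++ c :: (xs' ++ Q.mu ys :: zs)) (a₂ : s' = xs ++ d :: (xs' ++ Q.mu ys :: zs))
    (a₃ : s' = (xs ++ d :: xs') ++ Q.mu ys :: zs) (a₄ : t' = (xs ++ d :: xs') ++ ys ++ zs)
    (b₁ : s = (xs ++ c :: xs') ++ Q.mu ys :: zs) (b₂ : t = (xs ++ c :: xs') ++ ys ++ zs)
    (b₃ : t = xs ++ c :: (xs' ++ ys ++ zs)) (b₄ : t' = xs ++ d :: (xs' ++ ys ++ zs))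
    (h : (t.length : ℕ∞) ≤ n) (h' : (s.length : ℕ∞) ≤ n)
    (k : (t'.length : ℕ∞) ≤ n) (k' : (s'.length : ℕ∞) ≤ n) :
    Q.wh xs f (xs' ++ Q.mu ys :: zs) a₁ a₂ ≫ Q.al (xs ++ d :: xs') ys zs a₃ a₄ k k' =
      Q.al (xs ++ c :: xs') ys zs b₁ b₂ h h' ≫ Q.wh xs f (xs' ++ ys ++ zs) b₃ b₄ := by
  have e : Q.muA (idl ys) = Arrow.mk (𝟙 (Q.mu ys)) := Q.muA_id ys
  have := Q.al_natural (idl xs ++ Arrow.mk f :: idl xs') (idl ys) (idl zs) (by simp) (by simp)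
    (by simp) (by simp) (by simp) (by simp) b₁ b₂ a₃ a₄ h h' k k' (by simp [e, a₁])
    (by simp [e, a₂]) (by simp [b₂]) (by simp [a₄])
  refine Eq.trans ?_ (this.trans ?_)
  · rw [wh, Q.mapL_congr]
    simp [e]
  · rw [wh, Q.mapL_congr]
    simp

/-- Naturality of the associator in a letter after the bracketed block. -/
theorem al_wh_post (xs ys zs : List C) {c d : C} (f : c ⟶ d) (zs' : List C) {s t s' t' : List C}
    (a₁ : s = (xs ++ Q.mu ys :: zs) ++ c :: zs') (a₂ : s' = (xs ++ Q.mu ys :: zs) ++ d :: zs')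
    (a₃ : s' = xs ++ Q.mu ys :: (zs ++ d :: zs')) (a₄ : t' = xs ++ ys ++ (zs ++ d :: zs'))
    (b₁ : s = xs ++ Q.mu ys :: (zs ++ c :: zs')) (b₂ : t = xs ++ ys ++ (zs ++ c :: zs'))
    (b₃ : t = (xs ++ ys ++ zs) ++ c :: zs') (b₄ : t' = (xs ++ ys ++ zs) ++ d :: zs')
    (h : (t.length : ℕ∞) ≤ n) (h' : (s.length : ℕ∞) ≤ n)
    (k : (t'.length : ℕ∞) ≤ n) (k' : (s'.length : ℕ∞) ≤ n) :
    Q.wh (xs ++ Q.mu ys :: zs) f zs' a₁ a₂ ≫ Q.al xs ys (zs ++ d :: zs') a₃ a₄ k k' =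
      Q.al xs ys (zs ++ c :: zs') b₁ b₂ h h' ≫ Q.wh (xs ++ ys ++ zs) f zs' b₃ b₄ := by
  have e : Q.muA (idl ys) = Arrow.mk (𝟙 (Q.mu ys)) := Q.muA_id ys
  have := Q.al_natural (idl xs) (idl ys) (idl zs ++ Arrow.mk f :: idl zs') (by simp) (by simp)
    (by simp) (by simp) (by simp) (by simp) b₁ b₂ a₃ a₄ h h' k k' (by simp [e, a₁])
    (by simp [e, a₂]) (by simp [b₂]) (by simp [a₄])
  refine Eq.trans ?_ (this.trans ?_)
  · rw [wh, Q.mapL_congr]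
    simp [e]
  · rw [wh, Q.mapL_congr]
    simp

/-- Naturality of the associator in a letter inside the bracketed block. -/
theorem al_wh_mid (xs ys : List C) {c d : C} (f : c ⟶ d) (ys' zs : List C)
    {s t s' t' y y' : List C} (hy : y = ys ++ c :: ys') (hy' : y' = ys ++ d :: ys')
    (a₁ : s = xs ++ Q.mu y :: zs) (a₂ : s' = xs ++ Q.mu y' :: zs) (a₄ : t' = xs ++ y' ++ zs)
    (b₂ : t = xs ++ y ++ zs)
    (b₃ : t = (xs ++ ys) ++ c :: (ys' ++ zs)) (b₄ : t' = (xs ++ ys) ++ d :: (ys' ++ zs))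
    (h : (t.length : ℕ∞) ≤ n) (h' : (s.length : ℕ∞) ≤ n)
    (k : (t'.length : ℕ∞) ≤ n) (k' : (s'.length : ℕ∞) ≤ n) :
    Q.wh xs (Q.wh ys f ys' hy hy') zs a₁ a₂ ≫ Q.al xs y' zs a₂ a₄ k k' =
      Q.al xs y zs a₁ b₂ h h' ≫ Q.wh (xs ++ ys) f (ys' ++ zs) b₃ b₄ := by
  have e := Q.mk_wh ys f ys' hy hy'
  have := Q.al_natural (idl xs) (idl ys ++ Arrow.mk f :: idl ys') (idl zs) (by simp)
    (by simpa using hy) (by simp) (by simp) (by simpa using hy') (by simp) a₁ b₂ a₂ a₄ h h' k k'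
    (by simp [← e, a₁]) (by simp [← e, a₂]) (by simp [b₂, hy]) (by simp [a₄, hy'])
  refine Eq.trans ?_ (this.trans ?_)
  · rw [wh, Q.mapL_congr]
    simp [e]
  · rw [wh, Q.mapL_congr]
    simp

theorem wh_al (as bs cs ds es : List C) {m p q q' s t : List C} (hs : s = bs ++ cs ++ ds)
    (ht : t = bs ++ Q.mu cs :: ds) (hmn : (m.length : ℕ∞) ≤ n) (hpn : (p.length : ℕ∞) ≤ n)
    (hqn : (q.length : ℕ∞) ≤ n) (hsn : (s.length : ℕ∞) ≤ n) (htn : (t.length : ℕ∞) ≤ n)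
    (hqn' : (q'.length : ℕ∞) ≤ n) (a₁ : q = as ++ Q.mu s :: es) (a₂ : m = as ++ s ++ es)
    (b₁ : q' = as ++ Q.mu t :: es) (b₂ : p = as ++ t ++ es)
    (b₃ : p = (as ++ bs) ++ Q.mu cs :: (ds ++ es)) (b₄ : m = (as ++ bs) ++ cs ++ (ds ++ es)) :
    Q.wh as (Q.al bs cs ds ht hs hsn htn) es b₁ a₁ ≫ Q.al as s es a₁ a₂ hmn hqn =
      Q.al as t es b₁ b₂ hpn hqn' ≫ Q.al (as ++ bs) cs (ds ++ es) b₃ b₄ hmn hpn := by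
  have e := Q.mk_al bs cs ds ht hs hsn htn
  have e1 : (idl as ++ Q.alA bs cs ds :: idl es).map (·.left) = q' := by simp [← e, b₁]
  have e2 : (idl as ++ Q.alA bs cs ds :: idl es).map (·.right) = q := by simp [← e, a₁]
  refine Eq.trans ?_ (Q.al_nested (by simp [a₂, hs]) hs ht hmn hpn hqn hsn htn hqn' e1.symm e2.symm
    a₁ a₂ b₁ b₂ b₃ b₄)
  rw [wh, Q.mapL_congr]
  rw [e]
  rfl

/-- A morphism from an object to the product of a nonempty list of at most `n` objects. -/
structure Mor where
  c : C
  y : List C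
  -- Substituting a nonempty list for a letter never shortens a list. Hence a bound on the last list
  -- of a composite bounds all earlier ones, and the associators involved are defined.
  ne : y ≠ []
  le : (y.length : ℕ∞) ≤ n
  φ : c ⟶ Q.mu y

variable {Q}

/-- Composition of `φ : c ⟶ μ(pre, d, post)` with `ψ : d ⟶ μ(y)`. -/
def ins {c : C} {src tgt : List C} (pre : List C) (ψ : Q.Mor) (post : List C)
    (hs : src = pre ++ ψ.c :: post) (ht : tgt = pre ++ ψ.y ++ post) (h : (tgt.length : ℕ∞) ≤ n)
    (φ : c ⟶ Q.mu src) : c ⟶ Q.mu tgt :=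
  φ ≫ Q.wh pre ψ.φ post hs rfl ≫ Q.al pre ψ.y post rfl ht h (cast_le_of_le h (by
    have := List.length_pos_of_ne_nil ψ.ne
    simp [ht]; omega))

/-- Naturality moves both whiskered morphisms in front of both associators. Then condition (v)
exchanges the associators and the interchange law exchanges the morphisms. -/
theorem ins_par {c : C} (a : List C) (ψ : Q.Mor) (b : List C) (ψ' : Q.Mor) (e : List C)
    {m p q r : List C} (φ : c ⟶ Q.mu r)
    (h₁ : r = a ++ ψ.c :: (b ++ ψ'.c :: e)) (h₂ : p = a ++ ψ.y ++ (b ++ ψ'.c :: e))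
    (h₃ : p = (a ++ ψ.y ++ b) ++ ψ'.c :: e) (h₄ : m = (a ++ ψ.y ++ b) ++ ψ'.y ++ e)
    (k₁ : r = (a ++ ψ.c :: b) ++ ψ'.c :: e) (k₂ : q = (a ++ ψ.c :: b) ++ ψ'.y ++ e)
    (k₃ : q = a ++ ψ.c :: (b ++ ψ'.y ++ e)) (k₄ : m = a ++ ψ.y ++ (b ++ ψ'.y ++ e))
    (hm : (m.length : ℕ∞) ≤ n) (hp : (p.length : ℕ∞) ≤ n) (hq : (q.length : ℕ∞) ≤ n) :
    ins (a ++ ψ.y ++ b) ψ' e h₃ h₄ hm (ins a ψ (b ++ ψ'.c :: e) h₁ h₂ hp φ) =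
      ins a ψ (b ++ ψ'.y ++ e) k₃ k₄ hm (ins (a ++ ψ.c :: b) ψ' e k₁ k₂ hq φ) := by
  have := List.length_pos_of_ne_nil ψ.ne
  have := List.length_pos_of_ne_nil ψ'.ne
  subst h₁ h₂ h₄ k₂
  have hlen : (((a ++ Q.mu ψ.y :: b ++ Q.mu ψ'.y :: e).length : ℕ) : ℕ∞) ≤ n :=
    cast_le_of_le hm (by simp; omega)
  have hlen' : (((a ++ Q.mu ψ.y :: b ++ ψ'.y ++ e).length : ℕ) : ℕ∞) ≤ n :=
    cast_le_of_le hm (by simp; omega)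
  have hlen'' : (((a ++ Q.mu ψ.y :: b ++ ψ'.c :: e).length : ℕ) : ℕ∞) ≤ n :=
    cast_le_of_le hm (by simp; omega)
  have hlen3 : (((a ++ ψ.c :: b ++ Q.mu ψ'.y :: e).length : ℕ) : ℕ∞) ≤ n :=
    cast_le_of_le hm (by simp; omega)
  have hlen4 : (((a ++ ψ.y ++ b ++ Q.mu ψ'.y :: e).length : ℕ) : ℕ∞) ≤ n :=
    cast_le_of_le hm (by simp; omega)
  have e1 := Q.al_wh_post a ψ.y b ψ'.φ e (s := a ++ Q.mu ψ.y :: (b ++ ψ'.c :: e))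
    (t := a ++ ψ.y ++ (b ++ ψ'.c :: e)) (s' := a ++ Q.mu ψ.y :: b ++ Q.mu ψ'.y :: e)
    (t' := a ++ ψ.y ++ b ++ Q.mu ψ'.y :: e)
    (by simp) (by simp) (by simp) (by simp) (by simp) (by simp) (by simp) (by simp) hp
    (by simpa using hlen'') hlen4 hlen
  have e2 := Q.al_wh_pre a ψ.φ b ψ'.y e (s := a ++ ψ.c :: b ++ Q.mu ψ'.y :: e)
    (t := a ++ ψ.c :: b ++ ψ'.y ++ e) (s' := a ++ Q.mu ψ.y :: b ++ Q.mu ψ'.y :: e)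
    (t' := a ++ Q.mu ψ.y :: (b ++ ψ'.y ++ e))
    (by simp) (by simp) (by simp) (by simp) (by simp) (by simp) (by simp) (by simp) hq
    hlen3 (by simpa using hlen') hlen
  have e3 := Q.al_disjoint (as := a) (bs := ψ.y) (cs := b) (ds := ψ'.y) (es := e)
    (p := a ++ ψ.y ++ b ++ Q.mu ψ'.y :: e) (q := a ++ Q.mu ψ.y :: (b ++ ψ'.y ++ e))
    (r := a ++ Q.mu ψ.y :: b ++ Q.mu ψ'.y :: e)
    rfl (by simp) (by simp) (by simp) hm hlen4 (by simpa using hlen') hlen (by simp) (by simp)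
    (by simp) (by simp) (by simp) (by simp) (by simp) (by simp)
  have e4 := Q.wh_swap a ψ.φ ψ'.φ b e (l₁ := a ++ ψ.c :: (b ++ ψ'.c :: e))
    (l₂ := a ++ Q.mu ψ.y :: (b ++ ψ'.c :: e)) (l₃ := a ++ ψ.c :: b ++ Q.mu ψ'.y :: e)
    (l₄ := a ++ Q.mu ψ.y :: b ++ Q.mu ψ'.y :: e) (by simp) (by simp) (by simp) (by simp) (by simp)
    (by simp) (by simp) (by simp)
  simp only [ins, Category.assoc]
  rw [← reassoc_of% e1, e3, ← reassoc_of% e2, reassoc_of% e4]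

/-- Condition (vi) turns the whiskered inner associator followed by the outer one into two
associators that remove the outer parentheses first; naturality then moves `χ` past the first of
these. This is associativity for nested substitutions. -/
theorem ins_seq {c : C} (pre : List C) {d : C} (p : List C) (χ : Q.Mor) (q post : List C)
    {y y' src t tgt : List C} (ψ : d ⟶ Q.mu y) (φ : c ⟶ Q.mu src) (ne : y ≠ []) (ne' : y' ≠ [])
    (le : (y.length : ℕ∞) ≤ n) (le' : (y'.length : ℕ∞) ≤ n)
    (h₁ : y = p ++ χ.c :: q) (h₂ : y' = p ++ χ.y ++ q) (h₃ : src = pre ++ d :: post)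
    (h₄ : tgt = pre ++ y' ++ post) (k₂ : t = pre ++ y ++ post)
    (k₃ : t = (pre ++ p) ++ χ.c :: (q ++ post)) (k₄ : tgt = (pre ++ p) ++ χ.y ++ (q ++ post))
    (h : (tgt.length : ℕ∞) ≤ n) (ht : (t.length : ℕ∞) ≤ n) :
    ins pre ⟨d, y', ne', le', ins p χ q h₁ h₂ le' ψ⟩ post h₃ h₄ h φ =
      ins (pre ++ p) χ (q ++ post) k₃ k₄ h (ins pre ⟨d, y, ne, le, ψ⟩ post h₃ k₂ ht φ) := by
  have := List.length_pos_of_ne_nil χ.ne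
  subst h₁ h₂ h₃ h₄ k₂
  have l1 : (((p ++ Q.mu χ.y :: q).length : ℕ) : ℕ∞) ≤ n := cast_le_of_le le' (by simp; omega)
  have l2 : (((pre ++ p ++ Q.mu χ.y :: (q ++ post)).length : ℕ) : ℕ∞) ≤ n :=
    cast_le_of_le h (by simp; omega)
  have l3 : ∀ e, (((pre ++ e :: post).length : ℕ) : ℕ∞) ≤ n :=
    fun e => cast_le_of_le h (by simp; omega)
  have e1 := Q.wh_al pre p χ.y q post (p := pre ++ p ++ Q.mu χ.y :: (q ++ post)) rfl rfl h l2
    (l3 _) le' l1 (l3 _) rfl rfl rfl (by simp) (by simp) (by simp)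
  have e2 := Q.al_wh_mid pre p χ.φ q post (t := pre ++ (p ++ χ.c :: q) ++ post)
    (t' := pre ++ p ++ Q.mu χ.y :: (q ++ post)) rfl rfl rfl rfl (by simp) rfl (by simp) (by simp) ht (l3 _) l2 (l3 _)
  simp only [ins, Category.assoc]
  rw [← Q.wh_comp pre ψ _ post rfl rfl rfl, ← Q.wh_comp pre _ _ post rfl rfl rfl]
  simp only [Category.assoc]
  rw [e1, reassoc_of% e2]

end AnMonoidal
end Associahedral

/-! ### Substitution of a list of morphisms for consecutive letters. -/

namespace Associahedral
namespace AnMonoidal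

variable {C : Type u} [Category.{v} C] {n : ℕ∞} {Q : AnMonoidal C n}

namespace Mor

/-- The underlying morphism in `C`. -/
def arrow (a : Q.Mor) : Arrow C := Arrow.mk a.φ

theorem ext' {a b : Q.Mor} (hy : a.y = b.y) (h : a.arrow = b.arrow) : a = b := by
  cases a
  cases b
  cases hy
  cases h
  rfl

theorem length_le_flatMap (ψs : List Q.Mor) : ψs.length ≤ (ψs.flatMap (·.y)).length := by
  induction ψs with
  | nil => simp
  | cons ψ ψs ih =>
    have := List.length_pos_of_ne_nil ψ.ne
    simp only [List.length_cons, List.flatMap_cons, List.length_append]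
    omega

theorem flatMap_ne_nil {ψs : List Q.Mor} (h : ψs ≠ []) : ψs.flatMap (·.y) ≠ [] := by
  have h1 := length_le_flatMap ψs
  have h2 := List.length_pos_of_ne_nil h
  exact List.ne_nil_of_length_pos (by omega)

end Mor

theorem ins_comp {c d : C} (f : c ⟶ d) {src tgt : List C} (pre : List C) (ψ : Q.Mor)
    (post : List C) (hs : src = pre ++ ψ.c :: post) (ht : tgt = pre ++ ψ.y ++ post)
    (h : (tgt.length : ℕ∞) ≤ n) (φ : d ⟶ Q.mu src) :
    ins pre ψ post hs ht h (f ≫ φ) = f ≫ ins pre ψ post hs ht h φ := by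
  simp [ins]

/-- Composition of `φ : c ⟶ μ(pre, d₁, …, d_k, post)` with morphisms `ψ_i : d_i ⟶ μ(y_i)`. -/
def insAll {c : C} (post : List C) : ∀ (ψs : List Q.Mor) (pre : List C) {src tgt : List C}
    (_ : src = pre ++ ψs.map (·.c) ++ post) (_ : tgt = pre ++ ψs.flatMap (·.y) ++ post)
    (_ : (tgt.length : ℕ∞) ≤ n) (_ : c ⟶ Q.mu src), c ⟶ Q.mu tgt
  | [], _, _, _, hs, ht, _, φ => φ ≫ eqToHom (by rw [hs, ht]; simp)
  | ψ :: ψs, pre, _, _, hs, ht, h, φ =>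
    insAll post ψs (pre ++ ψ.y) rfl (by simp [ht]) h
      (ins pre ψ (ψs.map (·.c) ++ post) (by simp [hs]) (by simp) (cast_le_of_le h (by
        have := Mor.length_le_flatMap ψs
        simp [ht, -List.length_flatMap]; omega)) φ)

theorem insAll_nil {c : C} (post pre : List C) {src : List C}
    (hs : src = pre ++ ([] : List Q.Mor).map (·.c) ++ post)
    (ht : src = pre ++ ([] : List Q.Mor).flatMap (·.y) ++ post) (h : (src.length : ℕ∞) ≤ n)
    (φ : c ⟶ Q.mu src) : insAll post [] pre hs ht h φ = φ := by
  simp [insAll]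

/-- The recursion of `insAll` with every auxiliary list replaced by a variable, so that it can be
used for concatenations bracketed in any way. -/
theorem insAll_cons {c : C} (post : List C) (ψ : Q.Mor) (ψs : List Q.Mor) (pre : List C)
    {src tgt : List C} (hs : src = pre ++ (ψ :: ψs).map (·.c) ++ post)
    (ht : tgt = pre ++ (ψ :: ψs).flatMap (·.y) ++ post) (h : (tgt.length : ℕ∞) ≤ n)
    (φ : c ⟶ Q.mu src) {pre' post' mid : List C} (hpre : pre' = pre ++ ψ.y)
    (hpost : post' = ψs.map (·.c) ++ post) (h₁ : mid = pre' ++ ψs.map (·.c) ++ post)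
    (h₂ : tgt = pre' ++ ψs.flatMap (·.y) ++ post) (h₃ : src = pre ++ ψ.c :: post')
    (h₄ : mid = pre ++ ψ.y ++ post') (h₅ : (mid.length : ℕ∞) ≤ n) :
    insAll post (ψ :: ψs) pre hs ht h φ =
      insAll post ψs pre' h₁ h₂ h (ins pre ψ post' h₃ h₄ h₅ φ) := by
  subst hpre hpost h₁
  rfl

theorem insAll_congr {c : C} (post : List C) (ψs : List Q.Mor) {pre pre' : List C}
    {src tgt : List C} (hs : src = pre ++ ψs.map (·.c) ++ post)
    (ht : tgt = pre ++ ψs.flatMap (·.y) ++ post) (h : (tgt.length : ℕ∞) ≤ n)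
    (φ : c ⟶ Q.mu src) (e : pre = pre') :
    insAll post ψs pre hs ht h φ = insAll post ψs pre' (e ▸ hs) (e ▸ ht) h φ := by
  subst e
  rfl

theorem insAll_comp {c d : C} (f : c ⟶ d) (post : List C) (ψs : List Q.Mor) :
    ∀ (pre : List C) {src tgt : List C} (hs : src = pre ++ ψs.map (·.c) ++ post)
      (ht : tgt = pre ++ ψs.flatMap (·.y) ++ post) (h : (tgt.length : ℕ∞) ≤ n) (φ : d ⟶ Q.mu src),
      insAll post ψs pre hs ht h (f ≫ φ) = f ≫ insAll post ψs pre hs ht h φ := by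
  induction ψs with
  | nil => intros; simp [insAll]
  | cons ψ ψs ih => intros; simp only [insAll, ins_comp, ih]

theorem insAll_append {c : C} (post : List C) (ψs ψs' : List Q.Mor) :
    ∀ (pre : List C) {src tgt : List C} (hs : src = pre ++ (ψs ++ ψs').map (·.c) ++ post)
      (ht : tgt = pre ++ (ψs ++ ψs').flatMap (·.y) ++ post) (h : (tgt.length : ℕ∞) ≤ n)
      (φ : c ⟶ Q.mu src) {pre' post' mid : List C} (_ : pre' = pre ++ ψs.flatMap (·.y))
      (h₁ : src = pre ++ ψs.map (·.c) ++ post') (h₂ : mid = pre ++ ψs.flatMap (·.y) ++ post')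
      (h₃ : mid = pre' ++ ψs'.map (·.c) ++ post) (h₄ : tgt = pre' ++ ψs'.flatMap (·.y) ++ post)
      (h₅ : (mid.length : ℕ∞) ≤ n),
      insAll post (ψs ++ ψs') pre hs ht h φ =
        insAll post ψs' pre' h₃ h₄ h (insAll post' ψs pre h₁ h₂ h₅ φ) := by
  induction ψs with
  | nil =>
    intro pre src tgt hs ht h φ pre' post' mid hpre h₁ h₂ h₃ h₄ h₅
    obtain rfl : mid = src := by rw [h₁, h₂]; simp
    rw [insAll_nil]
    exact insAll_congr _ _ _ _ _ _ (by simp [hpre])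
  | cons ψ ψs ih =>
    intro pre src tgt hs ht h φ pre' post' mid hpre h₁ h₂ h₃ h₄ h₅
    have hpost : post' = ψs'.map (·.c) ++ post := by
      have := h₁.symm.trans hs
      simpa using this
    have := Mor.length_le_flatMap ψs
    have := Mor.length_le_flatMap ψs'
    have hlen : (((pre ++ ψ.y ++ (ψs.map (·.c) ++ post')).length : ℕ) : ℕ∞) ≤ n :=
      cast_le_of_le h (by simp [ht, hpost, -List.length_flatMap]; omega)
    rw [insAll_cons (mid := pre ++ ψ.y ++ (ψs.map (·.c) ++ post'))
      (post' := ψs.map (·.c) ++ post') (ψs := ψs) (hpre := rfl) (hpost := rfl) (h₁ := by simp)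
      (h₂ := by simp [h₂]) (h₃ := by simp [h₁]) (h₄ := rfl) (h₅ := hlen)]
    rw [← ih (pre ++ ψ.y) (by simp [hpost]) (by simp [ht]) h _ (by simp [hpre])]
    exact insAll_cons (hpre := rfl) (hpost := by simp [hpost]) (h₃ := by simp [h₁])
      (h₄ := rfl) (h₅ := hlen) ..

/-- `ins_par` iterated over `ψs`: a substitution further to the right commutes with all of them. -/
theorem ins_insAll {c : C} (mid : List C) (ψ' : Q.Mor) (post : List C) (ψs : List Q.Mor) :
    ∀ (pre : List C) {m p q r pre' pre'' post' post'' : List C} (φ : c ⟶ Q.mu r)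
      (_e₁ : pre' = pre ++ ψs.flatMap (·.y) ++ mid) (_e₂ : pre'' = pre ++ ψs.map (·.c) ++ mid)
      (_e₃ : post' = mid ++ ψ'.c :: post) (_e₄ : post'' = mid ++ ψ'.y ++ post)
      (h₁ : r = pre ++ ψs.map (·.c) ++ post') (h₂ : p = pre ++ ψs.flatMap (·.y) ++ post')
      (h₃ : p = pre' ++ ψ'.c :: post) (h₄ : m = pre' ++ ψ'.y ++ post)
      (k₁ : r = pre'' ++ ψ'.c :: post) (k₂ : q = pre'' ++ ψ'.y ++ post)
      (k₃ : q = pre ++ ψs.map (·.c) ++ post'') (k₄ : m = pre ++ ψs.flatMap (·.y) ++ post'')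
      (hm : (m.length : ℕ∞) ≤ n) (hp : (p.length : ℕ∞) ≤ n) (hq : (q.length : ℕ∞) ≤ n),
      ins pre' ψ' post h₃ h₄ hm (insAll post' ψs pre h₁ h₂ hp φ) =
        insAll post'' ψs pre k₃ k₄ hm (ins pre'' ψ' post k₁ k₂ hq φ) := by
  induction ψs with
  | nil =>
    intro pre m p q r pre' pre'' post' post'' φ e₁ e₂ e₃ e₄ h₁ h₂ h₃ h₄ k₁ k₂ k₃ k₄ hm hp hq
    obtain rfl : pre' = pre'' := by simp [e₁, e₂]
    obtain rfl : p = r := by rw [h₁, h₂]; simp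
    obtain rfl : m = q := by rw [k₃, k₄]; simp
    rw [insAll_nil, insAll_nil]
  | cons ψ ψs ih =>
    intro pre m p q r pre' pre'' post' post'' φ e₁ e₂ e₃ e₄ h₁ h₂ h₃ h₄ k₁ k₂ k₃ k₄ hm hp hq
    have l1 := List.length_pos_of_ne_nil ψ.ne
    have l2 := List.length_pos_of_ne_nil ψ'.ne
    have l3 := Mor.length_le_flatMap ψs
    rw [insAll_cons (ψ := ψ) (mid := pre ++ ψ.y ++ (ψs.map (·.c) ++ post'))
      (hpre := rfl) (hpost := rfl) (h₁ := by simp) (h₂ := by simp [h₂]) (h₃ := by simp [h₁])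
      (h₄ := rfl) (h₅ := cast_le_of_le hp (by simp [h₂, -List.length_flatMap]; omega))]
    rw [insAll_cons (ψ := ψ) (mid := pre ++ ψ.y ++ (ψs.map (·.c) ++ post''))
      (hpre := rfl) (hpost := rfl) (h₁ := by simp) (h₂ := by simp [k₄]) (h₃ := by simp [k₃])
      (h₄ := rfl) (h₅ := cast_le_of_le hm (by simp [k₄, -List.length_flatMap]; omega))]
    rw [ih (pre ++ ψ.y) (q := pre ++ ψ.y ++ (ψs.map (·.c) ++ post''))
      (pre'' := pre ++ ψ.y ++ (ψs.map (·.c) ++ mid)) (_e₁ := by simp [e₁]) (_e₂ := by simp)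
      (_e₃ := e₃) (_e₄ := e₄) (k₁ := by simp [e₃]) (k₂ := by simp [e₄]) (k₃ := by simp) (k₄ := by simp [k₄])
      (hq := cast_le_of_le hm (by simp [k₄, -List.length_flatMap]; omega))]
    congr 1
    obtain rfl : pre'' = pre ++ ψ.c :: (ψs.map (·.c) ++ mid) := by simp [e₂]
    obtain rfl : post' = mid ++ ψ'.c :: post := e₃
    obtain rfl : post'' = mid ++ ψ'.y ++ post := e₄
    have := ins_par pre ψ (ψs.map (·.c) ++ mid) ψ' post (r := r) (q := q)
      (p := pre ++ ψ.y ++ (ψs.map (·.c) ++ (mid ++ ψ'.c :: post)))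
      (m := pre ++ ψ.y ++ (ψs.map (·.c) ++ (mid ++ ψ'.y ++ post))) φ (by simp [h₁]) (by simp)
      (by simp) (by simp) (by simp [k₁]) (by simp [k₂]) (by simp [k₂]) (by simp)
      (cast_le_of_le hm (by simp [k₄, -List.length_flatMap]; omega)) (cast_le_of_le hp (by simp [h₂, -List.length_flatMap]; omega)) hq
    convert this using 2 <;> simp

end AnMonoidal
end Associahedral

/-! ### Associativity of simultaneous substitution. -/

namespace Associahedral
namespace AnMonoidal

variable {C : Type u} [Category.{v} C] {n : ℕ∞} {Q : AnMonoidal C n}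

/-- `ins_insAll` iterated over the block further to the right. -/
theorem insAll_insAll {c : C} (ψs : List Q.Mor) (pre post : List C) (ψs' : List Q.Mor) :
    ∀ (mid : List C) {m p q r pre' pre'' post' post'' : List C} (φ : c ⟶ Q.mu r)
      (_e₁ : pre' = pre ++ ψs.flatMap (·.y) ++ mid) (_e₂ : pre'' = pre ++ ψs.map (·.c) ++ mid)
      (_e₃ : post' = mid ++ ψs'.map (·.c) ++ post) (_e₄ : post'' = mid ++ ψs'.flatMap (·.y) ++ post)
      (h₁ : r = pre ++ ψs.map (·.c) ++ post') (h₂ : p = pre ++ ψs.flatMap (·.y) ++ post')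
      (h₃ : p = pre' ++ ψs'.map (·.c) ++ post) (h₄ : m = pre' ++ ψs'.flatMap (·.y) ++ post)
      (k₁ : r = pre'' ++ ψs'.map (·.c) ++ post) (k₂ : q = pre'' ++ ψs'.flatMap (·.y) ++ post)
      (k₃ : q = pre ++ ψs.map (·.c) ++ post'') (k₄ : m = pre ++ ψs.flatMap (·.y) ++ post'')
      (hm : (m.length : ℕ∞) ≤ n) (hp : (p.length : ℕ∞) ≤ n) (hq : (q.length : ℕ∞) ≤ n),
      insAll post ψs' pre' h₃ h₄ hm (insAll post' ψs pre h₁ h₂ hp φ) =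
        insAll post'' ψs pre k₃ k₄ hm (insAll post ψs' pre'' k₁ k₂ hq φ) := by
  induction ψs' with
  | nil =>
    intro mid m p q r pre' pre'' post' post'' φ e₁ e₂ e₃ e₄ h₁ h₂ h₃ h₄ k₁ k₂ k₃ k₄ hm hp hq
    obtain rfl : post' = post'' := by simp [e₃, e₄]
    obtain rfl : m = p := by rw [h₃, h₄]; simp
    obtain rfl : q = r := by rw [k₁, k₂]; simp
    rw [insAll_nil, insAll_nil]
  | cons ψ ψs' ih =>
    intro mid m p q r pre' pre'' post' post'' φ e₁ e₂ e₃ e₄ h₁ h₂ h₃ h₄ k₁ k₂ k₃ k₄ hm hp hq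
    have l1 := List.length_pos_of_ne_nil ψ.ne
    have l2 := Mor.length_le_flatMap ψs'
    rw [insAll_cons (ψ := ψ) (mid := pre' ++ ψ.y ++ (ψs'.map (·.c) ++ post))
      (hpre := rfl) (hpost := rfl) (h₁ := by simp) (h₂ := by simp [h₄]) (h₃ := by simp [h₃])
      (h₄ := rfl) (h₅ := cast_le_of_le hm (by simp [h₄, -List.length_flatMap]; omega))]
    rw [insAll_cons (ψ := ψ) (mid := pre'' ++ ψ.y ++ (ψs'.map (·.c) ++ post))
      (hpre := rfl) (hpost := rfl) (h₁ := by simp) (h₂ := by simp [k₂]) (h₃ := by simp [k₁])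
      (h₄ := rfl) (h₅ := cast_le_of_le hq (by simp [k₂, -List.length_flatMap]; omega))]
    rw [← ih (mid ++ ψ.y) (p := pre' ++ ψ.y ++ (ψs'.map (·.c) ++ post))
      (pre' := pre' ++ ψ.y) (_e₁ := by simp [e₁]) (_e₂ := by simp [e₂])
      (_e₃ := rfl) (_e₄ := by simp [e₄]) (h₁ := by simp [e₂]) (h₂ := by simp [e₁])
      (h₃ := by simp) (h₄ := by simp [h₄])
      (hp := cast_le_of_le hm (by simp [h₄, -List.length_flatMap]; omega))]
    congr 1
    exact ins_insAll mid ψ (ψs'.map (·.c) ++ post) ψs pre φ e₁ e₂ (by simp [e₃]) (by simp) ..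

namespace Mor

/-- Composition of `a : c ⟶ μ(y₁, …, y_k)` with morphisms `b_i : y_i ⟶ μ(z_i)`. -/
def comp (a : Q.Mor) (bs : List Q.Mor) (h : bs.map (·.c) = a.y)
    (hle : ((bs.flatMap (·.y)).length : ℕ∞) ≤ n) : Q.Mor where
  c := a.c
  y := bs.flatMap (·.y)
  ne := flatMap_ne_nil (by rintro rfl; exact a.ne h.symm)
  le := hle
  φ := insAll [] bs [] (by simp [h]) (by simp) hle a.φ

/-- `d` is the composite of `a` and the `b_i`. -/
def IsComp (a : Q.Mor) (bs : List Q.Mor) (d : Q.Mor) : Prop :=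
  ∃ h hle, d = a.comp bs h hle

end Mor

/-- `ins_seq` iterated over `bs`. The prefix `p` collects the target lists of the members already
substituted, which is why the induction must let it vary. -/
theorem ins_insAll_nil {c d : C} (pre post : List C) (bs : List Q.Mor) :
    ∀ (p pre' : List C) {y y' src t tgt : List C} (ψ : d ⟶ Q.mu y) (φ : c ⟶ Q.mu src) (ne : y ≠ [])
      (ne' : y' ≠ []) (le : (y.length : ℕ∞) ≤ n) (le' : (y'.length : ℕ∞) ≤ n)
      (_hpre : pre' = pre ++ p)
      (h₁ : y = p ++ bs.map (·.c) ++ []) (h₂ : y' = p ++ bs.flatMap (·.y) ++ [])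
      (h₃ : src = pre ++ d :: post) (h₄ : tgt = pre ++ y' ++ post) (k₂ : t = pre ++ y ++ post)
      (k₃ : t = pre' ++ bs.map (·.c) ++ post) (k₄ : tgt = pre' ++ bs.flatMap (·.y) ++ post)
      (h : (tgt.length : ℕ∞) ≤ n) (ht : (t.length : ℕ∞) ≤ n),
      ins pre ⟨d, y', ne', le', insAll [] bs p h₁ h₂ le' ψ⟩ post h₃ h₄ h φ =
        insAll post bs pre' k₃ k₄ h (ins pre ⟨d, y, ne, le, ψ⟩ post h₃ k₂ ht φ) := by
  induction bs with
  | nil =>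
    intro p pre' y y' src t tgt ψ φ ne ne' le le' hpre h₁ h₂ h₃ h₄ k₂ k₃ k₄ h ht
    obtain rfl : y = y' := by simp [h₁, h₂]
    obtain rfl : t = tgt := by simp [k₂, h₄]
    simp only [insAll_nil]
  | cons b bs ih =>
    intro p pre' y y' src t tgt ψ φ ne ne' le le' hpre h₁ h₂ h₃ h₄ k₂ k₃ k₄ h ht
    have l1 := List.length_pos_of_ne_nil b.ne
    have l2 := Mor.length_le_flatMap bs
    have ne₂ : p ++ b.y ++ bs.map (·.c) ≠ [] := by simp [b.ne]
    have le₂ : (((p ++ b.y ++ bs.map (·.c)).length : ℕ) : ℕ∞) ≤ n :=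
      cast_le_of_le le' (by simp [h₂, -List.length_flatMap]; omega)
    have le₃ : (((pre ++ (p ++ b.y ++ bs.map (·.c)) ++ post).length : ℕ) : ℕ∞) ≤ n :=
      cast_le_of_le h (by simp [h₄, h₂, -List.length_flatMap]; omega)
    have e : insAll [] (b :: bs) p h₁ h₂ le' ψ = _ :=
      insAll_cons (ψ := b) (mid := p ++ b.y ++ bs.map (·.c)) (hpre := rfl) (hpost := rfl)
        (h₁ := by simp) (h₂ := by simp [h₂]) (h₃ := by simp [h₁]) (h₄ := by simp) (h₅ := le₂) ..
    simp only [e]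
    rw [ih (p ++ b.y) (pre' ++ b.y) (t := pre ++ (p ++ b.y ++ bs.map (·.c)) ++ post)
      (ne := ne₂) (le := le₂) (_hpre := by simp [hpre]) (k₂ := rfl) (k₃ := by simp [hpre])
      (k₄ := by simp [k₄]) (ht := le₃)]
    rw [insAll_cons (ψ := b) (mid := pre ++ (p ++ b.y ++ bs.map (·.c)) ++ post)
      (pre' := pre' ++ b.y) (post' := bs.map (·.c) ++ [] ++ post) (hpre := rfl)
      (hpost := by simp) (h₁ := by simp [hpre]) (h₂ := by simp [k₄]) (h₃ := by simp [k₃])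
      (h₄ := by simp [hpre]) (h₅ := le₃)]
    congr 1
    subst hpre
    exact ins_seq pre p b (bs.map (·.c) ++ []) post (t := t) ψ φ ne ne₂ le le₂ (by simp [h₁])
      (by simp) h₃ rfl k₂ (by simp [k₃]) (by simp) le₃ ht

theorem ins_isComp {c : C} {a d : Q.Mor} {bs : List Q.Mor} (hd : a.IsComp bs d)
    (pre post : List C) {src t tgt : List C} (φ : c ⟶ Q.mu src)
    (h₃ : src = pre ++ d.c :: post) (h₄ : tgt = pre ++ d.y ++ post)
    (k₁ : src = pre ++ a.c :: post) (k₂ : t = pre ++ a.y ++ post)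
    (k₃ : t = pre ++ bs.map (·.c) ++ post) (k₄ : tgt = pre ++ bs.flatMap (·.y) ++ post)
    (h : (tgt.length : ℕ∞) ≤ n) (ht : (t.length : ℕ∞) ≤ n) :
    ins pre d post h₃ h₄ h φ = insAll post bs pre k₃ k₄ h (ins pre a post k₁ k₂ ht φ) := by
  obtain ⟨h1, h2, rfl⟩ := hd
  exact ins_insAll_nil pre post bs [] pre a.φ φ a.ne _ a.le _ (by simp) ..

/-- Induction step of associativity. The morphisms `b` concern only letters produced by `a`, so by
`insAll_insAll` they can be substituted before the `as`. There they merge with `a` into `d`, and the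
induction hypothesis treats the remaining letters. -/
theorem insAll_assoc_cons {c : C} {a d : Q.Mor} {b : List Q.Mor} (hd : a.IsComp b d) (post : List C)
    {as bs ds : List Q.Mor} (hcs : ds.map (·.c) = as.map (·.c))
    (hbs : bs.map (·.c) = as.flatMap (·.y)) (hds : bs.flatMap (·.y) = ds.flatMap (·.y))
    (ih : ∀ (pre : List C) {src t tgt : List C} (φ : c ⟶ Q.mu src)
      (h₁ : src = pre ++ as.map (·.c) ++ post) (h₂ : t = pre ++ as.flatMap (·.y) ++ post)
      (h₃ : t = pre ++ bs.map (·.c) ++ post) (h₄ : tgt = pre ++ bs.flatMap (·.y) ++ post)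
      (k₁ : src = pre ++ ds.map (·.c) ++ post) (k₂ : tgt = pre ++ ds.flatMap (·.y) ++ post)
      (ht : (t.length : ℕ∞) ≤ n) (h : (tgt.length : ℕ∞) ≤ n),
      insAll post bs pre h₃ h₄ h (insAll post as pre h₁ h₂ ht φ) = insAll post ds pre k₁ k₂ h φ)
    (pre : List C) {src t tgt : List C} (φ : c ⟶ Q.mu src)
    (h₁ : src = pre ++ (a :: as).map (·.c) ++ post)
    (h₂ : t = pre ++ (a :: as).flatMap (·.y) ++ post)
    (h₃ : t = pre ++ (b ++ bs).map (·.c) ++ post)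
    (h₄ : tgt = pre ++ (b ++ bs).flatMap (·.y) ++ post)
    (k₁ : src = pre ++ (d :: ds).map (·.c) ++ post)
    (k₂ : tgt = pre ++ (d :: ds).flatMap (·.y) ++ post)
    (ht : (t.length : ℕ∞) ≤ n) (h : (tgt.length : ℕ∞) ≤ n) :
    insAll post (b ++ bs) pre h₃ h₄ h (insAll post (a :: as) pre h₁ h₂ ht φ) =
      insAll post (d :: ds) pre k₁ k₂ h φ := by
  obtain ⟨e1, e2, e3⟩ := id hd
  have hc : d.c = a.c := by rw [e3]; rfl
  have hy : d.y = b.flatMap (·.y) := by rw [e3]; rfl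
  have l1 := List.length_pos_of_ne_nil a.ne
  have l2 := Mor.length_le_flatMap as
  have l3 := Mor.length_le_flatMap ds
  -- The mixed list with `d` substituted but not the `bs` is no longer than the final one, because
  -- the `bs` have nonempty targets.
  have l4 : (as.flatMap (·.y)).length ≤ (ds.flatMap (·.y)).length := by
    rw [← hds, ← hbs]
    simpa [-List.length_flatMap] using Mor.length_le_flatMap bs
  have s1 : ((((pre ++ a.y ++ (as.map (·.c) ++ post)).length : ℕ)) : ℕ∞) ≤ n :=
    cast_le_of_le ht (by simp [h₂, -List.length_flatMap]; omega)
  have s2 : ((((pre ++ d.y ++ (as.flatMap (·.y) ++ post)).length : ℕ)) : ℕ∞) ≤ n :=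
    cast_le_of_le h (by simp [k₂, -List.length_flatMap]; omega)
  have s3 : ((((pre ++ d.y ++ (as.map (·.c) ++ post)).length : ℕ)) : ℕ∞) ≤ n :=
    cast_le_of_le s2 (by simp [-List.length_flatMap]; omega)
  rw [insAll_cons (ψ := a) (mid := pre ++ a.y ++ (as.map (·.c) ++ post)) (pre' := pre ++ a.y)
      (hpre := rfl) (hpost := rfl) (h₁ := by simp) (h₂ := by simp [h₂]) (h₃ := by simp [h₁])
      (h₄ := rfl) (h₅ := s1),
    insAll_cons (ψ := d) (mid := pre ++ d.y ++ (as.map (·.c) ++ post)) (pre' := pre ++ d.y)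
      (post' := as.map (·.c) ++ post)
      (hpre := rfl) (hpost := by simp [hcs]) (h₁ := by simp [hcs]) (h₂ := by simp [k₂])
      (h₃ := by simp [h₁, hc]) (h₄ := rfl) (h₅ := s3),
    insAll_append post b bs pre h₃ h₄ h _ (pre' := pre ++ d.y)
      (mid := pre ++ d.y ++ (as.flatMap (·.y) ++ post))
      (post' := as.flatMap (·.y) ++ post) (by simp [hy]) (by simp [h₃, hbs]) (by simp [hy])
      (by simp [hbs]) (by simp [h₄, hy]) s2,
    ← insAll_insAll b pre post as (mid := []) (post' := as.map (·.c) ++ post) (pre' := pre ++ d.y)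
      (pre'' := pre ++ a.y) (p := pre ++ d.y ++ (as.map (·.c) ++ post)) (_e₁ := by simp [hy]) (_e₂ := by simp [e1])
      (_e₃ := by simp) (_e₄ := by simp) (h₁ := by simp [e1]) (h₂ := by simp [hy]) (h₃ := by simp)
      (h₄ := by simp) (hp := s3),
    ih (pre ++ d.y) (k₁ := by simp [hcs]) (k₂ := by simp [k₂])]
  congr 1
  exact (ins_isComp hd pre (as.map (·.c) ++ post) φ (by simp [h₁, hc]) rfl (by simp [h₁]) rfl
    (by simp [e1]) (by simp [hy]) s3 s1).symm

/-- Associativity of composition. -/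
theorem insAll_assoc {c : C} {ι : Type*} {A D : ι → Q.Mor} {B : ι → List Q.Mor} (post : List C)
    (qs : List ι) (hR : ∀ q ∈ qs, (A q).IsComp (B q) (D q)) :
    ∀ (pre : List C) {src t tgt : List C} (φ : c ⟶ Q.mu src)
      (h₁ : src = pre ++ (qs.map A).map (·.c) ++ post)
      (h₂ : t = pre ++ (qs.map A).flatMap (·.y) ++ post)
      (h₃ : t = pre ++ (qs.flatMap B).map (·.c) ++ post)
      (h₄ : tgt = pre ++ (qs.flatMap B).flatMap (·.y) ++ post)
      (k₁ : src = pre ++ (qs.map D).map (·.c) ++ post)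
      (k₂ : tgt = pre ++ (qs.map D).flatMap (·.y) ++ post)
      (ht : (t.length : ℕ∞) ≤ n) (h : (tgt.length : ℕ∞) ≤ n),
      insAll post (qs.flatMap B) pre h₃ h₄ h (insAll post (qs.map A) pre h₁ h₂ ht φ) =
        insAll post (qs.map D) pre k₁ k₂ h φ := by
  induction qs with
  | nil =>
    intro pre src t tgt φ h₁ h₂ h₃ h₄ k₁ k₂ ht h
    obtain rfl : src = t := by simp [h₁, h₂]
    obtain rfl : src = tgt := by simp [h₁, k₂]
    simp only [List.flatMap_nil, List.map_nil, insAll_nil]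
  | cons q qs ih =>
    intro pre src t tgt φ h₁ h₂ h₃ h₄ k₁ k₂ ht h
    have hq := hR q List.mem_cons_self
    obtain ⟨e1, e2, e3⟩ := id hq
    have hc : (D q).c = (A q).c := by rw [e3]; rfl
    have hy : (D q).y = (B q).flatMap (·.y) := by rw [e3]; rfl
    refine insAll_assoc_cons hq post ?_ ?_ ?_
      (ih fun q hq => hR q (List.mem_cons_of_mem _ hq)) pre φ h₁ h₂ h₃ h₄ k₁ k₂ ht h
    · have := k₁.symm.trans h₁
      simpa [hc] using this
    · have := h₃.symm.trans h₂
      simpa [e1] using this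
    · have := h₄.symm.trans k₂
      simpa [hy] using this

theorem insAll_arrow_congr {c c' : C} (post : List C) (ψs : List Q.Mor) (pre : List C)
    {src src' tgt tgt' : List C} (hs : src = pre ++ ψs.map (·.c) ++ post)
    (ht : tgt = pre ++ ψs.flatMap (·.y) ++ post) (h : (tgt.length : ℕ∞) ≤ n)
    (hs' : src' = pre ++ ψs.map (·.c) ++ post) (ht' : tgt' = pre ++ ψs.flatMap (·.y) ++ post)
    (h' : (tgt'.length : ℕ∞) ≤ n) {φ : c ⟶ Q.mu src} {φ' : c' ⟶ Q.mu src'}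
    (e : Arrow.mk φ = Arrow.mk φ') :
    Arrow.mk (insAll post ψs pre hs ht h φ) = Arrow.mk (insAll post ψs pre hs' ht' h' φ') := by
  obtain rfl : src = src' := hs.trans hs'.symm
  obtain rfl : tgt = tgt' := ht.trans ht'.symm
  obtain rfl : c = c' := congrArg Arrow.leftFunc.obj e
  rw [Arrow.mk_injective _ _ e]

theorem map_c_eq_of_isComp {ι : Type*} {A D : ι → Q.Mor} {B : ι → List Q.Mor} {qs : List ι}
    (hR : ∀ q ∈ qs, (A q).IsComp (B q) (D q)) :
    (qs.map D).map (·.c) = (qs.map A).map (·.c) := by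
  rw [List.map_map, List.map_map]
  refine List.map_congr_left fun x hx => ?_
  obtain ⟨_, _, e⟩ := hR x hx
  rw [Function.comp_apply, e]
  rfl

theorem flatMap_y_eq_of_isComp {ι : Type*} {A D : ι → Q.Mor} {B : ι → List Q.Mor} {qs : List ι}
    (hR : ∀ q ∈ qs, (A q).IsComp (B q) (D q)) :
    (qs.flatMap B).flatMap (·.y) = (qs.map D).flatMap (·.y) := by
  rw [List.flatMap_assoc, List.flatMap_map]
  refine List.flatMap_congr fun x hx => ?_
  obtain ⟨_, _, e⟩ := hR x hx
  rw [e]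
  rfl

theorem map_c_flatMap_eq_of_isComp {ι : Type*} {A D : ι → Q.Mor} {B : ι → List Q.Mor} {qs : List ι}
    (hR : ∀ q ∈ qs, (A q).IsComp (B q) (D q)) :
    (qs.flatMap B).map (·.c) = (qs.map A).flatMap (·.y) := by
  rw [List.map_flatMap, List.flatMap_map]
  refine List.flatMap_congr fun x hx => ?_
  obtain ⟨h, _, _⟩ := hR x hx
  exact h

/-! ### Unary morphisms and the evaluation of nodes -/

section

variable [hn : Fact (((1 : ℕ) : ℕ∞) ≤ n)]

variable (Q) in
/-- A morphism of `C` as a morphism to the product of a one-letter list. -/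
def arr (f : Arrow C) : Q.Mor where
  c := f.left
  y := [f.right]
  ne := by simp
  le := by simpa using hn.out
  φ := f.hom ≫ eqToHom (Q.mu_singleton hn.out _).symm

@[simp]
theorem arr_arrow (f : Arrow C) : (Q.arr f).arrow = f := by
  obtain ⟨X, Y, f⟩ := f
  exact Arrow.arrow_mk_comp_eqToHom f _

theorem arr_arrow_of_unary {a : Q.Mor} {d : C} (h : a.y = [d]) : Q.arr a.arrow = a := by
  refine Mor.ext' ?_ (by simp)
  rw [h]
  change [Q.mu a.y] = [d]
  rw [h, Q.mu_singleton hn.out]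

open Classical in
/-- The composite of `μ(c₁, …, c_k)` with `a_i : c_i ⟶ μ(y_i)`. -/
def join (as : List Q.Mor) : Q.Mor :=
  if h : as ≠ [] ∧ ((as.flatMap (·.y)).length : ℕ∞) ≤ n then
    ⟨Q.mu (as.map (·.c)), as.flatMap (·.y), Mor.flatMap_ne_nil h.1, h.2,
      insAll [] as [] (by simp) (by simp) h.2 (𝟙 _)⟩
  -- For the empty list this value is meaningful: a product without factors is the unit object.
  -- Lists that are too long never arise from words in the filtration.
  else Q.arr (Arrow.mk (𝟙 Q.zero))

theorem join_of_le {as : List Q.Mor} (h : as ≠ []) (h' : ((as.flatMap (·.y)).length : ℕ∞) ≤ n) :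
    join as = ⟨Q.mu (as.map (·.c)), as.flatMap (·.y), Mor.flatMap_ne_nil h, h',
      insAll [] as [] (by simp) (by simp) h' (𝟙 _)⟩ :=
  dif_pos ⟨h, h'⟩

theorem join_nil : join ([] : List Q.Mor) = Q.arr (Arrow.mk (𝟙 Q.zero)) := dif_neg (by simp)

/-- Associativity of substitution, applied to the identity of the product of the sources of the `A
q`. -/
theorem isComp_join {ι : Type*} {A D : ι → Q.Mor} {B : ι → List Q.Mor} {qs : List ι}
    (hR : ∀ q ∈ qs, (A q).IsComp (B q) (D q)) (hqs : qs ≠ [])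
    (hA : (((qs.map A).flatMap (·.y)).length : ℕ∞) ≤ n)
    (hD : (((qs.map D).flatMap (·.y)).length : ℕ∞) ≤ n) :
    (join (qs.map A)).IsComp (qs.flatMap B) (join (qs.map D)) := by
  have e1 := map_c_eq_of_isComp hR
  have e2 := flatMap_y_eq_of_isComp hR
  have e3 := map_c_flatMap_eq_of_isComp hR
  rw [join_of_le (by simpa using hqs) hA, join_of_le (by simpa using hqs) hD]
  refine ⟨e3, by rw [e2]; exact hD, Mor.ext' e2.symm ?_⟩
  have key := insAll_assoc [] qs hR [] (𝟙 (Q.mu ((qs.map A).map (·.c))))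
    (t := (qs.map A).flatMap (·.y)) (tgt := (qs.flatMap B).flatMap (·.y)) (by simp)
    (by simp) (by simp [e3]) (by simp) (by rw [e1]; simp) (by rw [e2]; simp) hA (by rw [e2]; exact hD)
  change Arrow.mk _ = Arrow.mk _
  dsimp only [Mor.comp]
  rw [key]
  exact insAll_arrow_congr _ _ _ _ _ _ _ _ _ (arrow_id_congr (by rw [e1]))
end

end AnMonoidal
end Associahedral

/-! ### Unary morphisms: substitution reduces to composition and products in the category. -/

namespace Associahedral

theorem arrow_comp_id_congr {C : Type u} [Category.{v} C] {X Y Z W : C} (f : X ⟶ Y) {g : Y ⟶ Z}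
    (h : Arrow.mk g = Arrow.mk (𝟙 W)) : Arrow.mk (f ≫ g) = Arrow.mk f := by
  cases h
  rw [Category.comp_id]

namespace AnMonoidal

variable {C : Type u} [Category.{v} C] {n : ℕ∞} {Q : AnMonoidal C n}

theorem mapL_idl {l src tgt : List C} (hs : src = (idl l).map (·.left))
    (ht : tgt = (idl l).map (·.right)) :
    Arrow.mk (Q.mapL (idl l) hs ht) = Arrow.mk (𝟙 (Q.mu l)) := by
  rw [mk_mapL]
  exact Q.muA_id l

section

variable [hn : Fact (((1 : ℕ) : ℕ∞) ≤ n)]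

/-- By condition (i) the associator of a one-letter block is an identity, so only the whiskering
remains. -/
theorem arrow_ins_arr {c : C} (pre : List C) (f : Arrow C) (post : List C) {src tgt t : List C}
    (hs : src = pre ++ (Q.arr f).c :: post) (ht : tgt = pre ++ (Q.arr f).y ++ post)
    (h : (tgt.length : ℕ∞) ≤ n) (φ : c ⟶ Q.mu src) (hs' : src = pre ++ f.left :: post)
    (ht' : t = pre ++ f.right :: post) :
    Arrow.mk (ins pre (Q.arr f) post hs ht h φ) = Arrow.mk (φ ≫ Q.wh pre f.hom post hs' ht') := by
  rw [ins, ← Category.assoc]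
  refine (arrow_comp_id_congr _ (W := Q.mu (pre ++ f.right :: post)) ?_).trans
    (arrow_comp_congr rfl ?_)
  · rw [mk_al]
    exact Q.alA_singleton (cast_le_of_le h (by simp [ht, arr]))
  · rw [mk_wh, mk_wh]
    congr 3
    exact arr_arrow f

theorem arrow_insAll_arr {c : C} (post : List C) (fs : List (Arrow C)) :
    ∀ (pre : List C) {src tgt t : List C} (hs : src = pre ++ (fs.map Q.arr).map (·.c) ++ post)
      (ht : tgt = pre ++ (fs.map Q.arr).flatMap (·.y) ++ post) (h : (tgt.length : ℕ∞) ≤ n)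
      (φ : c ⟶ Q.mu src) (hs' : src = (idl pre ++ fs ++ idl post).map (·.left))
      (ht' : t = (idl pre ++ fs ++ idl post).map (·.right)),
      Arrow.mk (insAll post (fs.map Q.arr) pre hs ht h φ) =
        Arrow.mk (φ ≫ Q.mapL (idl pre ++ fs ++ idl post) hs' ht') := by
  induction fs with
  | nil =>
    intro pre src tgt t hs ht h φ hs' ht'
    obtain rfl : src = tgt := by rw [hs, ht]; simp
    simp only [List.map_nil, insAll_nil]
    refine (arrow_comp_id_congr _ (W := Q.mu (pre ++ post)) ?_).symm
    rw [Q.mapL_congr (by simp : idl pre ++ [] ++ idl post = idl (pre ++ post))]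
    exact mapL_idl _ _
  | cons f fs ih =>
    intro pre src tgt t hs ht h φ hs' ht'
    have l2 := Mor.length_le_flatMap (fs.map Q.arr)
    rw [List.length_map] at l2
    have E : insAll post ((f :: fs).map Q.arr) pre hs ht h φ = _ := insAll_cons (ψ := Q.arr f) (ψs := fs.map Q.arr) (pre' := pre ++ [f.right])
      (mid := pre ++ f.right :: ((fs.map Q.arr).map (·.c) ++ post)) (hpre := rfl) (hpost := rfl)
      (h₁ := by simp) (h₂ := by simp [ht, arr]) (h₃ := by simp [hs]) (h₄ := by simp [arr])
      (h₅ := cast_le_of_le h (by simp [ht, arr, -List.length_flatMap]; omega)) ..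
    rw [E]
    have hl : (fs.map Q.arr).map (·.c) = fs.map (·.left) := by simp [arr, Function.comp_def]
    refine (ih (pre ++ [f.right]) _ _ h _ (t := t) (by simp [hl]) (by simp [ht'])).trans ?_
    refine (arrow_comp_congr (arrow_ins_arr pre f _ _ _ _ φ (by simp [hs, arr]) rfl) rfl).trans ?_
    rw [Category.assoc]
    congr 2
    let L : List (Σ X Y Z : C, (X ⟶ Y) × (Y ⟶ Z)) := idPairs pre ++
      ⟨f.left, f.right, f.right, f.hom, 𝟙 _⟩ :: (fs.map fun g => ⟨g.left, g.left, g.right, 𝟙 _, g.hom⟩)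
        ++ idPairs post
    refine Q.mapL_comp L ?_ ?_ ?_ _ _ _ _ _ _
    · simp [L, idPairs, idl, Function.comp_def, arr]
    · simp [L, idPairs, idl, Function.comp_def]
    · simp [L, idPairs, idl, Function.comp_def]

/-- The associator of a block that is the whole list is an identity, and so is `μ₁` as a functor;
thus substitution for the only letter is ordinary composition. -/
theorem arrow_ins_nil {c : C} (ψ : Q.Mor) {src tgt : List C} (hs : src = [] ++ ψ.c :: [])
    (ht : tgt = [] ++ ψ.y ++ []) (h : (tgt.length : ℕ∞) ≤ n) (φ : c ⟶ Q.mu src) {c' : C} {φ' : c' ⟶ ψ.c}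
    (e : Arrow.mk φ = Arrow.mk φ') :
    Arrow.mk (ins [] ψ [] hs ht h φ) = Arrow.mk (φ' ≫ ψ.φ) := by
  rw [ins]
  refine arrow_comp_congr e ?_
  refine (arrow_comp_id_congr _ (W := Q.mu ψ.y) ?_).trans ?_
  · rw [mk_al]
    exact Q.alA_all ψ.le hn.out
  · rw [mk_wh]
    exact Q.muA_singleton hn.out _

/-- Evaluation at a node whose incoming edges carry unary morphisms is therefore multiplication;
this is how corollas act by `μ`. -/
theorem join_arr {fs : List (Arrow C)} (hne : fs ≠ []) (h : (fs.length : ℕ∞) ≤ n) :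
    (join (fs.map Q.arr)).arrow = Q.muA fs ∧ (join (fs.map Q.arr)).y = fs.map (·.right) ∧ 
      (join (fs.map Q.arr)).c = Q.mu (fs.map (·.left)) := by
  have hy : (fs.map Q.arr).flatMap (·.y) = fs.map (·.right) := by
    induction fs with
    | nil => rfl
    | cons f fs ih =>
      rw [List.map_cons, List.flatMap_cons, List.map_cons]
      by_cases hfs : fs = []
      · subst hfs; rfl
      · rw [ih hfs (cast_le_of_le h (by simp))]; rfl
  have hc : (fs.map Q.arr).map (·.c) = fs.map (·.left) := by simp [arr, Function.comp_def]
  rw [join_of_le (by simpa using hne) (by simpa [hy] using h)]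
  refine ⟨?_, hy, congrArg Q.mu hc⟩
  refine (arrow_insAll_arr [] fs [] _ _ _ _ (t := fs.map (·.right)) (by simp [idl, hc])
    (by simp [idl])).trans ?_
  rw [Category.id_comp, mk_mapL]
  simp [idl]

theorem arrow_insAll_singleton {c : C} (ψ : Q.Mor) {src tgt : List C}
    (hs : src = [] ++ [ψ].map (·.c) ++ []) (ht : tgt = [] ++ [ψ].flatMap (·.y) ++ [])
    (h : (tgt.length : ℕ∞) ≤ n) (φ : c ⟶ Q.mu src) {c' : C} {φ' : c' ⟶ ψ.c} (e : Arrow.mk φ = Arrow.mk φ') :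
    Arrow.mk (insAll [] [ψ] [] hs ht h φ) = Arrow.mk (φ' ≫ ψ.φ) := by
  simp only [insAll]
  exact (Arrow.arrow_mk_comp_eqToHom _ _).trans (arrow_ins_nil ψ (by simp [hs]) (by simp) _ φ e)

theorem join_singleton (a : Q.Mor) : join [a] = a := by
  rw [join_of_le (by simp) (by simpa using a.le)]
  refine Mor.ext' (by simp) ?_
  dsimp only [Mor.arrow, Mor.comp]
  refine (arrow_insAll_singleton a _ _ _ _ (φ' := 𝟙 a.c) ?_).trans
    (congrArg Arrow.mk (Category.id_comp a.φ))
  exact arrow_id_congr (Q.mu_singleton hn.out a.c)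

theorem isComp_arr {X Y Z : C} (f : X ⟶ Y) (g : Y ⟶ Z) :
    (Q.arr (Arrow.mk f)).IsComp [Q.arr (Arrow.mk g)] (Q.arr (Arrow.mk (f ≫ g))) := by
  refine ⟨rfl, (Q.arr (Arrow.mk g)).le, Mor.ext' rfl ?_⟩
  rw [arr_arrow]
  dsimp only [Mor.arrow, Mor.comp]
  symm
  refine (arrow_insAll_singleton (Q.arr (Arrow.mk g)) _ _ _ _ (φ' := f) ?_).trans ?_
  · exact arr_arrow (Arrow.mk f)
  · exact arrow_comp_congr rfl (arr_arrow (Arrow.mk g))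

/-- Substitution commutes with precomposition, so a composite of `a` with the `bs` factors through
the `join` of the `bs`. -/
theorem join_of_isComp {a d : Q.Mor} {bs : List Q.Mor} (h : a.IsComp bs d) :
    (join bs).c = Q.mu a.y ∧ (join bs).y = d.y ∧ 
      ∀ e : Q.mu a.y = (join bs).c, d.arrow = Arrow.mk ((a.φ ≫ eqToHom e) ≫ (join bs).φ) := by
  obtain ⟨h1, h2, rfl⟩ := h
  have hne : bs ≠ [] := by rintro rfl; exact a.ne h1.symm
  rw [join_of_le hne h2]
  refine ⟨congrArg Q.mu h1, rfl, fun e => ?_⟩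
  have e1 := insAll_comp a.φ [] bs [] (src := a.y) (by simp [h1]) (by simp) h2 (𝟙 _)
  rw [Category.comp_id] at e1
  change Arrow.mk (insAll [] bs [] _ _ _ a.φ) = _
  rw [e1, Category.assoc]
  refine arrow_comp_congr rfl ?_
  exact (insAll_arrow_congr _ _ _ _ _ _ _ _ _ (arrow_id_congr (by rw [h1]))).trans
    (Arrow.arrow_mk_eqToHom_comp _ _).symm

/-- Used for an edge which survives in the middle word but not in the last one: the middle list is
replaced by its product. -/
theorem isComp_arr_join {a d : Q.Mor} {bs : List Q.Mor} (h : a.IsComp bs d) :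
    (Q.arr a.arrow).IsComp [join bs] d := by
  obtain ⟨h1, h2, h3⟩ := join_of_isComp h
  refine ⟨by simp only [List.map_cons, List.map_nil, h1]; rfl, by simpa using (join bs).le,
    Mor.ext' (by simp [Mor.comp, h2]) ?_⟩
  rw [h3 h1.symm]
  dsimp only [Mor.arrow, Mor.comp]
  symm
  refine arrow_insAll_singleton (join bs) _ _ _ _ ?_
  exact (arr_arrow a.arrow).trans (Arrow.arrow_mk_comp_eqToHom _ _).symm

/-- Used for an edge which survives in both the middle and the last word. -/
theorem isComp_arr_arr_join {a d : Q.Mor} {bs : List Q.Mor} (h : a.IsComp bs d) :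
    (Q.arr a.arrow).IsComp [Q.arr (join bs).arrow] (Q.arr d.arrow) := by
  obtain ⟨h1, h2, h3⟩ := join_of_isComp h
  refine ⟨by simp only [List.map_cons, List.map_nil]; exact congrArg (fun x => [x]) h1, 
    by simpa using (Q.arr (join bs).arrow).le, Mor.ext' ?_ ?_⟩
  · change [Q.mu d.y] = [Q.mu (join bs).y]
    rw [h2]
  rw [arr_arrow, h3 h1.symm]
  symm
  dsimp only [Mor.arrow, Mor.comp]
  refine (arrow_insAll_singleton (Q.arr (join bs).arrow) _ _ _ _
    (φ' := a.φ ≫ eqToHom h1.symm) ?_).trans ?_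
  · exact (arr_arrow a.arrow).trans (Arrow.arrow_mk_comp_eqToHom _ _).symm
  · exact arrow_comp_congr rfl (arr_arrow (join bs).arrow)

end
end AnMonoidal
end Associahedral

/-! ### Insensitivity to unit objects. -/

namespace Associahedral
namespace AnMonoidal

variable {C : Type u} [Category.{v} C] {n : ℕ∞} (Q : AnMonoidal C n)

open Classical in
/-- The list obtained by deleting the unit objects. -/
noncomputable def red (l : List C) : List C := l.filter fun c => c ≠ Q.zero

@[simp]
theorem red_append (l l' : List C) : Q.red (l ++ l') = Q.red l ++ Q.red l' := by
  simp [red]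

theorem red_cons_zero (l : List C) : Q.red (Q.zero :: l) = Q.red l := by
  simp [red]

theorem red_cons {c : C} (hc : c ≠ Q.zero) (l : List C) : Q.red (c :: l) = c :: Q.red l := by
  simp [red, hc]

theorem red_cons' (c : C) (l : List C) : Q.red (c :: l) = Q.red [c] ++ Q.red l := by
  rw [← red_append]; rfl

theorem length_red_le (l : List C) : (Q.red l).length ≤ l.length := List.length_filter_le _ _

/-- A property of lists which is insensitive to unit objects in the middle. -/
theorem red_induction {α : Type*} (F : List C → α) (N : ℕ)
    (hF : ∀ pre post, (pre ++ post).length + 1 ≤ N → F (pre ++ Q.zero :: post) = F (pre ++ post)) :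
    ∀ l pre : List C, (pre ++ l).length ≤ N → F (pre ++ l) = F (pre ++ Q.red l)
  | [], pre, _ => rfl
  | c :: l, pre, h => by
    have h' : (pre ++ l).length + 1 ≤ N := by simpa [add_assoc] using h
    by_cases hc : c = Q.zero
    · subst hc
      rw [red_cons_zero, hF _ _ h', red_induction F N hF l pre (by omega)]
    · rw [red_cons _ hc]
      have := red_induction F N hF l (pre ++ [c]) (by simpa using h)
      simpa using this

theorem muA_red (fs gs : List (Arrow C)) (l : List C)
    (h : ((fs.length + l.length + gs.length : ℕ) : ℕ∞) ≤ n) :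
    Q.muA (fs ++ idl l ++ gs) = Q.muA (fs ++ idl (Q.red l) ++ gs) := by
  refine Q.red_induction (fun l => Q.muA (fs ++ idl l ++ gs)) l.length (fun pre post hl => ?_) l []
    le_rfl
  have := Q.muA_zero_mid (fs := fs ++ idl pre) (gs := idl post ++ gs)
    (cast_le_of_le h (by simp [idl] at hl ⊢; omega))
  simpa using this

theorem mu_red {l : List C} (h : (l.length : ℕ∞) ≤ n) : Q.mu l = Q.mu (Q.red l) := by
  have := congrArg (·.left) (Q.muA_red [] [] l (by simpa using h))
  simpa [muA_left] using this

theorem mu_congr_red {l l' : List C} (h : (l.length : ℕ∞) ≤ n) (h' : (l'.length : ℕ∞) ≤ n)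
    (e : Q.red l = Q.red l') : Q.mu l = Q.mu l' := by
  rw [Q.mu_red h, Q.mu_red h', e]

theorem muA_cons_red (xs zs : List C) (f : Arrow C)
    (h : ((xs.length + 1 + zs.length : ℕ) : ℕ∞) ≤ n) :
    Q.muA (idl xs ++ f :: idl zs) = Q.muA (idl (Q.red xs) ++ f :: idl (Q.red zs)) := by
  have h1 := Q.muA_red [] (f :: idl zs) xs (cast_le_of_le h (by simp [idl]; omega))
  have h2 := Q.muA_red (idl (Q.red xs) ++ [f]) [] zs (cast_le_of_le h (by
    have := Q.length_red_le xs
    simp [idl]; omega))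
  simp only [List.nil_append, List.append_nil, List.append_assoc, List.singleton_append] at h1 h2
  rw [h1, h2]

/-- Conditions (ii), (iv) and (iii), each iterated, delete the unit objects before, inside and after
the block. -/
theorem alA_red (xs ys zs : List C) (h : ((xs.length + ys.length + zs.length : ℕ) : ℕ∞) ≤ n)
    (h' : ((xs.length + 1 + zs.length : ℕ) : ℕ∞) ≤ n) :
    Q.alA xs ys zs = Q.alA (Q.red xs) (Q.red ys) (Q.red zs) := by
  have lx := Q.length_red_le xs
  have ly := Q.length_red_le ys
  have e1 := Q.red_induction (fun l => Q.alA l ys zs) xs.length (fun pre post hl => by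
    rw [List.length_append] at hl
    exact Q.alA_unit_left (cast_le_of_le h (by simp; omega)) (cast_le_of_le h' (by omega)))
    xs [] le_rfl
  have e2 := Q.red_induction (fun l => Q.alA (Q.red xs) l zs) ys.length (fun pre post hl => by
    rw [List.length_append] at hl
    exact Q.alA_unit_mid (cast_le_of_le h (by simp; omega)) (cast_le_of_le h' (by omega)))
    ys [] le_rfl
  have e3 := Q.red_induction (fun l => Q.alA (Q.red xs) (Q.red ys) l) zs.length
    (fun pre post hl => by
      rw [List.length_append] at hl
      exact Q.alA_unit_right (cast_le_of_le h (by simp; omega)) (cast_le_of_le h' (by omega)))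
    zs [] le_rfl
  simp only [List.nil_append] at e1 e2 e3
  rw [e1, e2, e3]

variable {Q}

namespace Mor

/-- Morphisms which agree up to unit objects in the target list. -/
def Eqv (a b : Q.Mor) : Prop := a.arrow = b.arrow ∧ Q.red a.y = Q.red b.y

/-- Identity morphisms of the unit object. -/
def IsZero (a : Q.Mor) : Prop := a.arrow = Arrow.mk (𝟙 Q.zero) ∧ Q.red a.y = []

theorem Eqv.refl (a : Q.Mor) : a.Eqv a := ⟨rfl, rfl⟩

theorem Eqv.c_eq {a b : Q.Mor} (h : a.Eqv b) : a.c = b.c := congrArg Arrow.leftFunc.obj h.1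

theorem IsZero.c_eq {a : Q.Mor} (h : a.IsZero) : a.c = Q.zero := congrArg Arrow.leftFunc.obj h.1

/-- The second list is obtained from the first by deleting zero morphisms and replacing the others
by equivalent ones. -/
inductive Reduces : List Q.Mor → List Q.Mor → Prop
  | nil : Reduces [] []
  | cons {a b : Q.Mor} {as bs : List Q.Mor} : a.Eqv b → Reduces as bs → Reduces (a :: as) (b :: bs)
  | zero {a : Q.Mor} {as bs : List Q.Mor} : a.IsZero → Reduces as bs → Reduces (a :: as) bs

theorem Reduces.red_c {as bs : List Q.Mor} (h : Reduces as bs) :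
    Q.red (as.map (·.c)) = Q.red (bs.map (·.c)) := by
  induction h with
  | nil => rfl
  | cons h _ ih => rw [List.map_cons, List.map_cons, red_cons', ih, h.c_eq, ← red_cons']
  | zero h _ ih => rw [List.map_cons, h.c_eq, red_cons_zero, ih]

theorem Reduces.red_y {as bs : List Q.Mor} (h : Reduces as bs) :
    Q.red (as.flatMap (·.y)) = Q.red (bs.flatMap (·.y)) := by
  induction h with
  | nil => rfl
  | cons h _ ih => simp [ih, h.2]
  | zero h _ ih => simp [ih, h.2]

end Mor

theorem arrow_ins_congr {c c' : C} {pre pre' post post' : List C} {ψ ψ' : Q.Mor} (hψ : ψ.Eqv ψ')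
    {src tgt src' tgt' : List C} (hs : src = pre ++ ψ.c :: post) (ht : tgt = pre ++ ψ.y ++ post)
    (h : (tgt.length : ℕ∞) ≤ n) (φ : c ⟶ Q.mu src) (hs' : src' = pre' ++ ψ'.c :: post')
    (ht' : tgt' = pre' ++ ψ'.y ++ post') (h' : (tgt'.length : ℕ∞) ≤ n) (φ' : c' ⟶ Q.mu src')
    (hpre : Q.red pre = Q.red pre') (hpost : Q.red post = Q.red post')
    (hφ : Arrow.mk φ = Arrow.mk φ') :
    Arrow.mk (ins pre ψ post hs ht h φ) = Arrow.mk (ins pre' ψ' post' hs' ht' h' φ') := by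
  have l1 := List.length_pos_of_ne_nil ψ.ne
  have l2 := List.length_pos_of_ne_nil ψ'.ne
  have e1 := hψ.1
  unfold Mor.arrow at e1
  refine arrow_comp_congr hφ (arrow_comp_congr ?_ ?_)
  · rw [mk_wh, mk_wh, muA_cons_red _ _ _ _ (cast_le_of_le h (by simp [ht]; omega)),
      muA_cons_red Q pre' _ _ (cast_le_of_le h' (by simp [ht']; omega)), hpre, hpost, e1]
  · rw [mk_al, mk_al, alA_red, alA_red _ pre', hpre, hpost, hψ.2]
    · exact cast_le_of_le h' (by simp [ht']; omega)
    · exact cast_le_of_le h' (by simp [ht']; omega)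
    · exact cast_le_of_le h (by simp [ht]; omega)
    · exact cast_le_of_le h (by simp [ht]; omega)

/-- After deletion of unit objects the associator is that of an empty block, an identity by
condition (i); the whiskered morphism is a product of identities. -/
theorem arrow_ins_zero {c : C} {pre post : List C} {ψ : Q.Mor} (hψ : ψ.IsZero)
    {src tgt : List C} (hs : src = pre ++ ψ.c :: post) (ht : tgt = pre ++ ψ.y ++ post)
    (h : (tgt.length : ℕ∞) ≤ n) (φ : c ⟶ Q.mu src) :
    Arrow.mk (ins pre ψ post hs ht h φ) = Arrow.mk φ := by
  have l1 := List.length_pos_of_ne_nil ψ.ne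
  have l2 := Q.length_red_le pre
  have l3 := Q.length_red_le post
  have e1 := hψ.1
  unfold Mor.arrow at e1
  rw [ins, ← Category.assoc]
  refine (arrow_comp_id_congr _ (W := Q.mu (Q.red pre ++ Q.red post)) ?_).trans
    (arrow_comp_id_congr _ (W := Q.mu (pre ++ Q.zero :: post)) ?_)
  · rw [mk_al, alA_red, hψ.2]
    · exact Q.alA_nil (cast_le_of_le h (by simp [ht]; omega))
    · exact cast_le_of_le h (by simp [ht]; omega)
    · exact cast_le_of_le h (by simp [ht]; omega)
  · rw [mk_wh, e1, ← Q.muA_id]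
    simp [idl]

/-- Letter by letter from `arrow_ins_congr` and `arrow_ins_zero`. The two target lists may differ by
unit objects, but the morphisms of the category are the same. -/
theorem arrow_insAll_reduces {as bs : List Q.Mor} (hab : Mor.Reduces as bs) :
    ∀ {c c' : C} {pre pre' post post' : List C} {src tgt src' tgt' : List C}
      (hs : src = pre ++ as.map (·.c) ++ post) (ht : tgt = pre ++ as.flatMap (·.y) ++ post)
      (h : (tgt.length : ℕ∞) ≤ n) (φ : c ⟶ Q.mu src)
      (hs' : src' = pre' ++ bs.map (·.c) ++ post')
      (ht' : tgt' = pre' ++ bs.flatMap (·.y) ++ post') (h' : (tgt'.length : ℕ∞) ≤ n)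
      (φ' : c' ⟶ Q.mu src') (_ : Q.red pre = Q.red pre') (_ : Q.red post = Q.red post')
      (_ : Arrow.mk φ = Arrow.mk φ'),
      Arrow.mk (insAll post as pre hs ht h φ) = Arrow.mk (insAll post' bs pre' hs' ht' h' φ') := by
  induction hab with
  | nil =>
    intro c c' pre pre' post post' src tgt src' tgt' hs ht h φ hs' ht' h' φ' hpre hpost hφ
    simp only [insAll, Arrow.arrow_mk_comp_eqToHom, hφ]
  | cons hψ hr ih =>
    intro c c' pre pre' post post' src tgt src' tgt' hs ht h φ hs' ht' h' φ' hpre hpost hφ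
    simp only [insAll]
    refine ih _ _ _ _ _ _ _ _ (by simp [hpre, hψ.2]) hpost ?_
    exact arrow_ins_congr hψ _ _ _ _ _ _ _ _ hpre (by simp [hr.red_c, hpost]) hφ
  | zero hψ hr ih =>
    intro c c' pre pre' post post' src tgt src' tgt' hs ht h φ hs' ht' h' φ' hpre hpost hφ
    simp only [insAll]
    refine ih _ _ _ _ _ _ _ _ (by simp [hpre, hψ.2]) hpost ?_
    rw [arrow_ins_zero hψ, hφ]

section

variable [hn : Fact (((1 : ℕ) : ℕ∞) ≤ n)]

theorem join_reduces {as bs : List Q.Mor} (hab : Mor.Reduces as bs) (hb : bs ≠ [])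
    (h : ((as.flatMap (·.y)).length : ℕ∞) ≤ n) (h' : ((bs.flatMap (·.y)).length : ℕ∞) ≤ n) :
    (join as).Eqv (join bs) := by
  have ha : as ≠ [] := by rintro rfl; cases hab; exact hb rfl
  have l1 := Mor.length_le_flatMap as
  have l2 := Mor.length_le_flatMap bs
  rw [join_of_le ha h, join_of_le hb h']
  refine ⟨?_, hab.red_y⟩
  refine arrow_insAll_reduces hab _ _ _ _ _ _ _ _ rfl rfl (arrow_id_congr ?_)
  exact Q.mu_congr_red (cast_le_of_le h (by simpa using l1)) (cast_le_of_le h' (by simpa using l2))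
    hab.red_c

theorem isZero_arr_zero : (Q.arr (Arrow.mk (𝟙 Q.zero))).IsZero :=
  ⟨arr_arrow _, Q.red_cons_zero []⟩

/-- Complements `join_reduces` when no member remains: both `join []` and the product of units are
the identity of the unit object. -/
theorem join_isZero {as : List Q.Mor} (hab : Mor.Reduces as [])
    (h : ((as.flatMap (·.y)).length : ℕ∞) ≤ n) : (join as).IsZero := by
  by_cases ha : as = []
  · subst ha
    rw [join_nil]
    exact isZero_arr_zero
  have l1 := Mor.length_le_flatMap as
  rw [join_of_le ha h]
  refine ⟨?_, hab.red_y⟩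
  have hmu : Q.mu (as.map (·.c)) = Q.mu [] :=
    Q.mu_congr_red (cast_le_of_le h (by simpa using l1)) zero_le_enat hab.red_c
  refine (arrow_insAll_reduces hab _ _ _ _ (c' := Q.mu []) (pre' := []) (post' := []) (src' := [])
    (tgt' := []) rfl rfl zero_le_enat (𝟙 _) rfl rfl (arrow_id_congr hmu)).trans ?_
  rw [insAll_nil, mu_nil]

end

end AnMonoidal
end Associahedral

namespace Associahedral
namespace PWord

/-! ### The ordered list of incoming edges -/

/-- Every element of `s` is smaller than every element of `t`. -/
def Before {α : Type*} [LT α] (s t : Finset α) : Prop := ∀ x ∈ s, ∀ y ∈ t, x < y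

theorem Before.mono {α : Type*} [LT α] {s t s' t' : Finset α} (h : Before s t) (hs : s' ⊆ s)
    (ht : t' ⊆ t) : Before s' t' := fun x hx y hy => h x (hs hx) y (ht hy)

/-- A list of nonempty sets ordered by `Before` is determined by its elements. -/
theorem eq_of_pairwise_before {α : Type*} [LinearOrder α] {l l' : List (Finset α)}
    (hl : l.Pairwise Before) (hl' : l'.Pairwise Before) (hne : ∀ q ∈ l, q.Nonempty)
    (h : ∀ q, q ∈ l ↔ q ∈ l') : l = l' := by
  have key : ∀ {l : List (Finset α)}, l.Pairwise Before → (∀ q ∈ l, q.Nonempty) → l.Nodup := by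
    intro l hl hne
    refine List.Pairwise.imp_of_mem ?_ hl
    rintro s t hs ht hst rfl
    obtain ⟨x, hx⟩ := hne s hs
    exact lt_irrefl x (hst x hx x hx)
  refine List.Perm.eq_of_pairwise ?_ hl hl' ((List.perm_ext_iff_of_nodup (key hl hne)
    (key hl' fun q hq => hne q ((h q).2 hq))).2 h)
  intro s t hs ht hst hts
  obtain ⟨x, hx⟩ := hne s hs
  obtain ⟨y, hy⟩ := hne t ((h t).2 ht)
  exact absurd (hst x hx y hy) (hts y hy x hx).asymm

variable {m : ℕ}

theorem mem_inputs {w : PWord m} {p q : Finset (Fin m)} :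
    q ∈ w.inputs p ↔ q ∈ w.edges ∧ q ⊂ p ∧ ∀ r ∈ w.edges, q ⊂ r → ¬ r ⊂ p :=
  Finset.mem_filter

theorem edges_interval {w : PWord m} {p : Finset (Fin m)} (hp : p ∈ w.edges)
    {x y z : Fin m} (hx : x ∈ p) (hz : z ∈ p) (hxy : x ≤ y) (hyz : y ≤ z) : y ∈ p := by
  rcases mem_edges.1 hp with h | ⟨t, rfl⟩
  · exact nodes_interval (Finset.mem_insert_of_mem h) hx hz hxy hyz
  · rw [Finset.mem_singleton] at *
    subst hx hz
    exact le_antisymm hyz hxy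

/-- Edges are intervals, and two interleaved intervals would have a common point. -/
theorem before_or_before {w : PWord m} {p q : Finset (Fin m)} (hp : p ∈ w.edges)
    (hq : q ∈ w.edges) (h : Disjoint p q) : Before p q ∨ Before q p := by
  by_contra hcon
  rw [not_or] at hcon
  obtain ⟨h1, h2⟩ := hcon
  unfold Before at h1 h2
  push Not at h1 h2
  obtain ⟨x, hx, y, hy, hyx⟩ := h1
  obtain ⟨y', hy', x', hx', hxy'⟩ := h2
  have hd := Finset.disjoint_left.1 h
  rcases le_total y x' with h3 | h3
  · exact hd hx' (edges_interval hq hy hy' h3 hxy')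
  · exact hd (edges_interval hp hx' hx h3 hyx) hy

/-- The incoming edges of a node in their natural order. -/
noncomputable def children (w : PWord m) (p : Finset (Fin m)) : List (Finset (Fin m)) :=
  (w.inputs p).toList.mergeSort fun s t => decide (s.min ≤ t.min)

@[simp]
theorem mem_children {w : PWord m} {p q : Finset (Fin m)} :
    q ∈ w.children p ↔ q ∈ w.inputs p := by
  simp [children]

theorem length_children (w : PWord m) (p : Finset (Fin m)) :
    (w.children p).length = (w.inputs p).card := by
  simp [children]

theorem inputs_disjoint {w : PWord m} {p q r : Finset (Fin m)} (hq : q ∈ w.inputs p)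
    (hr : r ∈ w.inputs p) (h : q ≠ r) : Disjoint q r :=
  Finset.disjoint_left.2 fun _ hx hx' => h (inputs_eq hq hr hx hx')

theorem pairwise_children (w : PWord m) (p : Finset (Fin m)) :
    (w.children p).Pairwise Before := by
  have h1 : (w.children p).Pairwise fun s t => s.min ≤ t.min := by
    have := List.pairwise_mergeSort (le := fun s t : Finset (Fin m) => decide (s.min ≤ t.min))
      (by intro a b c h h'; exact decide_eq_true ((of_decide_eq_true h).trans (of_decide_eq_true h')))
      (by intro a b; rcases le_total a.min b.min with h | h <;> simp only [h, decide_true, Bool.true_or, Bool.or_true])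
      (w.inputs p).toList
    exact this.imp of_decide_eq_true
  have h2 : (w.children p).Nodup :=
    (List.mergeSort_perm _ _).nodup_iff.2 (Finset.nodup_toList _)
  refine List.Pairwise.imp_of_mem ?_ (List.Pairwise.and h1 h2)
  rintro s t hs ht ⟨hle, hne⟩
  rw [mem_children] at hs ht
  rcases before_or_before (mem_inputs.1 hs).1 (mem_inputs.1 ht).1
    (inputs_disjoint hs ht hne) with h | h
  · exact h
  · exfalso
    have hs' := edges_nonempty (mem_inputs.1 hs).1
    have ht' := edges_nonempty (mem_inputs.1 ht).1
    rw [← Finset.coe_min' hs', ← Finset.coe_min' ht', WithTop.coe_le_coe] at hle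
    exact absurd (h _ (t.min'_mem ht') _ (s.min'_mem hs')) (not_lt.2 hle)

theorem nonempty_of_mem_children {w : PWord m} {p q : Finset (Fin m)} (h : q ∈ w.children p) :
    q.Nonempty := edges_nonempty (mem_inputs.1 (mem_children.1 h)).1

theorem eq_children {w : PWord m} {p : Finset (Fin m)} {l : List (Finset (Fin m))}
    (hl : l.Pairwise Before) (h : ∀ q, q ∈ l ↔ q ∈ w.inputs p) : w.children p = l :=
  eq_of_pairwise_before (w.pairwise_children p) hl (fun _ hq => nonempty_of_mem_children hq)
    fun q => by rw [mem_children, h]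

theorem edges_mono {w w' : PWord m} (h : w ≤ w') : w'.edges ⊆ w.edges :=
  Finset.union_subset_union_left h

theorem ne_singleton_of_mem_inputs {w : PWord m} {p q : Finset (Fin m)} (hq : q ∈ w.inputs p)
    (x : Fin m) : p ≠ {x} := by
  rintro rfl
  have h1 := Finset.card_lt_card (mem_inputs.1 hq).2.1
  have h2 := Finset.card_pos.2 (edges_nonempty (mem_inputs.1 hq).1)
  rw [Finset.card_singleton] at h1
  omega

theorem subset_or_subset_of_mem {w : PWord m} {p q : Finset (Fin m)} (hp : p ∈ w.edges)
    (hq : q ∈ w.edges) {x : Fin m} (hxp : x ∈ p) (hxq : x ∈ q) : p ⊆ q ∨ q ⊆ p := by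
  rcases edges_nested hp hq with h | h | h
  · exact Or.inl h
  · exact Or.inr h
  · exact absurd hxq (Finset.disjoint_left.1 h hxp)

/-- `q` is the set of leaves above an edge, possibly the root edge. -/
def IsEdge (w : PWord m) (q : Finset (Fin m)) : Prop := q ∈ w.edges ∨ q = Finset.univ

open Classical in
/-- The edges of `w'` at which the part of the tree of `w'` below the edge `q` of a tree `w ≤ w'`
is cut off. -/
noncomputable def top (w' : PWord m) (q : Finset (Fin m)) : List (Finset (Fin m)) :=
  if w'.IsEdge q then [q] else w'.children q

/-- Every edge of `w'` is an edge of `w`, so one properly contained in `p` lies in a maximal edge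
`q` of `w` properly contained in `p`. The maximal edges of `w'` found this way are `q` itself if it
survives, and otherwise the maximal edges of `w'` properly inside `q`. This is the combinatorial
core of functoriality; `p` need not be a node of either tree. -/
theorem children_eq_flatMap {w w' : PWord m} (h : w ≤ w') (p : Finset (Fin m)) :
    w'.children p = (w.children p).flatMap w'.top := by
  have hne : ∀ q ∈ w.inputs p, q ≠ Finset.univ := by
    rintro q hq rfl
    exact (mem_inputs.1 hq).2.1.2 (Finset.subset_univ _)
  refine eq_children ?_ ?_
  · rw [List.pairwise_flatMap]
    have hsub : ∀ q s, s ∈ w'.top q → s ⊆ q := by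
      intro q s hs
      rw [top] at hs
      split_ifs at hs
      · rw [List.mem_singleton.1 hs]
      · exact (mem_inputs.1 (mem_children.1 hs)).2.1.1
    refine ⟨fun q _ => ?_, (w.pairwise_children p).imp fun {q r} hqr s hs t ht =>
      hqr.mono (hsub q s hs) (hsub r t ht)⟩
    rw [top]
    split_ifs
    · simp
    · exact w'.pairwise_children q
  · intro r
    rw [List.mem_flatMap]
    constructor
    · rintro ⟨q, hq, hr⟩
      rw [mem_children] at hq
      have hq' := mem_inputs.1 hq
      rw [top] at hr
      split_ifs at hr with hc
      · rw [List.mem_singleton.1 hr]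
        have hc := hc.resolve_right (hne q hq)
        exact mem_inputs.2 ⟨hc, hq'.2.1, fun r hr => hq'.2.2 r (edges_mono h hr)⟩
      · rw [IsEdge, not_or] at hc
        have hr' := mem_inputs.1 (mem_children.1 hr)
        refine mem_inputs.2 ⟨hr'.1, hr'.2.1.trans hq'.2.1, fun s hs hrs hsp => ?_⟩
        obtain ⟨x, hx⟩ := edges_nonempty hr'.1
        rcases subset_or_subset_of_mem (edges_mono h hs) hq'.1 (hrs.1 hx) (hr'.2.1.1 hx) with h1 | h1
        · refine hr'.2.2 s hs hrs (h1.ssubset_of_ne ?_)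
          rintro rfl
          exact hc.1 hs
        · refine hq'.2.2 s (edges_mono h hs) (h1.ssubset_of_ne ?_) hsp
          rintro rfl
          exact hc.1 hs
    · intro hr
      have hr' := mem_inputs.1 hr
      obtain ⟨x, hx⟩ := edges_nonempty hr'.1
      obtain ⟨q, hq, hxq⟩ := exists_inputs w (hr'.2.1.1 hx) (ne_singleton_of_mem_inputs hr x)
      have hq' := mem_inputs.1 hq
      refine ⟨q, mem_children.2 hq, ?_⟩
      have hrq : r ⊆ q := by
        rcases subset_or_subset_of_mem (edges_mono h hr'.1) hq'.1 hx hxq with h1 | h1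
        · exact h1
        · by_contra hcon
          exact hq'.2.2 r (edges_mono h hr'.1) ⟨h1, hcon⟩ hr'.2.1
      rw [top]
      by_cases hqe : q ∈ w'.edges
      · rw [if_pos (show w'.IsEdge q from Or.inl hqe), List.mem_singleton]
        by_contra hcon
        exact hr'.2.2 q hqe (hrq.ssubset_of_ne hcon) hq'.2.1
      · rw [if_neg (show ¬ w'.IsEdge q from not_or.2 ⟨hqe, hne q hq⟩), mem_children]
        refine mem_inputs.2 ⟨hr'.1, hrq.ssubset_of_ne ?_, fun s hs hrs hsq =>
          hr'.2.2 s hs hrs (hsq.trans hq'.2.1)⟩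
        rintro rfl
        exact hqe hr'.1

theorem IsEdge.mono {w w' : PWord m} (h : w ≤ w') {p : Finset (Fin m)} (hp : w'.IsEdge p) :
    w.IsEdge p := hp.imp_left fun h' => edges_mono h h'

theorem IsEdge.of_mem_children {w : PWord m} {p q : Finset (Fin m)} (h : q ∈ w.children p) :
    w.IsEdge q := Or.inl (mem_inputs.1 (mem_children.1 h)).1

theorem isEdge_univ (w : PWord m) : w.IsEdge Finset.univ := Or.inr rfl

theorem isEdge_singleton (w : PWord m) (x : Fin m) : w.IsEdge {x} :=
  Or.inl (mem_edges.2 (Or.inr ⟨x, rfl⟩))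

theorem card_lt_of_mem_children {w : PWord m} {p q : Finset (Fin m)} (h : q ∈ w.children p) :
    q.card < p.card := Finset.card_lt_card (mem_inputs.1 (mem_children.1 h)).2.1

theorem mem_nodes {w : PWord m} {p : Finset (Fin m)} :
    p ∈ w.nodes ↔ p = Finset.univ ∨ p ∈ w.parens := Finset.mem_insert

theorem mem_parens_of_mem_edges {w : PWord m} {p : Finset (Fin m)} (h : p ∈ w.edges)
    (hp : 2 ≤ p.card) : p ∈ w.parens := by
  rcases mem_edges.1 h with h | ⟨x, rfl⟩
  · exact h
  · rw [Finset.card_singleton] at hp; omega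

theorem IsEdge.mem_nodes {w : PWord m} {p : Finset (Fin m)} (h : w.IsEdge p) (hp : 2 ≤ p.card) :
    p ∈ w.nodes :=
  PWord.mem_nodes.2 (h.symm.imp_right fun h => mem_parens_of_mem_edges h hp)

theorem isEdge_of_mem_nodes {w : PWord m} {p : Finset (Fin m)} (h : p ∈ w.nodes) : w.IsEdge p :=
  (PWord.mem_nodes.1 h).symm.imp_left fun h => mem_edges.2 (Or.inl h)

/-- The node `p` may be missing in `w'`. The maximal edges of `w'` inside it are then among the
incoming edges of the smallest node of `w'` containing `p`. -/
theorem length_children_le {n : ℕ∞} {w w' : PWord m} (h : w ≤ w') (hw : w'.InFiltration n)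
    {p : Finset (Fin m)} (hp : p ∈ w.nodes) : ((w'.children p).length : ℕ∞) ≤ n := by
  rw [length_children]
  have hne : (w'.nodes.filter fun p' => p ⊆ p').Nonempty :=
    ⟨Finset.univ, Finset.mem_filter.2 ⟨Finset.mem_insert_self _ _, Finset.subset_univ _⟩⟩
  obtain ⟨p', hp', hmin⟩ := Finset.exists_min_image _ Finset.card hne
  rw [Finset.mem_filter] at hp'
  refine le_trans ?_ (hw p' hp'.1)
  have : w'.inputs p ⊆ w'.inputs p' := by
    intro r hr
    have hr' := mem_inputs.1 hr
    refine mem_inputs.2 ⟨hr'.1, hr'.2.1.trans_subset hp'.2, fun s hs hrs hsp => ?_⟩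
    have hsn : s ∈ w'.nodes := by
      refine mem_nodes.2 (Or.inr (mem_parens_of_mem_edges hs ?_))
      have h1 := Finset.card_lt_card hrs
      have h2 := Finset.card_pos.2 (edges_nonempty hr'.1)
      omega
    have hps : ¬ p ⊆ s := fun hps =>
      absurd (hmin s (Finset.mem_filter.2 ⟨hsn, hps⟩)) (not_le.2 (Finset.card_lt_card hsp))
    obtain ⟨x, hx⟩ := edges_nonempty hr'.1
    rcases nodes_nested (nodes_mono h hsn) hp with h1 | h1 | h1
    · exact hr'.2.2 s hs hrs ⟨h1, hps⟩
    · exact hps h1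
    · exact Finset.disjoint_left.1 h1 (hrs.1 hx) (hr'.2.1.1 hx)
  exact_mod_cast Finset.card_le_card this

theorem children_ne_nil (w : PWord m) {p : Finset (Fin m)} (hp : 2 ≤ p.card) :
    w.children p ≠ [] := by
  obtain ⟨x, hx⟩ := Finset.card_pos.1 (by omega : 0 < p.card)
  obtain ⟨q, hq, -⟩ := exists_inputs w hx (by rintro rfl; simp at hp)
  exact List.ne_nil_of_mem (mem_children.2 hq)

theorem children_eq_nil (w : PWord m) {p : Finset (Fin m)} (hp : p.card ≤ 1) :
    w.children p = [] := by
  refine List.eq_nil_iff_forall_not_mem.2 fun q hq => ?_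
  have h1 := Finset.card_lt_card (mem_inputs.1 (mem_children.1 hq)).2.1
  have h2 := Finset.card_pos.2 (nonempty_of_mem_children hq)
  omega

/-! ### The incoming edges of the nodes of a composite -/

variable {k : Fin m → ℕ}

theorem card_inner (i : Fin m) (q : Finset (Fin (k i))) : (inner k i q).card = q.card :=
  Finset.card_map _

theorem apply_mem_inner {i : Fin m} {j : Fin (k i)} {q : Finset (Fin (k i))} :
    finSigmaFinEquiv ⟨i, j⟩ ∈ inner k i q ↔ j ∈ q := by
  rw [mem_inner]
  constructor
  · rintro ⟨j', hj', h⟩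
    obtain rfl : j' = j := by simpa using h
    exact hj'
  · exact fun h => ⟨j, h, rfl⟩

theorem before_inner {i : Fin m} {q r : Finset (Fin (k i))} (h : Before q r) :
    Before (inner k i q) (inner k i r) := by
  intro x hx y hy
  obtain ⟨j, hj, rfl⟩ := mem_inner.1 hx
  obtain ⟨j', hj', rfl⟩ := mem_inner.1 hy
  exact not_le.1 fun hle => absurd (h j hj j' hj') (not_lt.2 ((apply_le_apply _ _ _).1 hle))

theorem before_outer {p q : Finset (Fin m)} (h : Before p q) : Before (outer k p) (outer k q) :=
  fun _ hx _ hy => lt_of_block_lt (h _ (mem_outer.1 hx) _ (mem_outer.1 hy))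

/-- An edge strictly in between comes from `T i`, since a union of blocks which meets block `i`
contains all of it. -/
theorem inner_mem_inputs (S : PWord m) (T : ∀ i, PWord (k i)) {i : Fin m}
    {q r : Finset (Fin (k i))} (hr : r ∈ (T i).inputs q) :
    inner k i r ∈ (comp S T).inputs (inner k i q) := by
  have hr' := mem_inputs.1 hr
  obtain ⟨j, hjr⟩ := edges_nonempty hr'.1
  have hss : inner k i r ⊂ inner k i q := Finset.map_ssubset_map.2 hr'.2.1
  have hre : inner k i r ∈ (comp S T).edges :=
    inner_mem_edges_comp hr'.1 (hss.trans_subset (Finset.subset_univ _))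
  refine mem_inputs.2 ⟨hre, hss, ?_⟩
  intro t ht hrt htq
  have h0 := Finset.card_pos.2 (edges_nonempty hre)
  have h0' := Finset.card_lt_card hrt
  have h := mem_parens_of_mem_edges ht (by omega)
  rcases mem_graft.1 (Finset.mem_filter.1 h).1 with ⟨p, hp, rfl⟩ | ⟨i', q', hq', rfl⟩
  · have hi := hrt.1 (apply_mem_inner.2 hjr)
    rw [mem_outer, block_apply] at hi
    exact htq.2 (inner_subset_outer hi q)
  · obtain ⟨l, -, hl⟩ := mem_inner.1 (hrt.1 (apply_mem_inner.2 hjr))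
    have hii := congrArg (block k) hl
    rw [block_apply, block_apply] at hii
    subst hii
    have h1 : r ⊂ q' := Finset.map_ssubset_map.1 hrt
    have h2 : q' ⊂ q := Finset.map_ssubset_map.1 htq
    refine hr'.2.2 q' (mem_edges.2 (Or.inl ?_)) h1 h2
    refine (mem_nodes.1 hq').resolve_left ?_
    rintro rfl
    exact h2.2 (Finset.subset_univ q)

theorem children_inner (S : PWord m) (T : ∀ i, PWord (k i)) (i : Fin m) (q : Finset (Fin (k i))) :
    (comp S T).children (inner k i q) = ((T i).children q).map (inner k i) := by
  refine eq_children ?_ ?_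
  · exact List.pairwise_map.2 (((T i).pairwise_children q).imp before_inner)
  intro c
  rw [List.mem_map]
  constructor
  · rintro ⟨r, hr, rfl⟩
    exact inner_mem_inputs S T (mem_children.1 hr)
  · intro hc
    have hc' := mem_inputs.1 hc
    obtain ⟨x, hx⟩ := edges_nonempty hc'.1
    obtain ⟨j, hj, rfl⟩ := mem_inner.1 (hc'.2.1.1 hx)
    obtain ⟨r, hr, hjr⟩ := exists_inputs (T i) hj (by
      rintro rfl
      refine ne_singleton_of_mem_inputs hc (finSigmaFinEquiv ⟨i, j⟩) ?_
      exact Finset.map_singleton _ _)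
    exact ⟨r, mem_children.2 hr, inputs_eq (inner_mem_inputs S T hr) hc (apply_mem_inner.2 hjr) hx⟩

/-- An edge strictly in between comes from `S`, since a subset of one block which meets `outer k r`
lies inside it. -/
theorem outer_mem_inputs (S : PWord m) (T : ∀ i, PWord (k i)) {p r : Finset (Fin m)}
    (hp : p ∈ S.nodes) (hr : r ∈ S.inputs p) (hne : (outer k r).Nonempty)
    (hrp : outer k r ≠ outer k p) : outer k r ∈ (comp S T).inputs (outer k p) := by
  have hr' := mem_inputs.1 hr
  obtain ⟨x, hx⟩ := id hne
  have hxr := mem_outer.1 hx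
  have hxp := hr'.2.1.1 hxr
  have hss : outer k r ⊂ outer k p := (outer_mono hr'.2.1.1).ssubset_of_ne hrp
  have hre : outer k r ∈ (comp S T).edges :=
    outer_mem_edges_comp hr'.1 hne (hss.trans_subset (Finset.subset_univ _))
  refine mem_inputs.2 ⟨hre, hss, ?_⟩
  intro t ht hrt htp
  have h0 := Finset.card_pos.2 (edges_nonempty hre)
  have h0' := Finset.card_lt_card hrt
  have h := mem_parens_of_mem_edges ht (by omega)
  rcases mem_graft.1 (Finset.mem_filter.1 h).1 with ⟨s, hs, rfl⟩ | ⟨i', q', hq', rfl⟩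
  · have hxs : block k x ∈ s := mem_outer.1 (hrt.1 hx)
    have hsp : s ⊂ p := by
      rcases nodes_nested hs hp with h1 | h1 | h1
      · refine h1.ssubset_of_ne ?_
        rintro rfl
        exact htp.2 (Finset.Subset.refl _)
      · exact absurd (outer_mono h1) htp.2
      · exact absurd hxp (Finset.disjoint_left.1 h1 hxs)
    have hse : s ∈ S.edges := by
      rcases mem_nodes.1 hs with rfl | hs'
      · exact absurd (Finset.subset_univ p) hsp.2
      · exact mem_edges.2 (Or.inl hs')
    have hrs : r ⊂ s := by
      rcases subset_or_subset_of_mem hr'.1 hse hxr hxs with h1 | h1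
      · refine h1.ssubset_of_ne ?_
        rintro rfl
        exact hrt.2 (Finset.Subset.refl _)
      · exact absurd (outer_mono h1) hrt.2
    exact hr'.2.2 s hse hrs hsp
  · obtain ⟨l, -, hl⟩ := mem_inner.1 (hrt.1 hx)
    have hb := congrArg (block k) hl
    rw [block_apply] at hb
    exact hrt.2 (inner_subset_outer (hb ▸ hxr) q')

open Classical in
-- Children that have lost all letters are deleted. The hypothesis `hS` excludes contracted nodes,
-- all of whose remaining leaves lie above a single child.
theorem children_outer (S : PWord m) (T : ∀ i, PWord (k i)) {p : Finset (Fin m)}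
    (hp : p ∈ S.nodes) (h1 : p.card ≠ 1) (hS : ∀ r ∈ S.inputs p, outer k r ≠ outer k p) :
    (comp S T).children (outer k p) =
      ((S.children p).filter fun r => (outer k r).Nonempty).map (outer k) := by
  refine eq_children ?_ ?_
  · exact List.pairwise_map.2 (((S.pairwise_children p).filter _).imp before_outer)
  intro c
  simp only [List.mem_map, List.mem_filter, mem_children, decide_eq_true_eq]
  constructor
  · rintro ⟨r, ⟨hr, hne⟩, rfl⟩
    exact outer_mem_inputs S T hp hr hne (hS r hr)
  · intro hc
    have hc' := mem_inputs.1 hc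
    obtain ⟨x, hx⟩ := edges_nonempty hc'.1
    have hxp := mem_outer.1 (hc'.2.1.1 hx)
    obtain ⟨r, hr, hxr⟩ := exists_inputs S hxp (fun h => h1 (by rw [h, Finset.card_singleton]))
    have hxr' : x ∈ outer k r := mem_outer.2 hxr
    exact ⟨r, ⟨hr, ⟨x, hxr'⟩⟩, inputs_eq (outer_mem_inputs S T hp hr ⟨x, hxr'⟩ (hS r hr)) hc hxr' hx⟩

/-- Incoming edges are disjoint, so at a contracted node every other child has lost all its letters.
-/
theorem outer_eq_empty_of_ne {S : PWord m} {p r r' : Finset (Fin m)} (hr : r ∈ S.inputs p)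
    (h : outer k r = outer k p) (hr' : r' ∈ S.inputs p) (hne : r' ≠ r) : outer k r' = ∅ := by
  refine Finset.eq_empty_of_forall_notMem fun x hx => hne ?_
  have h1 : x ∈ outer k r := h ▸ outer_mono (mem_inputs.1 hr').2.1.1 hx
  exact inputs_eq hr' hr (mem_outer.1 hx) (mem_outer.1 h1)

end PWord
end Associahedral

namespace Associahedral

open PWord

/-- Leaf, internal node, or the root edge of the empty word, the only edge without leaves. -/
theorem PWord.IsEdge.card_cases {m : ℕ} {w : PWord m} {p : Finset (Fin m)} (h : w.IsEdge p) :
    p.card = 1 ∨ 2 ≤ p.card ∨ (p = Finset.univ ∧ m = 0) := by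
  rcases h with h | rfl
  · have := Finset.card_pos.2 (edges_nonempty h)
    omega
  · rw [Finset.card_univ, Fintype.card_fin]
    rcases m with _ | _ | m <;> simp

namespace AnMonoidal

variable {C : Type u} [Category.{v} C] {n : ℕ∞} {Q : AnMonoidal C n} {m : ℕ}

theorem length_flatMap_y {ι : Type*} (l : List ι) {f : ι → Q.Mor} {g : ι → List (Finset (Fin m))}
    (h : ∀ q ∈ l, (f q).y.length = (g q).length) :
    ((l.map f).flatMap (·.y)).length = (l.flatMap g).length := by
  induction l with
  | nil => rfl
  | cons q l ih =>
    simp only [List.map_cons, List.flatMap_cons, List.length_append]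
    rw [ih fun q hq => h q (List.mem_cons_of_mem _ hq), h q List.mem_cons_self]

variable [hn : Fact (((1 : ℕ) : ℕ∞) ≤ n)]

/-! ### Evaluation of trees -/

open Classical in
/-- The morphism from the value at the edge `p` of the tree `w`, with the morphisms `F x` inserted
at the leaves, to the product of the values at the edges of `w'` closest to `p`. -/
noncomputable def eval (w w' : PWord m) (F : Fin m → Q.Mor) (p : Finset (Fin m)) : Q.Mor :=
  if h : p.card = 1 then F (p.min' (Finset.card_pos.1 (by omega)))
  -- An edge that survives in `w'` is a boundary: the product is formed there, which leaves a
  -- one-letter target list.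
  else if w'.IsEdge p then
    Q.arr (join ((w.children p).attach.map fun q => eval w w' F q.1)).arrow
  else join ((w.children p).attach.map fun q => eval w w' F q.1)
termination_by p.card
decreasing_by
  · exact card_lt_of_mem_children q.2
  · exact card_lt_of_mem_children q.2

theorem eval_singleton (w w' : PWord m) (F : Fin m → Q.Mor) (x : Fin m) :
    eval w w' F {x} = F x := by
  rw [eval, dif_pos (Finset.card_singleton x)]
  simp

theorem eval_of_isEdge (w : PWord m) {w' : PWord m} (F : Fin m → Q.Mor) {p : Finset (Fin m)}
    (hp : p.card ≠ 1) (h : w'.IsEdge p) :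
    eval w w' F p = Q.arr (join ((w.children p).map (eval w w' F))).arrow := by
  rw [eval, dif_neg hp, if_pos h, List.attach_map_val]

theorem eval_of_not_isEdge (w : PWord m) {w' : PWord m} (F : Fin m → Q.Mor) {p : Finset (Fin m)}
    (hp : p.card ≠ 1) (h : ¬ w'.IsEdge p) :
    eval w w' F p = join ((w.children p).map (eval w w' F)) := by
  rw [eval, dif_neg hp, if_neg h, List.attach_map_val]

theorem top_of_isEdge {w : PWord m} {p : Finset (Fin m)} (h : w.IsEdge p) : w.top p = [p] :=
  if_pos h

theorem top_of_not_isEdge {w : PWord m} {p : Finset (Fin m)} (h : ¬ w.IsEdge p) :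
    w.top p = w.children p := if_neg h

/-- Needed to see that at every node with at least two leaves `join` is applied to lists of
admissible length, so that its default value plays no role there. -/
theorem length_eval {w w' : PWord m} (hw : w ≤ w') (hf : w'.InFiltration n) {F : Fin m → Q.Mor}
    (hF : ∀ x, (F x).y.length = 1) {p : Finset (Fin m)} (hp : w.IsEdge p) :
    (eval w w' F p).y.length = (w'.top p).length := by
  induction hc : p.card using Nat.strong_induction_on generalizing p with
  | _ N ih =>
    subst hc
    rcases hp.card_cases with h | h | ⟨rfl, h⟩
    · obtain ⟨x, rfl⟩ := Finset.card_eq_one.1 h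
      rw [eval_singleton, hF, top_of_isEdge (w'.isEdge_singleton x), List.length_singleton]
    · by_cases h' : w'.IsEdge p
      · rw [eval_of_isEdge w F (by omega) h', top_of_isEdge h']
        rfl
      · have e := length_flatMap_y (w.children p) (f := eval w w' F) (g := w'.top) fun q hq =>
          ih _ (card_lt_of_mem_children hq) (IsEdge.of_mem_children hq) rfl
        rw [← children_eq_flatMap hw] at e
        rw [eval_of_not_isEdge w F (by omega) h', top_of_not_isEdge h', ← e, join_of_le]
        · simpa using w.children_ne_nil h
        · rw [e]
          exact length_children_le hw hf (hp.mem_nodes h)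
    · rw [eval_of_isEdge w F (by simp [h]) w'.isEdge_univ, top_of_isEdge w'.isEdge_univ]
      rfl

theorem length_eval_children_le {w w' : PWord m} (hw : w ≤ w') (hf : w'.InFiltration n)
    {F : Fin m → Q.Mor} (hF : ∀ x, (F x).y.length = 1) {p : Finset (Fin m)} (hp : w.IsEdge p)
    (h : 2 ≤ p.card) :
    ((((w.children p).map (eval w w' F)).flatMap (·.y)).length : ℕ∞) ≤ n := by
  rw [length_flatMap_y (w.children p) (f := eval w w' F) (g := w'.top) fun q hq =>
    length_eval hw hf hF (IsEdge.of_mem_children hq), ← children_eq_flatMap hw]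
  exact length_children_le hw hf (hp.mem_nodes h)

theorem arr_arrow_of_length {a : Q.Mor} (h : a.y.length = 1) : Q.arr a.arrow = a := by
  obtain ⟨d, hd⟩ := List.length_eq_one_iff.1 h
  exact arr_arrow_of_unary hd

/-- Functoriality in the words and in the morphisms at the leaves. The composites at the incoming
edges of `p` assemble by `isComp_join`, and `children_eq_flatMap` identifies the middle list. It
remains to see whether `p` survives in `w'` and `w''`; survival in `w''` implies survival in `w'`,
which leaves three cases. -/
theorem isComp_eval {w w' w'' : PWord m} (hw : w ≤ w') (hw' : w' ≤ w'')
    (hf' : w'.InFiltration n) (hf'' : w''.InFiltration n) {F G H : Fin m → Q.Mor}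
    (hF : ∀ x, (F x).y.length = 1) (hH : ∀ x, (H x).y.length = 1)
    (hFGH : ∀ x, (F x).IsComp [G x] (H x)) {p : Finset (Fin m)} (hp : w.IsEdge p) :
    (eval w w' F p).IsComp ((w'.top p).map (eval w' w'' G)) (eval w w'' H p) := by
  induction hc : p.card using Nat.strong_induction_on generalizing p with
  | _ N ih =>
    subst hc
    rcases hp.card_cases with h | h | ⟨rfl, h⟩
    · obtain ⟨x, rfl⟩ := Finset.card_eq_one.1 h
      rw [top_of_isEdge (w'.isEdge_singleton x), List.map_singleton, eval_singleton,
        eval_singleton, eval_singleton]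
      exact hFGH x
    · have key := isComp_join (A := eval w w' F) (D := eval w w'' H)
        (B := fun q => (w'.top q).map (eval w' w'' G)) (qs := w.children p)
        (fun q hq => ih _ (card_lt_of_mem_children hq) (IsEdge.of_mem_children hq) rfl)
        (w.children_ne_nil h) (length_eval_children_le hw hf' hF hp h)
        (length_eval_children_le (hw.trans hw') hf'' hH hp h)
      rw [← List.map_flatMap, ← children_eq_flatMap hw] at key
      by_cases h' : w'.IsEdge p
      · rw [eval_of_isEdge w F (by omega) h', top_of_isEdge h', List.map_singleton]
        by_cases h'' : w''.IsEdge p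
        · rw [eval_of_isEdge w' G (by omega) h'', eval_of_isEdge w H (by omega) h'']
          exact isComp_arr_arr_join key
        · rw [eval_of_not_isEdge w' G (by omega) h'', eval_of_not_isEdge w H (by omega) h'']
          exact isComp_arr_join key
      · have h'' : ¬ w''.IsEdge p := fun h'' => h' (h''.mono hw')
        rw [eval_of_not_isEdge w F (by omega) h', eval_of_not_isEdge w H (by omega) h'',
          top_of_not_isEdge h']
        exact key
    · have h0 : (Finset.univ : Finset (Fin m)).card = 0 := by simp [h]
      rw [eval_of_isEdge w F (by omega) w'.isEdge_univ, eval_of_isEdge w H (by omega) w''.isEdge_univ,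
        top_of_isEdge w'.isEdge_univ, List.map_singleton,
        eval_of_isEdge w' G (by omega) w''.isEdge_univ, children_eq_nil w (by omega),
        children_eq_nil w' (by omega)]
      simp only [List.map_nil, join_nil, arr_arrow]
      simpa using isComp_arr (Q := Q) (𝟙 Q.zero) (𝟙 Q.zero)

/-- For `w' = w` every edge survives, so only products of identities are formed. -/
theorem eval_id {w : PWord m} (hf : w.InFiltration n) {F : Fin m → Q.Mor}
    (hF : ∀ x, ∃ c, F x = Q.arr (Arrow.mk (𝟙 c))) {p : Finset (Fin m)} (hp : w.IsEdge p) :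
    ∃ c, eval w w F p = Q.arr (Arrow.mk (𝟙 c)) := by
  induction hc : p.card using Nat.strong_induction_on generalizing p with
  | _ N ih =>
    subst hc
    by_cases h1 : p.card = 1
    · obtain ⟨x, rfl⟩ := Finset.card_eq_one.1 h1
      rw [eval_singleton]
      exact hF x
    · rw [eval_of_isEdge w F h1 hp]
      have hex : ∀ q ∈ w.children p, ∃ c, eval w w F q = Q.arr (Arrow.mk (𝟙 c)) := fun q hq =>
        ih _ (card_lt_of_mem_children hq) (IsEdge.of_mem_children hq) rfl
      have : Nonempty C := ⟨Q.zero⟩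
      choose! o ho using hex
      rcases hp.card_cases with h | h | ⟨rfl, h⟩
      · exact absurd h h1
      · have e : (w.children p).map (eval w w F) =
            (idl ((w.children p).map o)).map Q.arr := by
          rw [idl, List.map_map, List.map_map]
          exact List.map_congr_left ho
        have hl := length_children_le (le_refl w) hf (hp.mem_nodes h)
        rw [e, (join_arr (by simpa [idl] using w.children_ne_nil h) (by simpa [idl] using hl)).1,
          idl, Q.muA_id]
        exact ⟨_, rfl⟩
      · rw [children_eq_nil w (by simp [h]), List.map_nil, join_nil, arr_arrow]
        exact ⟨_, rfl⟩

end AnMonoidal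
end Associahedral

/-! ### Edges of a grafted tree. -/

namespace Associahedral

open PWord

namespace PWord

variable {m : ℕ} {k : Fin m → ℕ}

theorem outer_mem_graft {S : PWord m} {p : Finset (Fin m)} (T : ∀ i, PWord (k i))
    (hp : S.IsEdge p) : outer k p ∈ graft S T := by
  rw [mem_graft]
  rcases hp with hp | rfl
  · rcases mem_edges.1 hp with h | ⟨x, rfl⟩
    · exact Or.inl ⟨p, Finset.mem_insert_of_mem h, rfl⟩
    · exact Or.inr ⟨x, Finset.univ, Finset.mem_insert_self _ _, inner_univ x⟩
  · exact Or.inl ⟨_, Finset.mem_insert_self _ _, rfl⟩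

theorem isEdge_of_mem_graft {S : PWord m} {T : ∀ i, PWord (k i)} {s : Finset (Fin (∑ i, k i))}
    (hs : s ∈ graft S T) (hne : s.Nonempty) : (comp S T).IsEdge s := by
  by_cases h : s = Finset.univ
  · exact Or.inr h
  · exact Or.inl (mem_edges_comp hs hne ((Finset.subset_univ s).ssubset_of_ne h))

theorem IsEdge.outer {S : PWord m} {p : Finset (Fin m)} (hp : S.IsEdge p) (T : ∀ i, PWord (k i))
    (hne : (PWord.outer k p).Nonempty) : (comp S T).IsEdge (PWord.outer k p) :=
  isEdge_of_mem_graft (outer_mem_graft T hp) hne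

theorem mem_graft_of_isEdge {S : PWord m} {T : ∀ i, PWord (k i)} {s : Finset (Fin (∑ i, k i))}
    (hs : (comp S T).IsEdge s) (hc : 2 ≤ s.card) : s ∈ graft S T := by
  rcases mem_nodes.1 (hs.mem_nodes hc) with rfl | h
  · exact mem_graft.2 (Or.inl ⟨Finset.univ, Finset.mem_insert_self _ _, outer_univ⟩)
  · exact (Finset.mem_filter.1 h).1

theorem inner_injective (i : Fin m) : Function.Injective (inner k i) := Finset.map_injective _

theorem eq_univ_of_inner_eq_outer {i : Fin m} {q : Finset (Fin (k i))} {p : Finset (Fin m)}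
    (hq : q.Nonempty) (h : inner k i q = outer k p) : q = Finset.univ := by
  obtain ⟨j, hj⟩ := hq
  have hi : i ∈ p := by
    have := h ▸ apply_mem_inner.2 hj
    rwa [mem_outer, block_apply] at this
  refine Finset.eq_univ_of_forall fun j' => ?_
  rw [← apply_mem_inner (k := k), h, mem_outer, block_apply]
  exact hi

theorem isEdge_inner_iff {S : PWord m} {T : ∀ i, PWord (k i)} {i : Fin m} {q : Finset (Fin (k i))}
    (hq : 2 ≤ q.card) : (comp S T).IsEdge (inner k i q) ↔ (T i).IsEdge q := by
  have hne : q.Nonempty := Finset.card_pos.1 (by omega)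
  constructor
  · intro h
    rcases mem_graft.1 (mem_graft_of_isEdge h (by rwa [card_inner])) with
      ⟨p, -, hpq⟩ | ⟨i', q', hq', hqq'⟩
    · exact Or.inr (eq_univ_of_inner_eq_outer hne hpq.symm)
    · obtain ⟨j, hj⟩ := hne
      have hx : finSigmaFinEquiv ⟨i, j⟩ ∈ inner k i' q' := hqq' ▸ apply_mem_inner.2 hj
      obtain ⟨l, -, hl⟩ := mem_inner.1 hx
      have hii := congrArg (block k) hl
      rw [block_apply, block_apply] at hii
      subst hii
      obtain rfl := inner_injective _ hqq'
      exact isEdge_of_mem_nodes hq'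
  · intro h
    exact isEdge_of_mem_graft (mem_graft.2 (Or.inr ⟨i, q, h.mem_nodes hq, rfl⟩))
      (Finset.card_pos.1 (by rw [card_inner]; omega))

/-- An edge of a composite which is the union of blocks comes from an edge of the outer tree. -/
theorem exists_isEdge_of_isEdge_outer {S : PWord m} {T : ∀ i, PWord (k i)} {p : Finset (Fin m)}
    (h : (comp S T).IsEdge (outer k p)) (hne : (outer k p).Nonempty) :
    ∃ p', S.IsEdge p' ∧ outer k p' = outer k p := by
  rcases h with h | h
  · rcases mem_edges.1 h with h | ⟨x, hx⟩
    · rcases mem_graft.1 (Finset.mem_filter.1 h).1 with ⟨p', hp', h'⟩ | ⟨i, q, hq, h'⟩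
      · exact ⟨p', isEdge_of_mem_nodes hp', h'⟩
      · refine ⟨{i}, S.isEdge_singleton i, ?_⟩
        obtain rfl := eq_univ_of_inner_eq_outer (q := q) (by
          rw [← h'] at hne
          exact Finset.map_nonempty.1 hne) h'
        rw [← inner_univ, h']
    · refine ⟨{block k x}, S.isEdge_singleton _, ?_⟩
      have hxp : x ∈ outer k p := hx ▸ Finset.mem_singleton_self x
      refine (outer_mono (Finset.singleton_subset_iff.2 (mem_outer.1 hxp))).antisymm ?_
      rw [← hx]
      exact Finset.singleton_subset_iff.2 (mem_outer.2 (Finset.mem_singleton_self _))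
  · exact ⟨Finset.univ, S.isEdge_univ, by rw [outer_univ, h]⟩

theorem isEdge_nested {w : PWord m} {p q : Finset (Fin m)} (hp : w.IsEdge p) (hq : w.IsEdge q)
    {x : Fin m} (hxp : x ∈ p) (hxq : x ∈ q) : p ⊆ q ∨ q ⊆ p := by
  rcases hp with hp | rfl
  · rcases hq with hq | rfl
    · exact subset_or_subset_of_mem hp hq hxp hxq
    · exact Or.inl (Finset.subset_univ _)
  · exact Or.inr (Finset.subset_univ _)

/-- An edge strictly above `p` lies above one of the incoming edges of `p`. -/
theorem exists_children_superset {w : PWord m} {p q : Finset (Fin m)} (hq : w.IsEdge q)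
    (hqp : q ⊂ p) (hne : q.Nonempty) : ∃ r ∈ w.children p, q ⊆ r := by
  obtain ⟨x, hx⟩ := hne
  obtain ⟨r, hr, hxr⟩ := exists_inputs w (hqp.1 hx) (by
    rintro rfl
    refine hqp.2 ?_
    simpa using hx)
  refine ⟨r, mem_children.2 hr, ?_⟩
  have hr' := mem_inputs.1 hr
  rcases isEdge_nested hq (Or.inl hr'.1) hx hxr with h | h
  · exact h
  · by_contra hcon
    rcases hq with hq | rfl
    · exact hr'.2.2 q hq ⟨h, hcon⟩ hqp
    · exact hqp.2 (Finset.subset_univ _)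

theorem Nonempty.of_outer {p : Finset (Fin m)} (h : (outer k p).Nonempty) : p.Nonempty := by
  obtain ⟨x, hx⟩ := h
  exact ⟨_, mem_outer.1 hx⟩

end PWord

namespace AnMonoidal

variable {C : Type u} [Category.{v} C] {n : ℕ∞} {Q : AnMonoidal C n} {m : ℕ} {k : Fin m → ℕ}

theorem Mor.Eqv.symm {a b : Q.Mor} (h : a.Eqv b) : b.Eqv a := ⟨h.1.symm, h.2.symm⟩

theorem Mor.Eqv.trans {a b c : Q.Mor} (h : a.Eqv b) (h' : b.Eqv c) : a.Eqv c :=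
  ⟨h.1.trans h'.1, h.2.trans h'.2⟩

theorem Mor.reduces_map {ι : Type*} (P : ι → Prop) [DecidablePred P] {f g : ι → Q.Mor}
    (l : List ι) (h : ∀ q ∈ l, P q → (f q).Eqv (g q)) (h' : ∀ q ∈ l, ¬ P q → (f q).IsZero) :
    Reduces (l.map f) ((l.filter fun q => P q).map g) := by
  induction l with
  | nil => exact .nil
  | cons q l ih =>
    have ih' := ih (fun q hq => h q (List.mem_cons_of_mem _ hq))
      (fun q hq => h' q (List.mem_cons_of_mem _ hq))
    by_cases hq : P q
    · rw [List.filter_cons_of_pos (by simpa using hq)]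
      exact .cons (h q List.mem_cons_self hq) ih'
    · rw [List.filter_cons_of_neg (by simpa using hq)]
      exact .zero (h' q List.mem_cons_self hq) ih'

variable [hn : Fact (((1 : ℕ) : ℕ∞) ≤ n)]

theorem arrow_eval (w w' : PWord m) (F : Fin m → Q.Mor) {p : Finset (Fin m)} (hp : p.card ≠ 1) :
    (eval w w' F p).arrow = (join ((w.children p).map (eval w w' F))).arrow := by
  by_cases h : w'.IsEdge p
  · rw [eval_of_isEdge w F hp h, arr_arrow]
  · rw [eval_of_not_isEdge w F hp h]

theorem arr_arrow_eval {w w' : PWord m} {F : Fin m → Q.Mor} (hF : ∀ x, (F x).y.length = 1)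
    {p : Finset (Fin m)} (hp : w'.IsEdge p) :
    Q.arr (eval w w' F p).arrow = eval w w' F p := by
  by_cases h : p.card = 1
  · obtain ⟨x, rfl⟩ := Finset.card_eq_one.1 h
    rw [eval_singleton, arr_arrow_of_length (hF x)]
  · rw [eval_of_isEdge w F h hp, arr_arrow]

theorem length_eval_of_isEdge {w w' : PWord m} {F : Fin m → Q.Mor} (hF : ∀ x, (F x).y.length = 1)
    {p : Finset (Fin m)} (hp : w'.IsEdge p) : (eval w w' F p).y.length = 1 := by
  rw [← arr_arrow_eval hF hp]
  rfl

/-! ### Evaluation of composites -/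

/-- Inside block `i` the grafted trees have the same incoming edges and the same surviving edges as
`T i` and `T' i`. -/
theorem eval_inner (S S' : PWord m) (T T' : ∀ i, PWord (k i)) (g : Fin (∑ i, k i) → Q.Mor)
    (i : Fin m) {q : Finset (Fin (k i))} (hq : q.Nonempty) :
    eval (comp S T) (comp S' T') g (inner k i q) =
      eval (T i) (T' i) (fun j => g (finSigmaFinEquiv ⟨i, j⟩)) q := by
  induction hc : q.card using Nat.strong_induction_on generalizing q with
  | _ N ih =>
    subst hc
    have h0 := Finset.card_pos.2 hq
    by_cases h1 : q.card = 1
    · obtain ⟨j, rfl⟩ := Finset.card_eq_one.1 h1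
      rw [eval_singleton]
      exact (congrArg _ (Finset.map_singleton _ _)).trans (eval_singleton _ _ _ _)
    · have e : ((comp S T).children (inner k i q)).map (eval (comp S T) (comp S' T') g) =
          ((T i).children q).map (eval (T i) (T' i) fun j => g (finSigmaFinEquiv ⟨i, j⟩)) := by
        rw [children_inner, List.map_map]
        exact List.map_congr_left fun r hr =>
          ih _ (card_lt_of_mem_children hr) (nonempty_of_mem_children hr) rfl
      have hiff := isEdge_inner_iff (S := S') (T := T') (i := i) (q := q) (by omega)
      by_cases h : (T' i).IsEdge q
      · rw [eval_of_isEdge _ _ h1 h, eval_of_isEdge _ _ (by rwa [card_inner]) (hiff.2 h), e]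
      · rw [eval_of_not_isEdge _ _ h1 h,
          eval_of_not_isEdge _ _ (by rwa [card_inner]) (mt hiff.1 h), e]

/-- The values at the roots of the `T_i`. -/
noncomputable def leafEval (T T' : ∀ i, PWord (k i)) (g : Fin (∑ i, k i) → Q.Mor) (i : Fin m) :
    Q.Mor :=
  eval (T i) (T' i) (fun j => g (finSigmaFinEquiv ⟨i, j⟩)) Finset.univ

section

variable {S S' : PWord m} {T T' : ∀ i, PWord (k i)} {g : Fin (∑ i, k i) → Q.Mor}

theorem length_leafEval (hg : ∀ x, (g x).y.length = 1) (i : Fin m) :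
    (leafEval T T' g i).y.length = 1 :=
  length_eval_of_isEdge (fun _ => hg _) (isEdge_univ _)

/-- A leaf with an empty word grafted onto it evaluates to the identity of the unit object. At a
node all of whose leaves are of this kind, so are all incoming edges, and `join_isZero` applies. -/
theorem isZero_eval (hS : S ≤ S') (hf : S'.InFiltration n) (hg : ∀ x, (g x).y.length = 1)
    {p : Finset (Fin m)} (hp : S.IsEdge p) (h : outer k p = ∅) :
    (eval S S' (leafEval T T' g) p).IsZero := by
  induction hc : p.card using Nat.strong_induction_on generalizing p with
  | _ N ih =>
    subst hc
    have key : p.card ≠ 1 → (join ((S.children p).map (eval S S' (leafEval T T' g)))).IsZero := by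
      intro h1
      rcases hp.card_cases with h2 | h2 | ⟨-, rfl⟩
      · exact absurd h2 h1
      · refine join_isZero ?_ (length_eval_children_le hS hf (length_leafEval hg) hp h2)
        have := Mor.reduces_map (fun _ => False) (g := eval S S' (leafEval T T' g)) (S.children p)
          (fun _ _ h => h.elim) fun q hq _ => ih _ (card_lt_of_mem_children hq)
            (IsEdge.of_mem_children hq) (Finset.subset_empty.1 (h ▸ outer_mono
              (mem_inputs.1 (mem_children.1 hq)).2.1.1)) rfl
        simpa using this
      · rw [children_eq_nil S (by rw [Finset.eq_empty_of_isEmpty p]; simp), List.map_nil, join_nil]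
        exact isZero_arr_zero
    by_cases h1 : p.card = 1
    · obtain ⟨i, rfl⟩ := Finset.card_eq_one.1 h1
      rw [← inner_univ] at h
      have h0 : (Finset.univ : Finset (Fin (k i))).card = 0 := by
        rw [← card_inner, h, Finset.card_empty]
      rw [eval_singleton, leafEval, eval_of_isEdge _ _ (by omega) (isEdge_univ _),
        children_eq_nil _ (by omega), List.map_nil, join_nil, arr_arrow]
      exact isZero_arr_zero
    · by_cases h' : S'.IsEdge p
      · rw [eval_of_isEdge _ _ h1 h', (key h1).1]
        exact isZero_arr_zero
      · rw [eval_of_not_isEdge _ _ h1 h']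
        exact key h1

/-- The value at a node all of whose incoming edges but one are deleted. -/
theorem join_eqv_of_outer_eq (hS : S ≤ S') (hf : S'.InFiltration n)
    (hg : ∀ x, (g x).y.length = 1) {p r : Finset (Fin m)} (hp : S.IsEdge p)
    (hr : r ∈ S.children p) (h : outer k r = outer k p) :
    (join ((S.children p).map (eval S S' (leafEval T T' g)))).Eqv
      (eval S S' (leafEval T T' g) r) := by
  classical
  have h2 : 2 ≤ p.card := by
    have h1 := card_lt_of_mem_children hr
    have h2 := Finset.card_pos.2 (nonempty_of_mem_children hr)
    omega
  have key := Mor.reduces_map (fun q => q = r) (f := eval S S' (leafEval T T' g))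
    (g := eval S S' (leafEval T T' g)) (S.children p) (fun _ _ _ => Mor.Eqv.refl _)
    fun q hq hne => isZero_eval hS hf hg (IsEdge.of_mem_children hq)
      (outer_eq_empty_of_ne (mem_children.1 hr) h (mem_children.1 hq) hne)
  have hfil : (S.children p).filter (fun q => decide (q = r)) = [r] := by
    refine eq_of_pairwise_before ((S.pairwise_children p).filter _) (List.pairwise_singleton _ _)
      (fun q hq => nonempty_of_mem_children (List.mem_of_mem_filter hq)) fun q => ?_
    simp only [List.mem_filter, decide_eq_true_eq, List.mem_singleton]
    exact ⟨fun h => h.2, fun h => ⟨h ▸ hr, h⟩⟩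
  rw [hfil, List.map_singleton] at key
  have := join_reduces key (by simp) (length_eval_children_le hS hf (length_leafEval hg) hp h2)
    (by simpa using (eval S S' (leafEval T T' g) r).le)
  rwa [join_singleton] at this

/-- `join_eqv_of_outer_eq` iterated along the chain of contracted nodes from `p` up to `r`. As `r`
survives in `S'`, its value is unary, so forming products on the way has no effect. -/
theorem eval_eqv_of_outer_eq (hS : S ≤ S') (hf : S'.InFiltration n)
    (hg : ∀ x, (g x).y.length = 1) {p r : Finset (Fin m)} (hp : S.IsEdge p) (hr : S'.IsEdge r)
    (hrp : r ⊆ p) (hne : (outer k r).Nonempty) (h : outer k r = outer k p) :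
    (eval S S' (leafEval T T' g) p).Eqv (eval S S' (leafEval T T' g) r) := by
  induction hc : p.card using Nat.strong_induction_on generalizing p with
  | _ N ih =>
    subst hc
    by_cases hrp' : r = p
    · subst hrp'
      exact Mor.Eqv.refl _
    obtain ⟨q, hq, hrq⟩ := exists_children_superset (hr.mono hS) (hrp.ssubset_of_ne hrp')
      (Nonempty.of_outer hne)
    have hqp := (mem_inputs.1 (mem_children.1 hq)).2.1
    have e1 : outer k q = outer k p :=
      (outer_mono hqp.1).antisymm (h ▸ outer_mono hrq)
    have h1 := ih _ (card_lt_of_mem_children hq) (IsEdge.of_mem_children hq) hrq (h.trans e1.symm) rfl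
    have h2 := (join_eqv_of_outer_eq hS hf hg hp hq e1 (T := T) (T' := T')).trans h1
    have hp1 : p.card ≠ 1 := by
      have h1 := card_lt_of_mem_children hq
      have h2 := Finset.card_pos.2 (nonempty_of_mem_children hq)
      omega
    by_cases h' : S'.IsEdge p
    · rw [eval_of_isEdge _ _ hp1 h', h2.1, arr_arrow_eval (length_leafEval hg) hr]
      exact Mor.Eqv.refl _
    · rw [eval_of_not_isEdge _ _ hp1 h']
      exact h2

open Classical in
-- The set `outer k p` can be an edge of `comp S' T'` although `p` is not one of `S'`, namely if
-- another edge of `S'` has the same remaining leaves; hence the case distinction. Equality fails in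
-- general, since the target list computed in `S` can contain unit objects at deleted edges.
theorem eval_outer (hS : S ≤ S') (hT : ∀ i, T i ≤ T' i) (hfS : S'.InFiltration n)
    (hfT : ∀ i, (T' i).InFiltration n) (hg : ∀ x, (g x).y.length = 1) {p : Finset (Fin m)}
    (hp : S.IsEdge p) (hne : (outer k p).Nonempty) :
    (eval (comp S T) (comp S' T') g (outer k p)).Eqv
      (if (comp S' T').IsEdge (outer k p) then Q.arr (eval S S' (leafEval T T' g) p).arrow
        else eval S S' (leafEval T T' g) p) := by
  induction hc : p.card using Nat.strong_induction_on generalizing p with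
  | _ N ih =>
    subst hc
    have hle : comp S T ≤ comp S' T' := comp_mono hS hT
    have hf : (comp S' T').InFiltration n := hfS.comp hfT
    have hG := length_leafEval (T := T) (T' := T') hg
    by_cases hp1 : p.card = 1
    · obtain ⟨i, rfl⟩ := Finset.card_eq_one.1 hp1
      rw [← inner_univ] at hne ⊢
      rw [eval_inner _ _ _ _ _ _ (Finset.map_nonempty.1 hne), eval_singleton,
        arr_arrow_of_length (hG i), ite_self]
      exact Mor.Eqv.refl _
    have hpc : 2 ≤ p.card := by
      have := Finset.card_pos.2 (Nonempty.of_outer hne)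
      omega
    have hnot : ¬ (comp S' T').IsEdge (outer k p) → ¬ S'.IsEdge p := fun h h' => h (h'.outer T' hne)
    -- If one child carries all remaining leaves, the node is contracted and takes over the value of
    -- that child.
    by_cases hex : ∃ r ∈ S.children p, outer k r = outer k p
    · obtain ⟨r, hr, hrp⟩ := hex
      have h1 := ih _ (card_lt_of_mem_children hr) (IsEdge.of_mem_children hr) (hrp ▸ hne) rfl
      have h2 := join_eqv_of_outer_eq hS hfS hg hp hr hrp (T := T) (T' := T')
      rw [hrp] at h1
      refine h1.trans ?_
      split_ifs with h
      · rw [arrow_eval S S' _ hp1, h2.1]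
        exact Mor.Eqv.refl _
      · rw [eval_of_not_isEdge _ _ hp1 (hnot h)]
        exact h2.symm
    · push Not at hex
      -- If a single leaf remained, the child through it would carry all remaining leaves, contrary
      -- to `hex`.
      have hoc : 2 ≤ (outer k p).card := by
        by_contra hcon
        have h0 := Finset.card_pos.2 hne
        obtain ⟨x, hx⟩ := Finset.card_eq_one.1 (by omega : (outer k p).card = 1)
        have hxp : block k x ∈ p := mem_outer.1 (hx ▸ Finset.mem_singleton_self x)
        obtain ⟨r, hr, hxr⟩ := exists_inputs S hxp (by rintro h; rw [h] at hp1; simp at hp1)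
        refine hex r (mem_children.2 hr) ((outer_mono (mem_inputs.1 hr).2.1.1).antisymm ?_)
        rw [hx]
        exact Finset.singleton_subset_iff.2 (mem_outer.2 hxr)
      have hch := children_outer S T (hp.mem_nodes hpc) hp1 fun r hr => hex r (mem_children.2 hr)
      have hed : (comp S T).IsEdge (outer k p) := hp.outer T hne
      have hred := Mor.reduces_map (fun r => (outer k r).Nonempty)
        (f := eval S S' (leafEval T T' g)) (g := fun r => eval (comp S T) (comp S' T') g (outer k r))
        (S.children p) (fun r hr hner => by
          refine Mor.Eqv.symm ?_
          refine (ih _ (card_lt_of_mem_children hr) (IsEdge.of_mem_children hr) hner rfl).trans ?_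
          split_ifs with hc
          · obtain ⟨r', hr', hrr'⟩ := exists_isEdge_of_isEdge_outer hc hner
            -- Otherwise `r'` strictly contains `r`, hence contains `p` by maximality of `r`; then
            -- `r` carries all remaining leaves of `p`, contrary to `hex`.
            have hsub : r' ⊆ r := by
              obtain ⟨x, hx⟩ := id hner
              have hxr := mem_outer.1 hx
              have hxr' := mem_outer.1 (hrr'.symm ▸ hx)
              rcases isEdge_nested (hr'.mono hS) (IsEdge.of_mem_children hr) hxr' hxr with h | h
              · exact h
              · by_contra hcon
                have hrm := mem_inputs.1 (mem_children.1 hr)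
                have hpr' : p ⊆ r' := by
                  rcases isEdge_nested (hr'.mono hS) hp hxr' (hrm.2.1.1 hxr) with h' | h'
                  · by_contra hcon'
                    rcases hr'.mono hS with h'' | rfl
                    · exact hrm.2.2 r' h'' ⟨h, hcon⟩ ⟨h', hcon'⟩
                    · exact hcon' (Finset.subset_univ _)
                  · exact h'
                exact hex r hr ((outer_mono hrm.2.1.1).antisymm (hrr' ▸ outer_mono hpr'))
            have h3 := eval_eqv_of_outer_eq hS hfS hg (IsEdge.of_mem_children hr) hr' hsub
              (hrr' ▸ hner) hrr' (T := T) (T' := T')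
            rw [h3.1, arr_arrow_eval hG hr']
            exact h3.symm
          · exact Mor.Eqv.refl _)
        (fun r hr hner => isZero_eval hS hfS hg (IsEdge.of_mem_children hr)
          (Finset.not_nonempty_iff_eq_empty.1 hner))
      have e : ((S.children p).filter fun r => decide (outer k r).Nonempty).map
            (fun r => eval (comp S T) (comp S' T') g (outer k r)) =
          ((comp S T).children (outer k p)).map (eval (comp S T) (comp S' T') g) := by
        rw [hch, List.map_map]
        rfl
      rw [e] at hred
      have h2 := join_reduces hred (by simpa using (comp S T).children_ne_nil hoc)
        (length_eval_children_le hS hfS hG hp hpc) (length_eval_children_le hle hf hg hed hoc)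
      split_ifs with h
      · rw [eval_of_isEdge _ _ (by omega) h, arrow_eval S S' _ hp1, h2.1]
        exact Mor.Eqv.refl _
      · rw [eval_of_not_isEdge _ _ (by omega) h, eval_of_not_isEdge _ _ hp1 (hnot h)]
        exact h2.symm

/-- At the root only the arrow matters, and equivalent morphisms have equal arrows. If no letter
remains, both evaluations give the identity of the unit object. -/
theorem arrow_eval_comp (hS : S ≤ S') (hT : ∀ i, T i ≤ T' i) (hfS : S'.InFiltration n)
    (hfT : ∀ i, (T' i).InFiltration n) (hg : ∀ x, (g x).y.length = 1) :
    (eval (comp S T) (comp S' T') g Finset.univ).arrow =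
      (eval S S' (leafEval T T' g) Finset.univ).arrow := by
  by_cases h : (outer k (Finset.univ : Finset (Fin m))).Nonempty
  · have := (eval_outer hS hT hfS hfT hg S.isEdge_univ h).1
    rw [outer_univ] at this
    rw [this]
    split_ifs <;> simp
  · have h0 := Finset.not_nonempty_iff_eq_empty.1 h
    rw [(isZero_eval hS hfS hg S.isEdge_univ h0).1]
    rw [outer_univ] at h0
    rw [arrow_eval _ _ _ (by simp [h0]), children_eq_nil _ (by simp [h0]), List.map_nil, join_nil,
      arr_arrow]

end

end AnMonoidal
end Associahedral

namespace Associahedral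

open PWord

namespace AnMonoidal

variable {C : Type u} [Category.{v} C] {n : ℕ∞} (Q : AnMonoidal C n)
  [hn : Fact (((1 : ℕ) : ℕ∞) ≤ n)] {m : ℕ}

/-! ### The algebra of an `A_n`-monoidal category -/

/-- The value at the root of a morphism of trees with morphisms of `C` at the leaves. -/
noncomputable def value {X Y : Assoc n m × (Fin m → C)} (f : X ⟶ Y) : Q.Mor :=
  eval X.1.1 Y.1.1 (fun x => Q.arr (Arrow.mk (f.2 x))) Finset.univ

theorem length_value {X Y : Assoc n m × (Fin m → C)} (f : X ⟶ Y) : (Q.value f).y.length = 1 :=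
  length_eval_of_isEdge (fun _ => rfl) (isEdge_univ _)

theorem isComp_value {X Y Z : Assoc n m × (Fin m → C)} (f : X ⟶ Y) (g : Y ⟶ Z) :
    (Q.value f).IsComp [Q.value g] (Q.value (f ≫ g)) := by
  have := isComp_eval (Q := Q) (leOfHom f.1) (leOfHom g.1) Y.1.2 Z.1.2
    (F := fun x => Q.arr (Arrow.mk (f.2 x))) (G := fun x => Q.arr (Arrow.mk (g.2 x)))
    (H := fun x => Q.arr (Arrow.mk ((f ≫ g).2 x))) (fun _ => rfl) (fun _ => rfl)
    (fun x => isComp_arr _ _) (isEdge_univ X.1.1)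
  rwa [top_of_isEdge (isEdge_univ _), List.map_singleton] at this

theorem arrow_value_id (X : Assoc n m × (Fin m → C)) :
    (Q.value (𝟙 X)).arrow = Arrow.mk (𝟙 (Q.value (𝟙 X)).c) := by
  obtain ⟨c, hc⟩ := eval_id (Q := Q) X.1.2 (F := fun x => Q.arr (Arrow.mk ((𝟙 X : X ⟶ X).2 x)))
    (fun x => ⟨X.2 x, rfl⟩) (isEdge_univ X.1.1)
  rw [value, hc, arr_arrow]
  rfl

/-- Composing with an identity in front shows that the source does not depend on the morphism, so it
can serve as the object part of the action. -/
theorem value_c {X Y : Assoc n m × (Fin m → C)} (f : X ⟶ Y) :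
    (Q.value f).c = (Q.value (𝟙 X)).c := by
  obtain ⟨_, _, h⟩ := Q.isComp_value (𝟙 X) f
  rw [Category.id_comp] at h
  rw [h]
  rfl

theorem mu_value_y {X Y : Assoc n m × (Fin m → C)} (f : X ⟶ Y) :
    Q.mu (Q.value f).y = (Q.value (𝟙 Y)).c := by
  obtain ⟨h, -, -⟩ := Q.isComp_value f (𝟙 Y)
  rw [← h, List.map_singleton]
  exact Q.mu_singleton hn.out _

/-- The action of the word `X.1` on the tuple `X.2`. -/
noncomputable def act (m : ℕ) : Assoc n m × (Fin m → C) ⥤ C where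
  obj X := (Q.value (𝟙 X)).c
  map f := eqToHom (Q.value_c f).symm ≫ (Q.value f).φ ≫ eqToHom (Q.mu_value_y f)
  map_id X := by
    apply Arrow.mk_injective
    rw [Arrow.arrow_mk_eqToHom_comp, Arrow.arrow_mk_comp_eqToHom]
    exact Q.arrow_value_id X
  map_comp {X Y Z} f g := by
    apply Arrow.mk_injective
    rw [Arrow.arrow_mk_eqToHom_comp, Arrow.arrow_mk_comp_eqToHom]
    obtain ⟨h1, -, h3⟩ := join_of_isComp (Q.isComp_value f g)
    rw [join_singleton] at h1 h3
    refine (h3 h1.symm).trans ?_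
    refine arrow_comp_congr ?_ ?_
    · rw [Arrow.arrow_mk_eqToHom_comp, Arrow.arrow_mk_comp_eqToHom, Arrow.arrow_mk_comp_eqToHom]
    · rw [Arrow.arrow_mk_eqToHom_comp, Arrow.arrow_mk_comp_eqToHom]

theorem mk_act_map {X Y : Assoc n m × (Fin m → C)} (f : X ⟶ Y) :
    Arrow.mk ((Q.act m).map f) = (Q.value f).arrow := by
  dsimp only [act]
  rw [Arrow.arrow_mk_eqToHom_comp, Arrow.arrow_mk_comp_eqToHom]
  rfl

/-- The algebra structure given by an `A_n`-monoidal structure. -/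
noncomputable def toAlgebra : AssocAlgebra C n where
  θ := Q.act
  unit := by
    refine Arrow.functor_ext fun X Y f => ?_
    change Arrow.mk ((Q.act 1).map _) = Arrow.mk (f 0)
    rw [mk_act_map, value]
    have : (Finset.univ : Finset (Fin 1)) = {0} := rfl
    rw [this, eval_singleton, arr_arrow]
    rfl
  comp m k := by
    refine Arrow.functor_ext fun X Y f => ?_
    change Arrow.mk ((Q.act (∑ i, k i)).map _) = Arrow.mk ((Q.act m).map _)
    rw [mk_act_map, mk_act_map]
    refine (arrow_eval_comp (leOfHom f.1.1) (fun i => leOfHom (f.1.2 i)) Y.1.1.2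
      (fun i => (Y.1.2 i).2) fun _ => rfl).trans ?_
    -- The value at the root of `T i` is unary, hence determined by its arrow, which is the action
    -- of `T i` on its block.
    refine congrArg (fun F => (eval _ _ F Finset.univ).arrow) (funext fun i => ?_)
    exact ((congrArg Q.arr (Q.mk_act_map ((blockFunctor C n k i).map f))).trans
      (arr_arrow_of_length (Q.length_value _))).symm

end AnMonoidal
end Associahedral

namespace Associahedral
namespace PWord

/-! ### Partial composition -/

/-- Transport of a word along an equality of lengths. -/
def cast {a b : ℕ} (e : a = b) (w : PWord a) : PWord b := e ▸ w

theorem mem_cast_parens {a b : ℕ} (e : a = b) {w : PWord a} {s : Finset (Fin a)} :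
    s.map (finCongr e).toEmbedding ∈ (cast e w).parens ↔ s ∈ w.parens := by
  subst e
  simp [cast]

theorem exists_map_eq {a b : ℕ} (e : a = b) (s : Finset (Fin b)) :
    ∃ t : Finset (Fin a), t.map (finCongr e).toEmbedding = s := by
  subst e
  exact ⟨s, by simp⟩

theorem mem_cast_nodes {a b : ℕ} (e : a = b) {w : PWord a} {s : Finset (Fin a)} :
    s.map (finCongr e).toEmbedding ∈ (cast e w).nodes ↔ s ∈ w.nodes := by
  subst e
  simp [cast]

theorem card_inputs_cast {a b : ℕ} (e : a = b) (w : PWord a) (s : Finset (Fin a)) :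
    ((cast e w).inputs (s.map (finCongr e).toEmbedding)).card = (w.inputs s).card := by
  subst e
  simp [cast]

theorem cast_le_cast {a b : ℕ} (e : a = b) {w w' : PWord a} (h : w ≤ w') :
    cast e w ≤ cast e w' := by
  subst e
  exact h

theorem InFiltration.cast {a b : ℕ} {n : ℕ∞} (e : a = b) {w : PWord a} (h : w.InFiltration n) :
    (PWord.cast e w).InFiltration n := by
  subst e
  exact h

variable {i j k m p : ℕ}

/-- The arities for substituting a word of length `j` for the letter `i`. -/
def arity (i j : ℕ) {p : ℕ} (t : Fin p) : ℕ := if (t : ℕ) = i then j else 1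

theorem arity_self {t : Fin p} (h : (t : ℕ) = i) : j = arity i j t := (if_pos h).symm

theorem arity_of_ne {t : Fin p} (h : (t : ℕ) ≠ i) : 1 = arity i j t := (if_neg h).symm

theorem sum_range_arity (i j t : ℕ) :
    ∑ s ∈ Finset.range t, (if s = i then j else 1) = if t ≤ i then t else t - 1 + j := by
  induction t with
  | zero => simp
  | succ t ih =>
    rw [Finset.sum_range_succ, ih]
    split_ifs <;> omega

theorem sum_arity (hm : i + j + k = m) (hp : i + 1 + k = p) :
    ∑ t : Fin p, arity i j t = m := by
  have h := Fin.sum_univ_eq_sum_range (fun s => if s = i then j else 1) p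
  rw [sum_range_arity, if_neg (by omega)] at h
  exact h.trans (by omega)

theorem val_finSigmaFinEquiv_arity (t : Fin p) (l : Fin (arity i j t)) :
    ((finSigmaFinEquiv ⟨t, l⟩ : Fin (∑ t : Fin p, arity i j t)) : ℕ) =
      (if (t : ℕ) ≤ i then (t : ℕ) else t - 1 + j) + l := by
  rw [finSigmaFinEquiv_apply, ← sum_range_arity, ← Fin.sum_univ_eq_sum_range]
  rfl

/-- The word `T` at the letter `i` and one-letter words at the others. -/
def substFamily (T : PWord j) (t : Fin p) : PWord (arity i j t) :=
  if h : (t : ℕ) = i then cast (arity_self h) T else cast (arity_of_ne h) (corolla 1)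

theorem substFamily_self (T : PWord j) {t : Fin p} (h : (t : ℕ) = i) :
    substFamily T t = cast (arity_self h) T := dif_pos h

theorem substFamily_of_ne (T : PWord j) {t : Fin p} (h : (t : ℕ) ≠ i) :
    substFamily T t = cast (arity_of_ne h) (corolla 1) := dif_neg h

theorem substFamily_mono {T T' : PWord j} (hT : T ≤ T') (t : Fin p) :
    (substFamily T t : PWord (arity i j t)) ≤ substFamily T' t := by
  by_cases h : (t : ℕ) = i
  · rw [substFamily_self T h, substFamily_self T' h]
    exact cast_le_cast _ hT
  · rw [substFamily_of_ne _ h, substFamily_of_ne _ h]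

/-- Substitution of the word `T` for the letter `i` of the word `S`. -/
def subst (hm : i + j + k = m) (hp : i + 1 + k = p) (S : PWord p) (T : PWord j) : PWord m :=
  cast (sum_arity hm hp) (comp S (substFamily T))

theorem subst_mono (hm : i + j + k = m) (hp : i + 1 + k = p) {S S' : PWord p} {T T' : PWord j}
    (hS : S ≤ S') (hT : T ≤ T') : subst hm hp S T ≤ subst hm hp S' T' :=
  cast_le_cast _ (comp_mono hS (substFamily_mono hT))

/-- The letter of the outer word which a letter belongs to. -/
def collapse (hm : i + j + k = m) (hp : i + 1 + k = p) (x : Fin m) : Fin p :=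
  ⟨if (x : ℕ) < i then x else if (x : ℕ) < i + j then i else x - j + 1, by split_ifs <;> omega⟩

theorem block_eq_collapse (hm : i + j + k = m) (hp : i + 1 + k = p)
    (x : Fin (∑ t : Fin p, arity i j t)) :
    block (arity i j) x = collapse hm hp (finCongr (sum_arity hm hp) x) := by
  obtain ⟨l, hl⟩ := exists_eq_apply x
  have h1 := val_finSigmaFinEquiv_arity _ l
  rw [hl] at h1
  have h2 : (l : ℕ) < if ((block (arity i j) x : Fin p) : ℕ) = i then j else 1 := l.2
  refine Fin.ext ?_
  simp only [collapse, finCongr_apply, Fin.val_cast]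
  generalize ((block (arity i j) x : Fin p) : ℕ) = t at *
  split_ifs at * <;> omega

/-- The letters which belong to a letter in `s`. -/
def blowup (hm : i + j + k = m) (hp : i + 1 + k = p) (s : Finset (Fin p)) : Finset (Fin m) :=
  Finset.univ.filter fun x => collapse hm hp x ∈ s

/-- The copy of a set of letters of the inner word. -/
def shift (hm : i + j + k = m) (q : Finset (Fin j)) : Finset (Fin m) :=
  q.map ⟨fun y : Fin j => ⟨i + y, by omega⟩, fun y z h => by
    simp only [Fin.mk.injEq] at h
    exact Fin.ext (by omega)⟩

/-- The letters in the positions `i`, …, `i + j - 1`. -/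
def segment (i j m : ℕ) : Finset (Fin m) :=
  Finset.univ.filter fun x : Fin m => i ≤ (x : ℕ) ∧ (x : ℕ) < i + j

@[simp]
theorem mem_segment {x : Fin m} : x ∈ segment i j m ↔ i ≤ (x : ℕ) ∧ (x : ℕ) < i + j := by
  simp [segment]

@[simp]
theorem mem_blowup {hm : i + j + k = m} {hp : i + 1 + k = p} {s : Finset (Fin p)} {x : Fin m} :
    x ∈ blowup hm hp s ↔ collapse hm hp x ∈ s := by
  simp [blowup]

theorem mem_shift {hm : i + j + k = m} {q : Finset (Fin j)} {x : Fin m} :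
    x ∈ shift hm q ↔ ∃ y ∈ q, i + (y : ℕ) = x := by
  rw [shift, Finset.mem_map]
  exact exists_congr fun y => and_congr_right fun _ => Fin.ext_iff

theorem shift_univ (hm : i + j + k = m) : shift hm Finset.univ = segment i j m := by
  ext x
  rw [mem_shift, mem_segment]
  constructor
  · rintro ⟨y, -, h⟩
    omega
  · exact fun h => ⟨⟨x - i, by omega⟩, Finset.mem_univ _, by dsimp only; omega⟩

theorem map_outer_arity (hm : i + j + k = m) (hp : i + 1 + k = p) (q : Finset (Fin p)) :
    (outer (arity i j) q).map (finCongr (sum_arity hm hp)).toEmbedding = blowup hm hp q := by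
  ext x
  rw [Finset.mem_map_equiv, mem_outer, block_eq_collapse hm hp, mem_blowup,
    Equiv.apply_symm_apply]

theorem map_inner_arity (hm : i + j + k = m) (hp : i + 1 + k = p) {t : Fin p} (ht : (t : ℕ) = i)
    (q : Finset (Fin j)) :
    (inner (arity i j) t (q.map (finCongr (arity_self ht)).toEmbedding)).map
      (finCongr (sum_arity hm hp)).toEmbedding = shift hm q := by
  ext x
  rw [Finset.mem_map_equiv, mem_inner, mem_shift]
  constructor
  · rintro ⟨l, hl, hx⟩
    rw [Finset.mem_map_equiv] at hl
    refine ⟨_, hl, ?_⟩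
    have h1 := val_finSigmaFinEquiv_arity t l
    rw [hx, if_pos ht.le, ht] at h1
    simpa using h1.symm
  · rintro ⟨y, hy, hx⟩
    refine ⟨finCongr (arity_self ht) y, by simpa [Finset.mem_map_equiv] using hy, ?_⟩
    have h1 := val_finSigmaFinEquiv_arity t (finCongr (arity_self ht) y)
    rw [if_pos ht.le, ht] at h1
    refine Fin.ext (h1.trans ?_)
    simpa using hx

/-- The root of `T` contributes the segment. The root of `S` yields the full set and the one-letter
words yield sets with at most one element; both are discarded by the size conditions. Identities
between substitutions thereby become identities between intervals. -/
theorem mem_subst_parens (hm : i + j + k = m) (hp : i + 1 + k = p) {S : PWord p} {T : PWord j}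
    {s : Finset (Fin m)} : s ∈ (subst hm hp S T).parens ↔
      ((∃ q ∈ S.parens, blowup hm hp q = s) ∨ s = segment i j m ∨ ∃ q ∈ T.parens, shift hm q = s) ∧
        2 ≤ s.card ∧ s.card < m := by
  obtain ⟨s, rfl⟩ := exists_map_eq (sum_arity hm hp) s
  have hinj := Finset.map_injective (finCongr (sum_arity hm hp)).toEmbedding
  have hsum : s.card < ∑ t : Fin p, arity i j t ↔ s.card < m :=
    (congrArg (s.card < ·) (sum_arity hm hp)).to_iff
  rw [subst, mem_cast_parens, comp, Finset.mem_filter, mem_graft, Finset.card_map, hsum]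
  refine and_congr_left fun ⟨h2, hlt⟩ => ?_
  constructor
  · rintro (⟨q, hq, rfl⟩ | ⟨t, q, hq, rfl⟩)
    · rw [map_outer_arity hm hp]
      rcases mem_nodes.1 hq with rfl | hq
      · rw [outer_univ, Finset.card_univ, Fintype.card_fin, sum_arity hm hp] at hlt
        omega
      · exact Or.inl ⟨q, hq, rfl⟩
    · right
      by_cases ht : (t : ℕ) = i
      · obtain ⟨q, rfl⟩ := exists_map_eq (arity_self ht) q
        rw [substFamily_self T ht, mem_cast_nodes] at hq
        rw [map_inner_arity hm hp ht]
        rcases mem_nodes.1 hq with rfl | hq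
        · exact Or.inl (shift_univ hm)
        · exact Or.inr ⟨q, hq, rfl⟩
      · have := Finset.card_le_univ q
        rw [card_inner] at h2
        have h1 := arity_of_ne (j := j) ht
        rw [Fintype.card_fin] at this
        omega
  · have hi : i < p := by omega
    have key : ∀ q ∈ T.nodes, shift hm q = s.map (finCongr (sum_arity hm hp)).toEmbedding →
        ∃ t, ∃ q ∈ (substFamily T t : PWord (arity i j t)).nodes, inner (arity i j) t q = s := by
      intro q hq h
      refine ⟨⟨i, hi⟩, q.map (finCongr (arity_self rfl)).toEmbedding, ?_, hinj ?_⟩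
      · rw [substFamily_self T rfl]
        exact (mem_cast_nodes _).2 hq
      · rw [map_inner_arity hm hp rfl, h]
    rintro (⟨q, hq, h⟩ | h | ⟨q, hq, h⟩)
    · exact Or.inl ⟨q, mem_nodes.2 (Or.inr hq), hinj (by rw [map_outer_arity hm hp, h])⟩
    · exact Or.inr (key Finset.univ (mem_nodes.2 (Or.inl rfl)) (by rw [shift_univ, h]))
    · exact Or.inr (key q (mem_nodes.2 (Or.inr hq)) h)

end PWord

namespace Assoc

variable {n : ℕ∞} {i j k m p : ℕ}

/-- Transport of a word along an equality of lengths. -/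
def cast {a b : ℕ} (e : a = b) (w : Assoc n a) : Assoc n b := ⟨w.1.cast e, w.2.cast e⟩

/-- The word `T` at the letter `i` and one-letter words at the others. -/
def substFamily (T : Assoc n j) (t : Fin p) : Assoc n (PWord.arity i j t) :=
  ⟨PWord.substFamily T.1 t, by
    by_cases h : (t : ℕ) = i
    · rw [PWord.substFamily_self _ h]
      exact T.2.cast _
    · rw [PWord.substFamily_of_ne _ h]
      exact (one n).2.cast _⟩

/-- Substitution of the word `T` for the letter `i` of the word `S`. -/
def subst (hm : i + j + k = m) (hp : i + 1 + k = p) (S : Assoc n p) (T : Assoc n j) : Assoc n m :=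
  cast (PWord.sum_arity hm hp) ((γ n (PWord.arity i j)).obj (S, substFamily T))

theorem subst_mono (hm : i + j + k = m) (hp : i + 1 + k = p) {S S' : Assoc n p} {T T' : Assoc n j}
    (hS : S ≤ S') (hT : T ≤ T') : subst hm hp S T ≤ subst hm hp S' T' :=
  PWord.subst_mono hm hp hS hT

end Assoc

namespace AssocAlgebra

variable {C : Type u} [Category.{v} C] {n : ℕ∞} (A : AssocAlgebra C n) {m : ℕ}

/-! ### The action on arrows -/

/-- The value of the action at a morphism of words and a tuple of morphisms of `C`. -/
def app {w w' : Assoc n m} (h : w ≤ w') (L : Fin m → Arrow C) : Arrow C :=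
  Arrow.mk ((A.θ m).map
    (CategoryTheory.Prod.mkHom (homOfLE h) (fun x => (L x).hom : (fun x => (L x).left) ⟶ fun x => (L x).right)))

theorem mk_θ_map {X Y : Assoc n m × (Fin m → C)} (f : X ⟶ Y) :
    Arrow.mk ((A.θ m).map f) = A.app (leOfHom f.1) fun x => Arrow.mk (f.2 x) := rfl

theorem app_congr {w₁ w₁' w₂ w₂' : Assoc n m} (h : w₁ ≤ w₁') (h' : w₂ ≤ w₂') (e : w₁ = w₂)
    (e' : w₁' = w₂') (L : Fin m → Arrow C) : A.app h L = A.app h' L := by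
  subst e e'
  rfl

theorem app_cast {a b : ℕ} (e : a = b) {w w' : Assoc n a} (h : w ≤ w') (L : Fin b → Arrow C)
    (h' : w.cast e ≤ w'.cast e) :
    A.app h' L = A.app h fun x => L (finCongr e x) := by
  subst e
  rfl

theorem app_one (h : Assoc.one n ≤ Assoc.one n) (L : Fin 1 → Arrow C) : A.app h L = L 0 := by
  have := congrArg (fun F : (Fin 1 → C) ⥤ C => F.mapArrow.obj
    (Arrow.mk (fun x => (L x).hom : (fun x => (L x).left) ⟶ fun x => (L x).right))) A.unit
  exact this

theorem app_γ {p : ℕ} (k : Fin p → ℕ) {S S' : Assoc n p} {T T' : ∀ t, Assoc n (k t)} (hS : S ≤ S')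
    (hT : ∀ t, T t ≤ T' t)
    (h : (Assoc.γ n k).obj (S, T) ≤ (Assoc.γ n k).obj (S', T')) (L : Fin (∑ t, k t) → Arrow C) :
    A.app h L = A.app hS fun t => A.app (hT t) fun l => L (finSigmaFinEquiv ⟨t, l⟩) := by
  have := congrArg (fun F => F.mapArrow.obj (Arrow.mk
    (X := ((S, T), fun x => (L x).left)) (Y := ((S', T'), fun x => (L x).right))
    (CategoryTheory.Prod.mkHom (CategoryTheory.Prod.mkHom (homOfLE hS) (fun t => homOfLE (hT t)))
      (fun x => (L x).hom : (fun x => (L x).left) ⟶ fun x => (L x).right)))) (A.comp p k)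
  exact this

variable {i j k p : ℕ}

/-- The tuple in which the middle block is replaced by `f`. -/
def plugFamily (hm : i + j + k = m) (hp : i + 1 + k = p) (f : Arrow C) (L : Fin m → Arrow C)
    (t : Fin p) : Arrow C :=
  (slot hm hp t).elim f L

/-- Compatibility with `γ` for a family consisting of one-letter words with one exception; by the
unit law the one-letter words act as identities. -/
theorem app_subst (hm : i + j + k = m) (hp : i + 1 + k = p) {S S' : Assoc n p} {T T' : Assoc n j}
    (hS : S ≤ S') (hT : T ≤ T') {w w' : Assoc n m} (h : w ≤ w')
    (hw : w = Assoc.subst hm hp S T) (hw' : w' = Assoc.subst hm hp S' T') (L : Fin m → Arrow C) :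
    A.app h L = A.app hS
      (plugFamily hm hp (A.app hT fun y => L ⟨i + y, by omega⟩) L) := by
  subst hw hw'
  have hTt : ∀ t : Fin p, (Assoc.substFamily T t : Assoc n (PWord.arity i j t)) ≤
    Assoc.substFamily T' t := PWord.substFamily_mono hT
  refine (A.app_cast (PWord.sum_arity hm hp) (w := (Assoc.γ n (PWord.arity i j)).obj (S, Assoc.substFamily T))
    (w' := (Assoc.γ n (PWord.arity i j)).obj (S', Assoc.substFamily T'))
    (PWord.comp_mono hS (PWord.substFamily_mono hT)) L h).trans ?_
  refine (A.app_γ (PWord.arity i j) hS hTt _ _).trans ?_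
  congr 1
  funext t
  by_cases ht : (t : ℕ) = i
  · have e1 : slot hm hp t = none := by
      rw [slot, dif_neg (by omega), dif_pos ht]
    rw [plugFamily, e1, Option.elim_none]
    have h1 : (Assoc.substFamily T t : Assoc n (PWord.arity i j t)) =
        Assoc.cast (PWord.arity_self ht) T := Subtype.ext (PWord.substFamily_self T.1 ht)
    have h2 : (Assoc.substFamily T' t : Assoc n (PWord.arity i j t)) =
        Assoc.cast (PWord.arity_self ht) T' := Subtype.ext (PWord.substFamily_self T'.1 ht)
    have h3 : Assoc.cast (PWord.arity_self ht) T ≤ Assoc.cast (PWord.arity_self ht) T' :=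
      PWord.cast_le_cast (PWord.arity_self (i := i) (j := j) ht) hT
    rw [A.app_congr (hTt t) h3 h1 h2, A.app_cast (PWord.arity_self ht) hT]
    congr 1
    funext y
    congr 1
    refine Fin.ext ?_
    have := PWord.val_finSigmaFinEquiv_arity t (finCongr (PWord.arity_self ht) y)
    rw [if_pos ht.le, ht] at this
    simpa using this
  · have h1 : ∀ T : Assoc n j, (Assoc.substFamily T t : Assoc n (PWord.arity i j t)) =
        Assoc.cast (PWord.arity_of_ne ht) (Assoc.one n) := fun T =>
      Subtype.ext (PWord.substFamily_of_ne T.1 ht)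
    rw [A.app_congr (hTt t) le_rfl (h1 T) (h1 T'), A.app_cast _ le_rfl, app_one]
    have hv := PWord.val_finSigmaFinEquiv_arity t (finCongr (PWord.arity_of_ne (j := j) ht) 0)
    rw [plugFamily, slot]
    by_cases hlt : (t : ℕ) < i
    · rw [dif_pos hlt, Option.elim_some]
      congr 1
      refine Fin.ext ?_
      rw [if_pos hlt.le] at hv
      simpa using hv
    · rw [dif_neg hlt, dif_neg ht, Option.elim_some]
      congr 1
      refine Fin.ext ?_
      rw [if_neg (by omega)] at hv
      simpa using hv

end AssocAlgebra
end Associahedral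

/-! ### Words with at most two pairs of parentheses as substitutions. -/

namespace Associahedral
namespace PWord

variable {i j k m p a b : ℕ}

theorem eq_of_parens_iff {w w' : PWord m}
    (h : ∀ s : Finset (Fin m), 2 ≤ s.card → s.card < m → (s ∈ w.parens ↔ s ∈ w'.parens)) :
    w = w' := by
  ext s
  exact ⟨fun hs => (h s (w.two_le s hs) (w.card_lt s hs)).1 hs,
    fun hs => (h s (w'.two_le s hs) (w'.card_lt s hs)).2 hs⟩

theorem mem_bracket_parens {s : Finset (Fin m)} :
    s ∈ (bracket i j m).parens ↔ s = segment i j m ∧ 2 ≤ s.card ∧ s.card < m := by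
  rw [bracket, Finset.mem_filter, Finset.mem_singleton]
  rfl

theorem card_segment_le (i j m : ℕ) : (segment i j m).card ≤ j := by
  have : (segment i j m).card ≤ (Finset.Ico i (i + j)).card := by
    refine Finset.card_le_card_of_injOn (fun x => (x : ℕ)) (fun x hx => ?_)
      (fun x _ y _ h => Fin.ext h)
    simpa using hx
  simpa using this

theorem segment_all (m : ℕ) : segment 0 m m = Finset.univ := by
  ext x
  simp

theorem bracket_eq_corolla (h : j ≤ 1) : bracket i j m = corolla m := by
  refine eq_of_parens_iff fun s h2 hm => iff_of_false (fun hs => ?_) (by simp [corolla])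
  have := card_segment_le i j m
  rw [← (mem_bracket_parens.1 hs).1] at this
  omega

theorem bracket_all (m : ℕ) : bracket 0 m m = corolla m := by
  refine eq_of_parens_iff fun s h2 hm => iff_of_false (fun hs => ?_) (by simp [corolla])
  rw [(mem_bracket_parens.1 hs).1, segment_all, Finset.card_univ, Fintype.card_fin] at hm
  omega

theorem blowup_segment_left (hm : i + j + k = m) (hp : i + 1 + k = p) (h : a + b ≤ i) :
    blowup hm hp (segment a b p) = segment a b m := by
  ext x
  simp only [mem_blowup, mem_segment, collapse]
  split_ifs <;> omega

/-- One letter of the segment becomes `j` letters, so `b' = b + j - 1`; the relation is written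
additively to avoid truncated subtraction. -/
theorem blowup_segment_mid (hm : i + j + k = m) (hp : i + 1 + k = p) {b' : ℕ} (h : a ≤ i)
    (h' : i < a + b) (hb : b' + 1 = b + j) :
    blowup hm hp (segment a b p) = segment a b' m := by
  ext x
  simp only [mem_blowup, mem_segment, collapse]
  split_ifs <;> omega

theorem blowup_segment_right (hm : i + j + k = m) (hp : i + 1 + k = p) {a' : ℕ} (h : i < a)
    (ha : a' + 1 = a + j) :
    blowup hm hp (segment a b p) = segment a' b m := by
  ext x
  simp only [mem_blowup, mem_segment, collapse]
  split_ifs <;> omega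

theorem shift_segment (hm : i + j + k = m) (h : a + b ≤ j) :
    shift hm (segment a b j) = segment (i + a) b m := by
  ext x
  rw [mem_shift, mem_segment]
  constructor
  · rintro ⟨y, hy, h⟩
    rw [mem_segment] at hy
    omega
  · intro h
    exact ⟨⟨x - i, by omega⟩, mem_segment.2 (by dsimp only; omega), by dsimp only; omega⟩

theorem blowup_singleton (hm : i + j + k = m) (hp : i + 1 + k = p) {t : Fin p} (ht : (t : ℕ) = i) :
    blowup hm hp {t} = segment i j m := by
  ext x
  simp only [mem_blowup, mem_segment, collapse, Finset.mem_singleton, Fin.ext_iff]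
  split_ifs <;> omega

theorem card_blowup_singleton_le (hm : i + j + k = m) (hp : i + 1 + k = p) {t : Fin p}
    (ht : (t : ℕ) ≠ i) : (blowup hm hp {t}).card ≤ 1 := by
  refine Finset.card_le_one.2 fun x hx y hy => Fin.ext ?_
  simp only [mem_blowup, collapse, Finset.mem_singleton, Fin.ext_iff] at hx hy
  split_ifs at hx hy <;> omega

theorem blowup_univ (hm : i + j + k = m) (hp : i + 1 + k = p) :
    blowup hm hp Finset.univ = Finset.univ := by
  ext x
  simp

/-- A set whose blowup is a possible pair of parentheses is one, too, or consists of the letter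
which is substituted for. -/
theorem card_of_blowup (hm : i + j + k = m) (hp : i + 1 + k = p) {q : Finset (Fin p)}
    (h2 : 2 ≤ (blowup hm hp q).card) (hlt : (blowup hm hp q).card < m)
    (h : blowup hm hp q ≠ segment i j m) : 2 ≤ q.card ∧ q.card < p := by
  constructor
  · by_contra hcon
    rcases (by omega : q.card = 0 ∨ q.card = 1) with h0 | h1
    · rw [Finset.card_eq_zero.1 h0] at h2
      simp [blowup] at h2
    · obtain ⟨t, rfl⟩ := Finset.card_eq_one.1 h1
      by_cases ht : (t : ℕ) = i
      · exact h (blowup_singleton hm hp ht)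
      · have := card_blowup_singleton_le hm hp ht
        omega
  · refine (card_finset_fin_le q).lt_of_ne fun h => ?_
    rw [(Finset.card_eq_iff_eq_univ q).1 (by simpa using h), blowup_univ, Finset.card_univ,
      Fintype.card_fin] at hlt
    omega

theorem card_shift (hm : i + j + k = m) (q : Finset (Fin j)) : (shift hm q).card = q.card :=
  Finset.card_map _

theorem card_of_shift (hm : i + j + k = m) {q : Finset (Fin j)} (h2 : 2 ≤ (shift hm q).card)
    (h : shift hm q ≠ segment i j m) : 2 ≤ q.card ∧ q.card < j := by
  rw [card_shift] at h2
  refine ⟨h2, (card_finset_fin_le q).lt_of_ne fun hq => h ?_⟩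
  rw [(Finset.card_eq_iff_eq_univ q).1 (by simpa using hq), shift_univ]

theorem subst_corolla_corolla (hm : i + j + k = m) (hp : i + 1 + k = p) :
    subst hm hp (corolla p) (corolla j) = bracket i j m := by
  refine eq_of_parens_iff fun s h2 hlt => ?_
  rw [mem_subst_parens, mem_bracket_parens]
  simp [corolla]

theorem mem_subst_bracket_corolla (hm : i + j + k = m) (hp : i + 1 + k = p) {s : Finset (Fin m)} :
    s ∈ (subst hm hp (bracket a b p) (corolla j)).parens ↔
      (s = blowup hm hp (segment a b p) ∨ s = segment i j m) ∧ 2 ≤ s.card ∧ s.card < m := by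
  rw [mem_subst_parens]
  refine and_congr_left fun ⟨h2, hlt⟩ => ?_
  simp only [corolla, Finset.notMem_empty, false_and, exists_false, or_false, mem_bracket_parens]
  constructor
  · rintro (⟨q, ⟨rfl, -⟩, h⟩ | h)
    · exact Or.inl h.symm
    · exact Or.inr h
  · rintro (h | h)
    -- If the bracket of `bracket a b p` encloses only the letter substituted for, it is not
    -- recorded there, but its blow-up is then the segment. In all other cases `card_of_blowup`
    -- shows that it is recorded.
    · by_cases hs : s = segment i j m
      · exact Or.inr hs
      · subst h
        exact Or.inl ⟨_, ⟨rfl, card_of_blowup hm hp h2 hlt hs⟩, rfl⟩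
    · exact Or.inr h

theorem mem_subst_corolla_bracket (hm : i + j + k = m) (hp : i + 1 + k = p) {s : Finset (Fin m)} :
    s ∈ (subst hm hp (corolla p) (bracket a b j)).parens ↔
      (s = segment i j m ∨ s = shift hm (segment a b j)) ∧ 2 ≤ s.card ∧ s.card < m := by
  rw [mem_subst_parens]
  refine and_congr_left fun ⟨h2, hlt⟩ => ?_
  simp only [corolla, Finset.notMem_empty, false_and, exists_false, false_or, mem_bracket_parens]
  constructor
  · rintro (h | ⟨q, ⟨rfl, -⟩, h⟩)
    · exact Or.inl h
    · exact Or.inr h.symm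
  · rintro (h | h)
    · exact Or.inl h
    · by_cases hs : s = segment i j m
      · exact Or.inl hs
      · subst h
        exact Or.inr ⟨_, ⟨rfl, card_of_shift hm h2 hs⟩, rfl⟩

/-- Substituting the empty word deletes a letter, and its empty segment contributes no parentheses.
This underlies conditions (ii)–(iv). -/
theorem subst_bracket_nil {a' b' : ℕ} (hm : i + 0 + k = m) (hp : i + 1 + k = p)
    (h : blowup hm hp (segment a b p) = segment a' b' m) :
    subst hm hp (bracket a b p) (corolla 0) = bracket a' b' m := by
  refine eq_of_parens_iff fun s h2 hlt => ?_
  rw [mem_subst_bracket_corolla, mem_bracket_parens, h]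
  refine and_congr_left fun _ => or_iff_left ?_
  rintro rfl
  have := card_segment_le i 0 m
  omega

/-- Either order of insertion gives the same two disjoint pairs; this identifies the sources of the
two sides of condition (v). -/
theorem subst_disjoint {a b c d e m p q : ℕ} (hm : a + b + c + d + e = m)
    (hp : a + b + c + 1 + e = p) (h₁ : a + b + (c + d + e) = m)
    (h₂ : a + 1 + (c + d + e) = q) :
    subst hm hp (bracket a b p) (corolla d) = subst h₁ h₂ (bracket (a + 1 + c) d q) (corolla b) := by
  refine eq_of_parens_iff fun s h2 hlt => ?_
  rw [mem_subst_bracket_corolla, mem_subst_bracket_corolla, blowup_segment_left hm hp (by omega),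
    blowup_segment_right h₁ h₂ (a' := a + b + c) (by omega) (by omega), or_comm]

/-- The analogous identification of the sources in condition (vi). -/
theorem subst_nested {a b c d e m p q s t : ℕ} (hs : b + c + d = s) (ht : b + 1 + d = t)
    (hm : a + s + e = m) (hq : a + 1 + e = q) (hm' : a + b + c + (d + e) = m)
    (hp' : a + b + 1 + (d + e) = p) :
    subst hm hq (corolla q) (bracket b c s) = subst hm' hp' (bracket a t p) (corolla c) := by
  refine eq_of_parens_iff fun r h2 hlt => ?_
  rw [mem_subst_bracket_corolla, mem_subst_corolla_bracket, shift_segment hm (by omega),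
    blowup_segment_mid hm' hp' (b' := s) (by omega) (by omega) (by omega)]

end PWord

namespace AssocAlgebra

variable {C : Type u} [Category.{v} C] {n : ℕ∞} (A : AssocAlgebra C n) {i j k m p : ℕ}

/-! ### The `A_n`-monoidal structure of an algebra -/

/-- The tuple of identity morphisms. -/
def ids (X : Fin m → C) (x : Fin m) : Arrow C := Arrow.mk (𝟙 (X x))

theorem mk_plug_map (hm : i + j + k = m) (hp : i + 1 + k = p) (F : (Fin j → C) ⥤ C)
    {X Y : Fin m → C} (f : X ⟶ Y) :
    (fun t => Arrow.mk ((plug i j k hm hp F).map f t)) =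
      plugFamily hm hp (Arrow.mk (F.map ((middle C hm).map f))) fun x => Arrow.mk (f x) := by
  funext t
  change Arrow.mk ((plugComponent hm F (slot hm hp t)).map f) = (slot hm hp t).elim _ _
  cases slot hm hp t <;> rfl

theorem ids_plug_obj (hm : i + j + k = m) (hp : i + 1 + k = p) (F : (Fin j → C) ⥤ C)
    (X : Fin m → C) :
    ids ((plug i j k hm hp F).obj X) =
      plugFamily hm hp (Arrow.mk (𝟙 (F.obj ((middle C hm).obj X)))) (ids X) := by
  funext t
  change Arrow.mk (𝟙 ((plugComponent hm F (slot hm hp t)).obj X)) = (slot hm hp t).elim _ _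
  cases slot hm hp t <;> rfl

theorem mk_plugMap_app (hm : i + j + k = m) (hp : i + 1 + k = p) {F G : (Fin j → C) ⥤ C}
    (τ : F ⟶ G) (X : Fin m → C) :
    (fun t => Arrow.mk ((plugMap i j k hm hp τ).app X t)) =
      plugFamily hm hp (Arrow.mk (τ.app ((middle C hm).obj X))) (ids X) := by
  funext t
  change Arrow.mk ((plugMapComponent hm τ (slot hm hp t)).app X) = (slot hm hp t).elim _ _
  cases slot hm hp t <;> rfl

theorem app_ids_of_eq {w w' : Assoc n m} (h : w ≤ w') (e : w = w') (X : Fin m → C) :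
    A.app h (ids X) = Arrow.mk (𝟙 ((A.θ m).obj (w', X))) := by
  subst e
  exact congrArg Arrow.mk ((A.θ m).map_id (w, X))

theorem mk_comp_eq_app {w w' w'' : Assoc n m} (h : w ≤ w') (h' : w' ≤ w'') {X Y Z : Fin m → C}
    (f : X ⟶ Y) (g : Y ⟶ Z) {P Q R : C} {a : P ⟶ Q} {b : Q ⟶ R}
    (ha : Arrow.mk a = A.app h fun x => Arrow.mk (f x))
    (hb : Arrow.mk b = A.app h' fun x => Arrow.mk (g x)) :
    Arrow.mk (a ≫ b) = A.app (h.trans h') fun x => Arrow.mk ((f ≫ g) x) := by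
  refine (arrow_comp_congr ha hb).trans ?_
  rw [← Functor.map_comp]
  rfl

theorem mk_comp_eq_app_ids {w w' w'' : Assoc n m} (h : w ≤ w') (h' : w' ≤ w'') {X : Fin m → C}
    {P Q R : C} {a : P ⟶ Q} {b : Q ⟶ R} (ha : Arrow.mk a = A.app h (ids X))
    (hb : Arrow.mk b = A.app h' (ids X)) :
    Arrow.mk (a ≫ b) = A.app (h.trans h') (ids X) := by
  have := A.mk_comp_eq_app h h' (𝟙 X) (𝟙 X) ha hb
  rw [Category.comp_id] at this
  exact this

/-- The multiplication `μ_k`. -/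
abbrev mul (k : ℕ) (h : (k : ℕ∞) ≤ n) : (Fin k → C) ⥤ C :=
  CategoryTheory.Prod.sectR (Assoc.corolla k h) (Fin k → C) ⋙ A.θ k

theorem mk_mul_map {h : (k : ℕ∞) ≤ n} {X Y : Fin k → C} (f : X ⟶ Y) :
    Arrow.mk ((A.mul k h).map f) = A.app (le_refl (Assoc.corolla k h)) fun x => Arrow.mk (f x) := rfl

theorem mk_id_mul_obj {h : (k : ℕ∞) ≤ n} (X : Fin k → C) :
    Arrow.mk (𝟙 ((A.mul k h).obj X)) = A.app (le_refl (Assoc.corolla k h)) (ids X) :=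
  (A.app_ids_of_eq _ rfl X).symm

theorem subst_corolla_corolla (hm : i + j + k = m) (hp : i + 1 + k = p) (hmn : (m : ℕ∞) ≤ n)
    (hpn : (p : ℕ∞) ≤ n) (hjn : (j : ℕ∞) ≤ n) :
    Assoc.bracket i j m hmn = Assoc.subst hm hp (Assoc.corolla p hpn) (Assoc.corolla j hjn) :=
  Subtype.ext (PWord.subst_corolla_corolla hm hp).symm

theorem corolla_eq_subst_nil (hm : i + 0 + k = m) (hp : i + 1 + k = p) (hmn : (m : ℕ∞) ≤ n)
    (hpn : (p : ℕ∞) ≤ n) (hjn : ((0 : ℕ) : ℕ∞) ≤ n) :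
    Assoc.corolla m hmn = Assoc.subst hm hp (Assoc.corolla p hpn) (Assoc.corolla 0 hjn) :=
  (Subtype.ext (PWord.bracket_eq_corolla (Nat.zero_le 1)).symm).trans
    (subst_corolla_corolla hm hp hmn hpn hjn)

theorem subst_le_bracket (hm : i + j + k = m) (hp : i + 1 + k = p) (hmn : (m : ℕ∞) ≤ n)
    (hpn : (p : ℕ∞) ≤ n) (hjn : (j : ℕ∞) ≤ n) (a b : ℕ) :
    Assoc.subst hm hp (Assoc.bracket a b p hpn) (Assoc.corolla j hjn) ≤ Assoc.bracket i j m hmn :=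
  (Assoc.subst_mono hm hp (leOfHom (Assoc.drop a b p hpn)) le_rfl).trans_eq
    (subst_corolla_corolla hm hp hmn hpn hjn).symm

theorem plug_mul (hm : i + j + k = m) (hp : i + 1 + k = p) (hmn : (m : ℕ∞) ≤ n)
    (hpn : (p : ℕ∞) ≤ n) (hjn : (j : ℕ∞) ≤ n) :
    plug i j k hm hp (A.mul j hjn) ⋙ A.mul p hpn =
      CategoryTheory.Prod.sectR (Assoc.bracket i j m hmn) (Fin m → C) ⋙ A.θ m := by
  refine Arrow.functor_ext fun X Y f => ?_
  change Arrow.mk ((A.mul p hpn).map ((plug i j k hm hp (A.mul j hjn)).map f)) =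
    A.app (le_refl (Assoc.bracket i j m hmn)) fun x => Arrow.mk (f x)
  rw [mk_mul_map, mk_plug_map, A.app_subst hm hp (le_refl (Assoc.corolla p hpn))
    (le_refl (Assoc.corolla j hjn)) _ (subst_corolla_corolla hm hp hmn hpn hjn)
    (subst_corolla_corolla hm hp hmn hpn hjn)]
  rfl

/-- The natural transformation given by dropping the parentheses. -/
def dropParens (i j : ℕ) (hmn : (m : ℕ∞) ≤ n) :
    CategoryTheory.Prod.sectR (Assoc.bracket i j m hmn) (Fin m → C) ⋙ A.θ m ⟶ A.mul m hmn where
  app X := (A.θ m).map (CategoryTheory.Prod.mkHom (Assoc.drop i j m hmn) (𝟙 X))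
  naturality X Y f := by
    refine ((A.θ m).map_comp _ _).symm.trans (Eq.trans ?_ ((A.θ m).map_comp _ _))
    refine congrArg _ (CategoryTheory.Prod.hom_ext (Subsingleton.elim _ _) ?_)
    exact (Category.comp_id f).trans (Category.id_comp f).symm

/-- The associator `α^{i,j,k}`. -/
def assoc (hm : i + j + k = m) (hp : i + 1 + k = p) (hmn : (m : ℕ∞) ≤ n) (hpn : (p : ℕ∞) ≤ n)
    (hjn : (j : ℕ∞) ≤ n) : plug i j k hm hp (A.mul j hjn) ⋙ A.mul p hpn ⟶ A.mul m hmn :=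
  eqToHom (A.plug_mul hm hp hmn hpn hjn) ≫ A.dropParens i j hmn

theorem mk_assoc_app (hm : i + j + k = m) (hp : i + 1 + k = p) (hmn : (m : ℕ∞) ≤ n)
    (hpn : (p : ℕ∞) ≤ n) (hjn : (j : ℕ∞) ≤ n) (X : Fin m → C) :
    Arrow.mk ((A.assoc hm hp hmn hpn hjn).app X) =
      A.app (leOfHom (Assoc.drop i j m hmn)) (ids X) := by
  rw [assoc, NatTrans.comp_app, eqToHom_app, Arrow.arrow_mk_eqToHom_comp]
  rfl

/-- The inner multiplication is absorbed into the words by `app_subst`, so that both factors of a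
composite of associators are actions at the same tuple `X`. -/
theorem mk_assoc_app_plug {a b c q : ℕ} (hm : i + j + k = m) (hp : i + 1 + k = p)
    (hjn : (j : ℕ∞) ≤ n) (habc : a + b + c = p) (hq : a + 1 + c = q)
    (hpn : (p : ℕ∞) ≤ n) (hqn : (q : ℕ∞) ≤ n) (hbn : (b : ℕ∞) ≤ n) {w w' : Assoc n m} (h : w ≤ w')
    (hw : w = Assoc.subst hm hp (Assoc.bracket a b p hpn) (Assoc.corolla j hjn))
    (hw' : w' = Assoc.subst hm hp (Assoc.corolla p hpn) (Assoc.corolla j hjn)) (X : Fin m → C) :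
    Arrow.mk ((A.assoc habc hq hpn hqn hbn).app ((plug i j k hm hp (A.mul j hjn)).obj X)) =
      A.app h (ids X) := by
  rw [mk_assoc_app, ids_plug_obj, mk_id_mul_obj, A.app_subst hm hp _ (le_refl _) h hw hw']
  rfl

/-- Conditions (ii), (iii) and (iv) at once: they differ only in the position of the deleted letter
relative to the segment, which `h` records. -/
theorem mk_assoc_app_unit {a b c q a' b' c' q' : ℕ} (hm : i + 0 + k = m) (hp : i + 1 + k = p)
    (habc : a + b + c = p) (hq : a + 1 + c = q) (hpn : (p : ℕ∞) ≤ n) (hqn : (q : ℕ∞) ≤ n)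
    (hbn : (b : ℕ∞) ≤ n) (habc' : a' + b' + c' = m) (hq' : a' + 1 + c' = q')
    (hmn : (m : ℕ∞) ≤ n) (hqn' : (q' : ℕ∞) ≤ n) (hbn' : (b' : ℕ∞) ≤ n)
    (h : PWord.blowup hm hp (PWord.segment a b p) = PWord.segment a' b' m) (X : Fin m → C) :
    Arrow.mk ((A.assoc habc hq hpn hqn hbn).app
        ((plug i 0 k hm hp (A.mul 0 zero_le_enat)).obj X)) =
      Arrow.mk ((A.assoc habc' hq' hmn hqn' hbn').app X) :=
  (A.mk_assoc_app_plug hm hp zero_le_enat habc hq hpn hqn hbn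
    (leOfHom (Assoc.drop a' b' m hmn)) (Subtype.ext (PWord.subst_bracket_nil hm hp h).symm)
    (corolla_eq_subst_nil hm hp hmn hpn zero_le_enat) X).trans
    (A.mk_assoc_app habc' hq' hmn hqn' hbn' X).symm

/-- The `A_n`-monoidal structure given by an algebra structure. -/
def toMonoidal : AnMonoidal C n where
  μ := A.mul
  μ_one h := A.unit
  μ_unit {i j m p} hm hp hmn hpn := by
    have : Assoc.bracket i 0 m hmn = Assoc.corolla m hmn :=
      Subtype.ext (PWord.bracket_eq_corolla (Nat.zero_le 1))
    rw [A.plug_mul hm hp hmn hpn, this]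
  α i j k m p hm hp hmn hpn := A.assoc hm hp hmn hpn (le_mid hm hmn)
  α_zero hm hp hmn hpn X := by
    rw [mk_assoc_app]
    exact A.app_ids_of_eq _ (Subtype.ext (PWord.bracket_eq_corolla (Nat.zero_le 1))) X
  α_one hm hp hmn hpn X := by
    rw [mk_assoc_app]
    exact A.app_ids_of_eq _ (Subtype.ext (PWord.bracket_eq_corolla le_rfl)) X
  α_all {j m p} hm hp hmn hpn X := by
    rw [mk_assoc_app]
    refine A.app_ids_of_eq _ (Subtype.ext ?_) X
    obtain rfl : j = m := by omega
    exact PWord.bracket_all _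
  α_unit_left {a b c d m q} hm hq hmn hqn X :=
    A.mk_assoc_app_unit (by omega) (by omega) _ _ hmn hqn _ hm hq _ _ _
      (PWord.blowup_segment_right _ _ (by omega) (by omega)) X
  α_unit_right {a b c d m q} hm hq hmn hqn X :=
    A.mk_assoc_app_unit (by omega) (by omega) _ _ hmn hqn _ hm hq _ _ _
      (PWord.blowup_segment_left _ _ (by omega)) X
  α_unit_mid {a b c d m q} hm hq hmn hqn X :=
    A.mk_assoc_app_unit (by omega) (by omega) _ _ hmn hqn _ hm hq _ _ _
      (PWord.blowup_segment_mid _ _ (by omega) (by omega) (by omega)) X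
  α_disjoint {a b c d e m p q r} hm hp hq hr hmn hpn hqn hrn hbn hdn X := by
    have h₁ : a + b + (c + d + e) = m := by omega
    have h₂ : a + 1 + (c + d + e) = q := by omega
    refine (A.mk_comp_eq_app_ids (subst_le_bracket hm hp hmn hpn hdn a b)
      (leOfHom (Assoc.drop _ _ _ hmn))
      (A.mk_assoc_app_plug hm hp hdn _ _ hpn hrn hbn _ rfl
        (subst_corolla_corolla hm hp hmn hpn hdn) X) (A.mk_assoc_app hm hp hmn hpn hdn X)).trans
      (Eq.trans ?_ (A.mk_comp_eq_app_ids (subst_le_bracket h₁ h₂ hmn hqn hbn (a + 1 + c) d)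
        (leOfHom (Assoc.drop _ _ _ hmn))
        (A.mk_assoc_app_plug h₁ h₂ hbn hq hr hqn hrn hdn _ rfl
          (subst_corolla_corolla h₁ h₂ hmn hqn hbn) X) (A.mk_assoc_app h₁ h₂ hmn hqn hbn X)).symm)
    -- Both sides are actions of morphisms to the corolla, and their sources agree; in a poset the
    -- morphisms are then equal.
    exact A.app_congr _ _ (Subtype.ext (PWord.subst_disjoint hm hp h₁ h₂)) rfl _
  α_nested {a b c d e m p q s t} hm hp hq hs ht hmn hpn hqn hsn htn hcn X := by
    have h₁ : a + s + e = m := by omega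
    have h₂ : a + b + c + (d + e) = m := by omega
    have h₃ : a + b + 1 + (d + e) = p := by omega
    -- The product of the inner associator with identities is the action of dropping the inner pair
    -- of parentheses alone.
    have key : Arrow.mk ((A.mul q hqn).map
        ((plugMap a s e h₁ hq (A.assoc hs ht hsn htn hcn)).app X)) =
        A.app ((Assoc.subst_mono h₁ hq le_rfl (leOfHom (Assoc.drop b c s hsn))).trans_eq
          (subst_corolla_corolla h₁ hq hmn hqn hsn).symm) (ids X) := by
      rw [A.mk_mul_map, mk_plugMap_app, mk_assoc_app,
        A.app_subst h₁ hq (le_refl (Assoc.corolla q hqn)) (leOfHom (Assoc.drop b c s hsn)) _ rfl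
          (subst_corolla_corolla h₁ hq hmn hqn hsn)]
      rfl
    refine (A.mk_comp_eq_app_ids _ (leOfHom (Assoc.drop _ _ _ hmn)) key
      (A.mk_assoc_app h₁ hq hmn hqn hsn X)).trans
      (Eq.trans ?_ (A.mk_comp_eq_app_ids (subst_le_bracket h₂ h₃ hmn hpn hcn a t)
        (leOfHom (Assoc.drop _ _ _ hmn))
        (A.mk_assoc_app_plug h₂ h₃ hcn _ hq hpn hqn htn _ rfl
          (subst_corolla_corolla h₂ h₃ hmn hpn hcn) X) (A.mk_assoc_app h₂ h₃ hmn hpn hcn X)).symm)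
    exact A.app_congr _ _ (Subtype.ext (PWord.subst_nested hs ht h₁ hq h₂ h₃)) rfl _

end AssocAlgebra
end Associahedral

namespace Associahedral
namespace PWord

variable {i j k m p : ℕ}

/-! ### Cutting a tree at an internal edge -/

theorem collapse_mono (hm : i + j + k = m) (hp : i + 1 + k = p) {x y : Fin m} (h : x ≤ y) :
    collapse hm hp x ≤ collapse hm hp y := by
  rw [Fin.le_def] at h ⊢
  dsimp only [collapse]
  split_ifs <;> omega

theorem collapse_surjective (hm : i + j + k = m) (hp : i + 1 + k = p) (hj : 0 < j) :
    Function.Surjective (collapse hm hp) := by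
  intro t
  refine ⟨⟨if (t : ℕ) ≤ i then t else t - 1 + j, by split_ifs <;> omega⟩, Fin.ext ?_⟩
  dsimp only [collapse]
  split_ifs <;> omega

theorem blowup_subset_blowup (hm : i + j + k = m) (hp : i + 1 + k = p) (hj : 0 < j)
    {s t : Finset (Fin p)} : blowup hm hp s ⊆ blowup hm hp t ↔ s ⊆ t := by
  refine ⟨fun h y hy => ?_, fun h x hx => mem_blowup.2 (h (mem_blowup.1 hx))⟩
  obtain ⟨x, rfl⟩ := collapse_surjective hm hp hj y
  exact mem_blowup.1 (h (mem_blowup.2 hy))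

theorem blowup_injective (hm : i + j + k = m) (hp : i + 1 + k = p) (hj : 0 < j) :
    Function.Injective (blowup hm hp) := fun _ _ h =>
  ((blowup_subset_blowup hm hp hj).1 h.subset).antisymm ((blowup_subset_blowup hm hp hj).1 h.symm.subset)

theorem shift_injective (hm : i + j + k = m) : Function.Injective (shift hm) :=
  Finset.map_injective _

/-- The word obtained by replacing the letters in the positions `i`, …, `i + j - 1` by one
letter. -/
def contract (hm : i + j + k = m) (hp : i + 1 + k = p) (hj : 0 < j) (w : PWord m) : PWord p where
  parens := Finset.univ.filter fun s => 2 ≤ s.card ∧ blowup hm hp s ∈ w.parens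
  interval := by
    intro s hs
    rw [Finset.mem_filter] at hs
    refine exists_eq_Icc (Finset.card_pos.1 (by omega)) fun x hx z hz y hxy hyz => ?_
    rcases hxy.eq_or_lt with rfl | hxy
    · exact hx
    rcases hyz.eq_or_lt with rfl | hyz
    · exact hz
    obtain ⟨x, rfl⟩ := collapse_surjective hm hp hj x
    obtain ⟨y, rfl⟩ := collapse_surjective hm hp hj y
    obtain ⟨z, rfl⟩ := collapse_surjective hm hp hj z
    refine mem_blowup.1 (nodes_interval (mem_nodes.2 (Or.inr hs.2.2)) (mem_blowup.2 hx)
      (mem_blowup.2 hz) (le_of_lt ?_) (le_of_lt ?_))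
    · exact not_le.1 fun h => absurd (collapse_mono hm hp h) (not_le.2 hxy)
    · exact not_le.1 fun h => absurd (collapse_mono hm hp h) (not_le.2 hyz)
  two_le := fun s hs => (Finset.mem_filter.1 hs).2.1
  card_lt := by
    intro s hs
    rw [Finset.mem_filter] at hs
    refine (card_finset_fin_le s).lt_of_ne fun h => ?_
    have := w.card_lt _ hs.2.2
    rw [(Finset.card_eq_iff_eq_univ s).1 (by simpa using h), blowup_univ, Finset.card_univ,
      Fintype.card_fin] at this
    omega
  nested := by
    intro s hs t ht
    rcases w.nested _ (Finset.mem_filter.1 hs).2.2 _ (Finset.mem_filter.1 ht).2.2 with h | h | h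
    · exact Or.inl ((blowup_subset_blowup hm hp hj).1 h)
    · exact Or.inr (Or.inl ((blowup_subset_blowup hm hp hj).1 h))
    · refine Or.inr (Or.inr (Finset.disjoint_left.2 fun y hy hy' => ?_))
      obtain ⟨x, rfl⟩ := collapse_surjective hm hp hj y
      exact Finset.disjoint_left.1 h (mem_blowup.2 hy) (mem_blowup.2 hy')

/-- The subword of the letters in the positions `i`, …, `i + j - 1`. -/
def subword (hm : i + j + k = m) (w : PWord m) : PWord j where
  parens := Finset.univ.filter fun s => s.card < j ∧ shift hm s ∈ w.parens
  interval := by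
    intro s hs
    rw [Finset.mem_filter] at hs
    have h2 := w.two_le _ hs.2.2
    rw [card_shift] at h2
    refine exists_eq_Icc (Finset.card_pos.1 (by omega)) fun x hx z hz y hxy hyz => ?_
    rw [Fin.le_def] at hxy hyz
    have h := nodes_interval (mem_nodes.2 (Or.inr hs.2.2)) (mem_shift.2 ⟨x, hx, rfl⟩)
      (mem_shift.2 ⟨z, hz, rfl⟩) (x := ⟨i + x, by omega⟩) (y := ⟨i + y, by omega⟩)
      (z := ⟨i + z, by omega⟩) (by rw [Fin.le_def]; dsimp only; omega)
      (by rw [Fin.le_def]; dsimp only; omega)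
    obtain ⟨y', hy', h⟩ := mem_shift.1 h
    obtain rfl : y' = y := Fin.ext (by dsimp only at h; omega)
    exact hy'
  two_le := by
    intro s hs
    have h2 := w.two_le _ (Finset.mem_filter.1 hs).2.2
    rwa [card_shift] at h2
  card_lt := fun s hs => (Finset.mem_filter.1 hs).2.1
  nested := by
    intro s hs t ht
    rcases w.nested _ (Finset.mem_filter.1 hs).2.2 _ (Finset.mem_filter.1 ht).2.2 with h | h | h
    · exact Or.inl (Finset.map_subset_map.1 h)
    · exact Or.inr (Or.inl (Finset.map_subset_map.1 h))
    · exact Or.inr (Or.inr ((Finset.disjoint_map _).1 h))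

theorem mem_contract_parens {hm : i + j + k = m} {hp : i + 1 + k = p} {hj : 0 < j} {w : PWord m}
    {s : Finset (Fin p)} :
    s ∈ (contract hm hp hj w).parens ↔ 2 ≤ s.card ∧ blowup hm hp s ∈ w.parens := by
  simp [contract]

theorem mem_subword_parens {hm : i + j + k = m} {w : PWord m} {s : Finset (Fin j)} :
    s ∈ (subword hm w).parens ↔ s.card < j ∧ shift hm s ∈ w.parens := by
  simp [subword]

theorem contract_mono (hm : i + j + k = m) (hp : i + 1 + k = p) (hj : 0 < j) {w w' : PWord m}
    (h : w ≤ w') : contract hm hp hj w ≤ contract hm hp hj w' := fun _ hs =>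
  mem_contract_parens.2 ⟨(mem_contract_parens.1 hs).1, h (mem_contract_parens.1 hs).2⟩

theorem subword_mono (hm : i + j + k = m) {w w' : PWord m} (h : w ≤ w') :
    subword hm w ≤ subword hm w' := fun _ hs =>
  mem_subword_parens.2 ⟨(mem_subword_parens.1 hs).1, h (mem_subword_parens.1 hs).2⟩

theorem blowup_image_collapse (hm : i + j + k = m) (hp : i + 1 + k = p) {s : Finset (Fin m)}
    (h : segment i j m ⊆ s ∨ Disjoint s (segment i j m)) :
    blowup hm hp (s.image (collapse hm hp)) = s := by
  ext x
  rw [mem_blowup, Finset.mem_image]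
  refine ⟨?_, fun hx => ⟨x, hx, rfl⟩⟩
  rintro ⟨y, hy, hxy⟩
  by_cases hxP : x ∈ segment i j m
  · rcases h with h | h
    · exact h hxP
    · refine absurd ?_ (Finset.disjoint_left.1 h hy)
      rw [mem_segment] at hxP ⊢
      simp only [collapse, Fin.mk.injEq] at hxy
      split_ifs at hxy <;> omega
  · obtain rfl : y = x := by
      rw [mem_segment] at hxP
      simp only [collapse, Fin.mk.injEq] at hxy
      refine Fin.ext ?_
      split_ifs at hxy <;> omega
    exact hy

theorem exists_shift_eq (hm : i + j + k = m) {s : Finset (Fin m)} (h : s ⊆ segment i j m) :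
    ∃ q, shift hm q = s := by
  refine ⟨Finset.univ.filter fun y : Fin j => (⟨i + y, by omega⟩ : Fin m) ∈ s, ?_⟩
  ext x
  rw [mem_shift]
  constructor
  · rintro ⟨y, hy, h⟩
    rw [Finset.mem_filter] at hy
    have e : (⟨i + y, by omega⟩ : Fin m) = x := Fin.ext h
    rw [← e]
    exact hy.2
  · intro hx
    have hx' := mem_segment.1 (h hx)
    have e : i + ((x : ℕ) - i) = x := by omega
    refine ⟨⟨x - i, by omega⟩, Finset.mem_filter.2 ⟨Finset.mem_univ _, ?_⟩, e⟩
    have : (⟨i + ((x : ℕ) - i), by omega⟩ : Fin m) = x := Fin.ext e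
    rwa [this]

/-- Any other pair of parentheses lies inside the segment, contains it or is disjoint from it. The
first kind is recorded by the subword, the other two by the contraction. -/
theorem subst_contract_subword (hm : i + j + k = m) (hp : i + 1 + k = p) (hj : 0 < j) {w : PWord m}
    (h : segment i j m ∈ w.parens) : subst hm hp (contract hm hp hj w) (subword hm w) = w := by
  refine eq_of_parens_iff fun s h2 hlt => ?_
  rw [mem_subst_parens, and_iff_left ⟨h2, hlt⟩]
  constructor
  · rintro (⟨q, hq, rfl⟩ | rfl | ⟨q, hq, rfl⟩)
    · exact (mem_contract_parens.1 hq).2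
    · exact h
    · exact (mem_subword_parens.1 hq).2
  · intro hs
    by_cases hs' : s = segment i j m
    · exact Or.inr (Or.inl hs')
    have key : segment i j m ⊆ s ∨ Disjoint s (segment i j m) →
        ∃ q ∈ (contract hm hp hj w).parens, blowup hm hp q = s := by
      intro hd
      have e := blowup_image_collapse hm hp hd
      refine ⟨_, mem_contract_parens.2 ⟨?_, by rwa [e]⟩, e⟩
      exact (card_of_blowup hm hp (by rwa [e]) (by rwa [e]) (by rwa [e])).1
    rcases w.nested s hs _ h with hd | hd | hd
    · obtain ⟨q, rfl⟩ := exists_shift_eq hm hd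
      exact Or.inr (Or.inr ⟨q, mem_subword_parens.2 ⟨(card_of_shift hm h2 hs').2, hs⟩, rfl⟩)
    · exact Or.inl (key (Or.inl hd))
    · exact Or.inl (key (Or.inr hd))

/-- The segment itself is recorded neither here nor in the subword, so cutting lowers the number of
parentheses of both pieces. -/
theorem card_contract_lt (hm : i + j + k = m) (hp : i + 1 + k = p) (hj : 0 < j) {w : PWord m}
    (h : segment i j m ∈ w.parens) : (contract hm hp hj w).parens.card < w.parens.card := by
  refine lt_of_le_of_lt ?_ (Finset.card_erase_lt_of_mem h)
  refine Finset.card_le_card_of_injOn (blowup hm hp) (fun q hq => ?_)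
    (blowup_injective hm hp hj).injOn
  have hq' := mem_contract_parens.1 hq
  refine Finset.mem_erase.2 ⟨fun he => ?_, hq'.2⟩
  rw [← blowup_singleton hm hp (t := ⟨i, by omega⟩) rfl] at he
  rw [blowup_injective hm hp hj he, Finset.card_singleton] at hq'
  omega

theorem card_subword_lt (hm : i + j + k = m) {w : PWord m}
    (h : segment i j m ∈ w.parens) : (subword hm w).parens.card < w.parens.card := by
  refine lt_of_le_of_lt ?_ (Finset.card_erase_lt_of_mem h)
  refine Finset.card_le_card_of_injOn (shift hm) (fun q hq => ?_) (shift_injective hm).injOn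
  have hq' := mem_subword_parens.1 hq
  refine Finset.mem_erase.2 ⟨fun he => ?_, hq'.2⟩
  rw [← shift_univ hm] at he
  rw [shift_injective hm he, Finset.card_univ, Fintype.card_fin] at hq'
  omega

theorem InFiltration.of_cast {a b : ℕ} {n : ℕ∞} {e : a = b} {w : PWord a}
    (h : (PWord.cast e w).InFiltration n) : w.InFiltration n := by
  subst e
  exact h

/-- As `0 < j`, no letter is deleted; hence no node of `S` with at least two leaves is contracted,
and each keeps its number of incoming edges. -/
theorem InFiltration.of_subst_left {n : ℕ∞} {hm : i + j + k = m} {hp : i + 1 + k = p} (hj : 0 < j)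
    {S : PWord p} {T : PWord j} (h : (subst hm hp S T).InFiltration n) : S.InFiltration n := by
  intro s hs
  rw [← length_children]
  by_cases h2 : 2 ≤ s.card
  · have hsurj : ∀ t : Fin p, ∃ x : Fin (∑ t : Fin p, arity i j t), block (arity i j) x = t :=
      fun t => ⟨finSigmaFinEquiv ⟨t, ⟨0, by unfold arity; split_ifs <;> omega⟩⟩, block_apply _ _⟩
    have hne : ∀ r : Finset (Fin p), r.Nonempty → (outer (arity i j) r).Nonempty := by
      rintro r ⟨t, ht⟩
      obtain ⟨x, rfl⟩ := hsurj t
      exact ⟨x, mem_outer.2 ht⟩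
    have hc := children_outer S (substFamily T : ∀ t, PWord (arity i j t)) hs (by omega) (by
      intro r hr he
      obtain ⟨t, ht, ht'⟩ := Finset.exists_of_ssubset (mem_inputs.1 hr).2.1
      obtain ⟨x, rfl⟩ := hsurj t
      exact ht' (mem_outer.1 (he ▸ mem_outer.2 ht)))
    rw [List.filter_eq_self.2 fun r hr => decide_eq_true (hne r (nonempty_of_mem_children hr))] at hc
    have hl := congrArg List.length hc
    rw [length_children, List.length_map] at hl
    rw [← hl]
    have hsne := hne s (Finset.card_pos.1 (by omega))
    refine h.of_cast _ (((isEdge_of_mem_nodes hs).outer _ hsne).mem_nodes ?_)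
    by_contra hcon
    have := children_eq_nil (PWord.comp S (substFamily T : ∀ t, PWord (arity i j t)))
      (p := outer (arity i j) s) (by omega)
    rw [this] at hc
    exact S.children_ne_nil h2 (by simpa using hc.symm)
  · rw [children_eq_nil S (by omega)]
    simp

theorem InFiltration.of_subst_right {n : ℕ∞} {hm : i + j + k = m} {hp : i + 1 + k = p}
    {S : PWord p} {T : PWord j} (h : (subst hm hp S T).InFiltration n) : T.InFiltration n := by
  intro s hs
  by_cases h2 : 2 ≤ s.card
  · obtain ⟨t, ht⟩ : ∃ t : Fin p, (t : ℕ) = i := ⟨⟨i, by omega⟩, rfl⟩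
    have hs' : s.map (finCongr (arity_self ht)).toEmbedding ∈
        (substFamily T t : PWord (arity i j t)).nodes := by
      rw [substFamily_self T ht]
      exact (mem_cast_nodes _).2 hs
    have hc := congrArg List.length (children_inner S (substFamily T : ∀ t, PWord (arity i j t))
      t (s.map (finCongr (arity_self ht)).toEmbedding))
    rw [List.length_map, length_children, length_children] at hc
    have hc' := card_inputs_cast (arity_self ht) T s
    rw [← substFamily_self T ht] at hc'
    rw [← hc', ← hc]
    have hcard : 2 ≤ (inner (arity i j) t
        (s.map (finCongr (arity_self ht)).toEmbedding)).card := by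
      rwa [card_inner, Finset.card_map]
    exact h.of_cast _ ((isEdge_of_mem_graft (mem_graft.2 (Or.inr ⟨_, _, hs', rfl⟩))
      (Finset.card_pos.1 (by omega))).mem_nodes hcard)
  · rw [← length_children, children_eq_nil T (by omega)]
    simp

theorem le_of_inFiltration_corolla {n : ℕ∞} (hn : ((1 : ℕ) : ℕ∞) ≤ n)
    (h : (corolla m).InFiltration n) : (m : ℕ∞) ≤ n := by
  by_cases hm : m ≤ 1
  · exact cast_le_of_le hn hm
  refine le_trans ?_ (h Finset.univ (Finset.mem_insert_self _ _))
  have : (Finset.univ.image fun x : Fin m => ({x} : Finset (Fin m))) ⊆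
      (corolla m).inputs Finset.univ := by
    intro s hs
    obtain ⟨x, -, rfl⟩ := Finset.mem_image.1 hs
    refine mem_inputs.2 ⟨mem_edges.2 (Or.inr ⟨x, rfl⟩), ?_, ?_⟩
    · refine (Finset.subset_univ _).ssubset_of_ne fun he => ?_
      have := congrArg Finset.card he
      rw [Finset.card_singleton, Finset.card_univ, Fintype.card_fin] at this
      omega
    · intro r hr hxr
      rcases mem_edges.1 hr with h' | ⟨y, rfl⟩
      · simp [corolla] at h'
      · have := Finset.card_lt_card hxr
        simp at this
  have hle := Finset.card_le_card this
  rw [Finset.card_image_of_injective _ Finset.singleton_injective, Finset.card_univ,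
    Fintype.card_fin] at hle
  exact_mod_cast hle

theorem exists_eq_segment {w : PWord m} {s : Finset (Fin m)} (hs : s ∈ w.parens) :
    ∃ i j k, i + j + k = m ∧ 0 < j ∧ s = segment i j m := by
  obtain ⟨a, b, rfl⟩ := w.interval s hs
  have h2 := w.two_le _ hs
  have hab : a ≤ b := Finset.nonempty_Icc.1 (Finset.card_pos.1 (by omega))
  rw [Fin.le_def] at hab
  refine ⟨a, b - a + 1, m - 1 - b, by omega, by omega, ?_⟩
  ext x
  rw [Finset.mem_Icc, mem_segment, Fin.le_def, Fin.le_def]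
  omega

end PWord

namespace AssocAlgebra

variable {C : Type u} [Category.{v} C] {n : ℕ∞} {m : ℕ}

/-! ### An algebra is determined by its `A_n`-monoidal structure -/

theorem app_trans_congr {A B : AssocAlgebra C n} {w w' w'' : Assoc n m} (h : w ≤ w')
    (h' : w' ≤ w'') {X Y Z : Fin m → C} {f : X ⟶ Y} {g : Y ⟶ Z}
    (hf : (A.app h fun x => Arrow.mk (f x)) = B.app h fun x => Arrow.mk (f x))
    (hg : (A.app h' fun x => Arrow.mk (g x)) = B.app h' fun x => Arrow.mk (g x)) :
    (A.app (h.trans h') fun x => Arrow.mk ((f ≫ g) x)) =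
      B.app (h.trans h') fun x => Arrow.mk ((f ≫ g) x) := by
  have key : ∀ A : AssocAlgebra C n, (A.app (h.trans h') fun x => Arrow.mk ((f ≫ g) x)) =
      Arrow.mk ((A.θ m).map (CategoryTheory.Prod.mkHom (homOfLE h) f) ≫
        (A.θ m).map (CategoryTheory.Prod.mkHom (homOfLE h') g)) := by
    intro A
    rw [← Functor.map_comp]
    rfl
  rw [key, key]
  exact arrow_comp_congr hf hg

/-- A pair of parentheses of `w'` is also one of `w`. Cutting both words there expresses the action
through words with fewer parentheses. -/
theorem app_eq_of_mem_parens {A B : AssocAlgebra C n} {w w' : Assoc n m} (h : w ≤ w')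
    {s : Finset (Fin m)} (hs : s ∈ w'.1.parens)
    (ih : ∀ {l : ℕ} {v v' : Assoc n l} (h : v ≤ v') (L : Fin l → Arrow C),
      v.1.parens.card < w.1.parens.card → A.app h L = B.app h L) (L : Fin m → Arrow C) :
    A.app h L = B.app h L := by
  obtain ⟨i, j, k, hm, hj, rfl⟩ := PWord.exists_eq_segment hs
  obtain ⟨p, hp⟩ : ∃ p, i + 1 + k = p := ⟨_, rfl⟩
  have e := PWord.subst_contract_subword hm hp hj (h hs)
  have e' := PWord.subst_contract_subword hm hp hj hs
  have hf : (PWord.subst hm hp (w.1.contract hm hp hj) (w.1.subword hm)).InFiltration n := by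
    rw [e]
    exact w.2
  have hf' : (PWord.subst hm hp (w'.1.contract hm hp hj) (w'.1.subword hm)).InFiltration n := by
    rw [e']
    exact w'.2
  let S : Assoc n p := ⟨w.1.contract hm hp hj, hf.of_subst_left hj⟩
  let S' : Assoc n p := ⟨w'.1.contract hm hp hj, hf'.of_subst_left hj⟩
  let T : Assoc n j := ⟨w.1.subword hm, hf.of_subst_right⟩
  let T' : Assoc n j := ⟨w'.1.subword hm, hf'.of_subst_right⟩
  have hS : S ≤ S' := PWord.contract_mono hm hp hj h
  have hT : T ≤ T' := PWord.subword_mono hm h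
  have hw : w = Assoc.subst hm hp S T := Subtype.ext e.symm
  have hw' : w' = Assoc.subst hm hp S' T' := Subtype.ext e'.symm
  rw [A.app_subst hm hp hS hT h hw hw', B.app_subst hm hp hS hT h hw hw',
    ih hT _ (PWord.card_subword_lt hm (h hs)), ih hS _ (PWord.card_contract_lt hm hp hj (h hs))]

/-- Induction on the number of parentheses of `w`. If `w'` has parentheses, both words are cut. If
`w'` is a corolla and `w` is not, the morphism factors through the word with one of the pairs of
`w`: the first factor is treated by cutting, the second is an associator. Between corollas the
action is `μ`. -/
theorem app_eq_of_toMonoidal_eq (hn : ((1 : ℕ) : ℕ∞) ≤ n) {A B : AssocAlgebra C n}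
    (hAB : A.toMonoidal = B.toMonoidal) {w w' : Assoc n m} (h : w ≤ w') (L : Fin m → Arrow C) :
    A.app h L = B.app h L := by
  have hμ : ∀ {k : ℕ} (hk : (k : ℕ∞) ≤ n) (L : Fin k → Arrow C),
      A.app (le_refl (Assoc.corolla k hk)) L = B.app (le_refl (Assoc.corolla k hk)) L := by
    intro k hk L
    exact congrArg (fun Q : AnMonoidal C n => (Q.μ k hk).mapArrow.obj (Arrow.mk
      (fun x => (L x).hom : (fun x => (L x).left) ⟶ fun x => (L x).right))) hAB
  have hα : ∀ {i j k m p : ℕ} (_ : i + j + k = m) (_ : i + 1 + k = p) (hmn : (m : ℕ∞) ≤ n)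
      (_ : (p : ℕ∞) ≤ n) (X : Fin m → C),
      A.app (leOfHom (Assoc.drop i j m hmn)) (ids X) =
        B.app (leOfHom (Assoc.drop i j m hmn)) (ids X) := by
    intro i j k m p hm hp hmn hpn X
    have := congrArg (fun Q : AnMonoidal C n => Arrow.mk ((Q.α i j k hm hp hmn hpn).app X)) hAB
    rw [← A.mk_assoc_app hm hp hmn hpn (le_mid hm hmn),
      ← B.mk_assoc_app hm hp hmn hpn (le_mid hm hmn)]
    exact this
  induction hN : w.1.parens.card using Nat.strong_induction_on generalizing m with
  | _ N ih =>
    subst hN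
    have hmem : ∀ {w' : Assoc n m} (h : w ≤ w') {s : Finset (Fin m)} (_ : s ∈ w'.1.parens)
        (L : Fin m → Arrow C), A.app h L = B.app h L := fun h s hs L =>
      app_eq_of_mem_parens h hs (fun h L hlt => ih _ hlt h L rfl) L
    by_cases hw' : ∃ s, s ∈ w'.1.parens
    · obtain ⟨s, hs⟩ := hw'
      exact hmem h hs L
    · obtain ⟨w', hf⟩ := w'
      obtain rfl : w' = PWord.corolla m :=
        PWord.eq_of_parens_iff fun s _ _ => iff_of_false (fun hs => hw' ⟨s, hs⟩) (by simp [PWord.corolla])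
      have hmn := PWord.le_of_inFiltration_corolla hn hf
      by_cases hw : ∃ s, s ∈ w.1.parens
      · obtain ⟨s, hs⟩ := hw
        obtain ⟨i, j, k, hm, hj, rfl⟩ := PWord.exists_eq_segment hs
        have hle : w ≤ Assoc.bracket i j m hmn := by
          intro s hs'
          rwa [(PWord.mem_bracket_parens.1 hs').1]
        have hs' : PWord.segment i j m ∈ (Assoc.bracket i j m hmn).1.parens :=
          PWord.mem_bracket_parens.2 ⟨rfl, w.1.two_le _ hs, w.1.card_lt _ hs⟩
        let f : (fun x => (L x).left) ⟶ fun x => (L x).right := fun x => (L x).hom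
        -- Associators describe the action at identity morphisms only, so the morphisms `L` are
        -- applied afterwards, at the corolla.
        have h1 := app_trans_congr (A := A) (B := B) (leOfHom (Assoc.drop i j m hmn))
          (le_refl (Assoc.corolla m hmn)) (f := 𝟙 _) (g := f)
          (hα hm rfl hmn (cast_le_of_le hmn (by omega)) _) (hμ hmn _)
        have h2 := app_trans_congr (A := A) (B := B) hle _ (f := 𝟙 _) (hmem hle hs' _) h1
        rw [Category.id_comp, Category.id_comp] at h2
        exact h2
      · obtain ⟨w, hf'⟩ := w
        obtain rfl : w = PWord.corolla m :=
          PWord.eq_of_parens_iff fun s _ _ => iff_of_false (fun hs => hw ⟨s, hs⟩) (by simp [PWord.corolla])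
        exact hμ hmn L

theorem toMonoidal_injective (hn : ((1 : ℕ) : ℕ∞) ≤ n) :
    Function.Injective (toMonoidal : AssocAlgebra C n → AnMonoidal C n) := by
  intro A B hAB
  refine AssocAlgebra.ext (funext fun m => Arrow.functor_ext fun X Y f => ?_)
  change Arrow.mk ((A.θ m).map f) = Arrow.mk ((B.θ m).map f)
  rw [mk_θ_map, mk_θ_map]
  exact app_eq_of_toMonoidal_eq hn hAB _ _

end AssocAlgebra
end Associahedral

namespace Associahedral

theorem arrow_id_comp_congr {C : Type u} [Category.{v} C] {X Y Z W : C} {f : X ⟶ Y} (g : Y ⟶ Z)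
    (h : Arrow.mk f = Arrow.mk (𝟙 W)) : Arrow.mk (f ≫ g) = Arrow.mk g := by
  cases h
  rw [Category.id_comp]

namespace PWord

variable {m i j k a b : ℕ}

/-! ### The incoming edges in trees with at most two nodes -/

/-- The letters in the positions `a`, …, `a + b - 1` in their natural order. -/
def letters (h : a + b ≤ m) : List (Fin m) := List.ofFn fun t : Fin b => ⟨a + t, by omega⟩

theorem length_letters (h : a + b ≤ m) : (letters h).length = b := by simp [letters]

theorem mem_letters (h : a + b ≤ m) {x : Fin m} :
    x ∈ letters h ↔ a ≤ (x : ℕ) ∧ (x : ℕ) < a + b := by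
  rw [letters, List.mem_ofFn']
  constructor
  · rintro ⟨t, rfl⟩
    dsimp only
    omega
  · exact fun hx => ⟨⟨x - a, by omega⟩, Fin.ext (by dsimp only; omega)⟩

theorem pairwise_letters (h : a + b ≤ m) : (letters h).Pairwise (· < ·) := by
  rw [letters, List.pairwise_ofFn]
  intro s t hst
  rw [Fin.lt_def] at hst ⊢
  dsimp only
  omega

theorem finRange_eq_letters (hm : i + j + k = m) :
    List.finRange m = letters (a := 0) (b := i) (m := m) (by omega) ++
      letters (a := i) (b := j) (by omega) ++ letters (a := i + j) (b := k) (by omega) := by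
  have hp : (letters (a := 0) (b := i) (m := m) (by omega) ++
      letters (a := i) (b := j) (by omega) ++
      letters (a := i + j) (b := k) (by omega)).Pairwise (· < ·) := by
    rw [List.pairwise_append, List.pairwise_append]
    refine ⟨⟨pairwise_letters _, pairwise_letters _, fun x hx y hy => ?_⟩, pairwise_letters _,
      fun x hx y hy => ?_⟩
    · rw [mem_letters] at hx hy
      rw [Fin.lt_def]
      omega
    · rw [List.mem_append, mem_letters, mem_letters] at hx
      rw [mem_letters] at hy
      rw [Fin.lt_def]
      omega
  refine List.Perm.eq_of_pairwise (le := (· < ·)) (fun x y _ _ h h' => absurd h h'.asymm)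
    (List.pairwise_lt_finRange m) hp ?_
  refine (List.perm_ext_iff_of_nodup (List.nodup_finRange m) (hp.imp ne_of_lt)).2 fun x => ?_
  simp only [List.mem_finRange, true_iff, List.mem_append, mem_letters]
  omega

theorem before_singleton {x y : Fin m} (h : x < y) : Before ({x} : Finset (Fin m)) {y} := by
  intro x' hx y' hy
  rwa [Finset.mem_singleton.1 hx, Finset.mem_singleton.1 hy]

theorem ssubset_singleton_iff_false {w : PWord m} {q : Finset (Fin m)} (hq : q ∈ w.edges)
    (x : Fin m) : ¬ q ⊂ {x} := fun h => by
  have h1 := Finset.card_pos.2 (edges_nonempty hq)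
  have h2 := Finset.card_lt_card h
  rw [Finset.card_singleton] at h2
  omega

theorem singleton_ssubset {x : Fin m} {s : Finset (Fin m)} (hx : x ∈ s) (hs : 2 ≤ s.card) :
    {x} ⊂ s := (Finset.singleton_subset_iff.2 hx).ssubset_of_ne (by rintro rfl; simp at hs)

theorem children_corolla (hm : 2 ≤ m) :
    (corolla m).children Finset.univ = (List.finRange m).map fun x => {x} := by
  refine eq_children ?_ fun q => ?_
  · exact List.pairwise_map.2 ((List.pairwise_lt_finRange m).imp before_singleton)
  · simp only [List.mem_map, List.mem_finRange, true_and]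
    constructor
    · rintro ⟨x, rfl⟩
      refine mem_inputs.2 ⟨mem_edges.2 (Or.inr ⟨x, rfl⟩),
        singleton_ssubset (Finset.mem_univ x) (by simpa using hm), fun r hr hxr => ?_⟩
      rcases mem_edges.1 hr with h | ⟨y, rfl⟩
      · simp [corolla] at h
      · exact absurd hxr (ssubset_singleton_iff_false (mem_edges.2 (Or.inr ⟨x, rfl⟩) : {x} ∈ (corolla m).edges) y)
    · intro hq
      rcases mem_edges.1 (mem_inputs.1 hq).1 with h | h
      · simp [corolla] at h
      · exact h

theorem mem_edges_bracket (h2 : 2 ≤ (segment i j m).card) (hlt : (segment i j m).card < m)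
    {q : Finset (Fin m)} : q ∈ (bracket i j m).edges ↔ q = segment i j m ∨ ∃ x, {x} = q := by
  rw [mem_edges, mem_bracket_parens]
  refine or_congr_left ⟨fun h => h.1, ?_⟩
  rintro rfl
  exact ⟨rfl, h2, hlt⟩

theorem children_bracket_univ (hm : i + j + k = m) (h2 : 2 ≤ (segment i j m).card)
    (hlt : (segment i j m).card < m) :
    (bracket i j m).children Finset.univ =
      (letters (a := 0) (b := i) (m := m) (by omega)).map (fun x => {x}) ++
        segment i j m :: (letters (a := i + j) (b := k) (by omega)).map fun x => {x} := by
  have hE := @mem_edges_bracket m i j h2 hlt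
  refine eq_children ?_ fun q => ?_
  · rw [List.pairwise_append, List.pairwise_cons, List.pairwise_map, List.pairwise_map]
    refine ⟨(pairwise_letters _).imp before_singleton, ⟨fun t ht => ?_,
      (pairwise_letters _).imp before_singleton⟩, fun s hs t ht => ?_⟩
    · obtain ⟨y, hy, rfl⟩ := List.mem_map.1 ht
      rw [mem_letters] at hy
      intro x hx y' hy'
      rw [mem_segment] at hx
      rw [Finset.mem_singleton.1 hy', Fin.lt_def]
      omega
    · obtain ⟨x, hx, rfl⟩ := List.mem_map.1 hs
      rw [mem_letters] at hx
      intro x' hx' y hy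
      rw [Finset.mem_singleton.1 hx', Fin.lt_def]
      rcases List.mem_cons.1 ht with rfl | ht
      · rw [mem_segment] at hy
        omega
      · obtain ⟨z, hz, rfl⟩ := List.mem_map.1 ht
        rw [mem_letters] at hz
        rw [Finset.mem_singleton.1 hy]
        omega
  · have hiff : q ∈ (bracket i j m).inputs Finset.univ ↔
        q = segment i j m ∨ ∃ x, x ∉ segment i j m ∧ {x} = q := by
      rw [mem_inputs]
      constructor
      · rintro ⟨hq, -, hmax⟩
        refine (hE.1 hq).imp_right ?_
        rintro ⟨x, rfl⟩
        refine ⟨x, fun hx => hmax _ (hE.2 (Or.inl rfl)) (singleton_ssubset hx h2) ?_, rfl⟩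
        refine (Finset.subset_univ _).ssubset_of_ne fun h => ?_
        rw [h, Finset.card_univ, Fintype.card_fin] at hlt
        omega
      · rintro (rfl | ⟨x, hx, rfl⟩)
        · refine ⟨hE.2 (Or.inl rfl), (Finset.subset_univ _).ssubset_of_ne fun h => ?_, ?_⟩
          · rw [h, Finset.card_univ, Fintype.card_fin] at hlt
            omega
          · intro r hr hlt
            rcases hE.1 hr with rfl | ⟨y, rfl⟩
            · exact absurd hlt (ssubset_irrefl _)
            · exact absurd hlt (ssubset_singleton_iff_false (hE.2 (Or.inl rfl)) y)
        · refine ⟨hE.2 (Or.inr ⟨x, rfl⟩), singleton_ssubset (Finset.mem_univ x) ?_, ?_⟩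
          · rw [Finset.card_univ, Fintype.card_fin]
            omega
          · intro r hr hlt
            rcases hE.1 hr with rfl | ⟨y, rfl⟩
            · exact absurd (hlt.1 (Finset.mem_singleton_self x)) hx
            · exact absurd hlt (ssubset_singleton_iff_false (hE.2 (Or.inr ⟨x, rfl⟩)) y)
    rw [hiff]
    simp only [List.mem_append, List.mem_cons, List.mem_map, mem_letters, mem_segment]
    constructor
    · rintro (⟨x, hx, rfl⟩ | rfl | ⟨x, hx, rfl⟩)
      · exact Or.inr ⟨x, by omega, rfl⟩
      · exact Or.inl rfl
      · exact Or.inr ⟨x, by omega, rfl⟩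
    · rintro (rfl | ⟨x, hx, rfl⟩)
      · exact Or.inr (Or.inl rfl)
      · by_cases hxi : (x : ℕ) < i
        · exact Or.inl ⟨x, by omega, rfl⟩
        · exact Or.inr (Or.inr ⟨x, by omega, rfl⟩)

theorem children_bracket_segment (hij : i + j ≤ m) (h2 : 2 ≤ (segment i j m).card)
    (hlt : (segment i j m).card < m) :
    (bracket i j m).children (segment i j m) = (letters hij).map fun x => {x} := by
  have hE := @mem_edges_bracket m i j h2 hlt
  refine eq_children ?_ fun q => ?_
  · exact List.pairwise_map.2 ((pairwise_letters _).imp before_singleton)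
  · simp only [List.mem_map, mem_letters, mem_inputs, ← mem_segment]
    constructor
    · rintro ⟨x, hx, rfl⟩
      refine ⟨hE.2 (Or.inr ⟨x, rfl⟩), singleton_ssubset hx h2, fun r hr hxr hrs => ?_⟩
      rcases hE.1 hr with rfl | ⟨y, rfl⟩
      · exact absurd hrs (ssubset_irrefl _)
      · exact absurd hxr (ssubset_singleton_iff_false (hE.2 (Or.inr ⟨x, rfl⟩)) y)
    · rintro ⟨hq, hqs, -⟩
      rcases hE.1 hq with rfl | ⟨y, rfl⟩
      · exact absurd hqs (ssubset_irrefl _)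
      · exact ⟨y, hqs.1 (Finset.mem_singleton_self y), rfl⟩

end PWord

/-! ### Recovering an `A_n`-monoidal structure from its algebra. -/

namespace AnMonoidal

open PWord

variable {C : Type u} [Category.{v} C] {n : ℕ∞} {m : ℕ}

theorem ext_of_arrows {Q Q' : AnMonoidal C n} (hμ : ∀ k h, Q.μ k h = Q'.μ k h)
    (hα : ∀ (i j k : ℕ) {m p : ℕ} (hm : i + j + k = m) (hp : i + 1 + k = p) (hmn : (m : ℕ∞) ≤ n)
      (hpn : (p : ℕ∞) ≤ n) (X : Fin m → C),
      Arrow.mk ((Q.α i j k hm hp hmn hpn).app X) = Arrow.mk ((Q'.α i j k hm hp hmn hpn).app X)) :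
    Q = Q' := by
  cases Q with
  | mk μ _ _ α =>
    cases Q' with
    | mk μ' _ _ α' =>
      obtain rfl : μ = μ' := funext fun k => funext fun h => hμ k h
      obtain rfl : @α = @α' := by
        funext i j k m p hm hp hmn hpn
        ext X
        exact Arrow.mk_injective _ _ (hα i j k hm hp hmn hpn X)
      rfl

variable {Q : AnMonoidal C n} [hn : Fact (((1 : ℕ) : ℕ∞) ≤ n)]

theorem map_c_arr_idl (l : List C) : ((idl l).map Q.arr).map (·.c) = l := by
  induction l with
  | nil => rfl
  | cons c l ih =>
    rw [idl, List.map_cons, List.map_cons, List.map_cons, ← idl, ih]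
    rfl

theorem flatMap_y_arr_idl (l : List C) : ((idl l).map Q.arr).flatMap (·.y) = l := by
  induction l with
  | nil => rfl
  | cons c l ih =>
    rw [idl, List.map_cons, List.map_cons, List.flatMap_cons, ← idl, ih]
    rfl

/-- The associators as composites. -/
theorem arrow_join_middle (xs ys zs : List C) (h : ((xs ++ ys ++ zs).length : ℕ∞) ≤ n) {U : Q.Mor}
    (hU : U.arrow = Arrow.mk (𝟙 (Q.mu ys))) (hUy : U.y = ys) (hUc : U.c = Q.mu ys) :
    (join ((idl xs).map Q.arr ++ U :: (idl zs).map Q.arr)).arrow = Q.alA xs ys zs := by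
  obtain ⟨c, y, ne, le, φ⟩ := U
  dsimp only at hUy hUc
  subst hUy hUc
  have hφ : φ = 𝟙 _ := Arrow.mk_injective _ _ hU
  subst hφ
  have l1 := List.length_pos_of_ne_nil ne
  have cx := map_c_arr_idl (Q := Q) xs
  have yx := flatMap_y_arr_idl (Q := Q) xs
  have cz := map_c_arr_idl (Q := Q) zs
  have yz := flatMap_y_arr_idl (Q := Q) zs
  have hflat : ((idl xs).map Q.arr ++ (⟨Q.mu y, y, ne, le, 𝟙 _⟩ : Q.Mor) ::
      (idl zs).map Q.arr).flatMap (·.y) = xs ++ y ++ zs := by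
    rw [List.flatMap_append, List.flatMap_cons, yx, yz, List.append_assoc]
  rw [join_of_le (by simp) (by rw [hflat]; exact h)]
  dsimp only [Mor.arrow]
  -- The substitution is split into the letters before `U`, `U` itself and the letters after it. The
  -- identities on either side have no effect, and substituting the identity `U` leaves just the
  -- associator.
  rw [insAll_append [] ((idl xs).map Q.arr) _ [] _ _ _ _ (pre' := xs) (post' := Q.mu y :: zs)
    (mid := xs ++ Q.mu y :: zs) (by rw [yx]; rfl) (by rw [List.map_append, List.map_cons, cx, cz]; rfl)
    (by rw [yx]; rfl) (by rw [List.map_cons, cz, List.append_nil])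
    (by rw [List.flatMap_append, yx]; simp) (cast_le_of_le h (by simp; omega)),
    insAll_cons [] _ _ xs _ _ _ _ (pre' := xs ++ y) (post' := zs) (mid := xs ++ y ++ zs) rfl
      (by rw [cz, List.append_nil]) (by rw [cz, List.append_nil])
      (by rw [hflat, yz, List.append_nil]) rfl rfl h]
  refine (arrow_insAll_arr [] (idl zs) (xs ++ y) _ _ _ _ (t := xs ++ y ++ zs) (by simp [idl, Function.comp_def])
    (by simp [idl, Function.comp_def])).trans ?_
  refine (arrow_comp_id_congr _ (W := Q.mu (xs ++ y ++ zs)) ?_).trans ?_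
  · rw [Q.mapL_congr (by simp [idl] : idl (xs ++ y) ++ idl zs ++ idl [] = idl (xs ++ y ++ zs))]
    exact mapL_idl _ _
  rw [ins]
  refine (arrow_id_comp_congr _ (W := Q.mu (xs ++ Q.mu y :: zs)) ?_).trans
    ((arrow_id_comp_congr _ (W := Q.mu (xs ++ Q.mu y :: zs)) ?_).trans (Q.mk_al ..))
  · refine (arrow_insAll_arr (Q.mu y :: zs) (idl xs) [] _ _ _ _ (t := xs ++ Q.mu y :: zs)
      (by simp [idl, Function.comp_def, arr]) (by simp [idl, Function.comp_def])).trans ?_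
    refine (arrow_comp_id_congr _ (W := Q.mu (xs ++ Q.mu y :: zs)) ?_).trans ?_
    · rw [Q.mapL_congr (by simp [idl] : idl [] ++ idl xs ++ idl (Q.mu y :: zs) =
        idl (xs ++ Q.mu y :: zs))]
      exact mapL_idl _ _
    · refine arrow_id_congr (congrArg Q.mu ?_)
      rw [List.map_append, List.map_cons, cx, cz]
  · rw [wh_id]

theorem arrow_eval_corolla (hm : (m : ℕ∞) ≤ n) (F : Fin m → Arrow C) :
    (eval (corolla m) (corolla m) (fun x => Q.arr (F x)) Finset.univ).arrow =
      Q.muA (List.ofFn F) := by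
  rcases (by omega : m = 0 ∨ m = 1 ∨ 2 ≤ m) with rfl | rfl | h2
  · rw [arrow_eval _ _ _ (by simp), children_eq_nil _ (by simp), List.map_nil, join_nil, arr_arrow,
      List.ofFn_zero, ← Q.mu_nil, ← Q.muA_id]
    rfl
  · have : (Finset.univ : Finset (Fin 1)) = {0} := rfl
    rw [this, eval_singleton, arr_arrow]
    exact (Q.muA_singleton hn.out (F 0)).symm
  · have hc : ((corolla m).children Finset.univ).map
        (eval (corolla m) (corolla m) fun x => Q.arr (F x)) = (List.ofFn F).map Q.arr := by
      rw [children_corolla h2, List.map_map, List.ofFn_eq_map, List.map_map]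
      exact List.map_congr_left fun x _ => eval_singleton _ _ _ x
    rw [arrow_eval _ _ _ (by simp; omega), hc]
    refine (join_arr ?_ (by simpa using hm)).1
    intro h
    have := congrArg List.length h
    simp at this
    omega

/-- The segment is not an edge of the corolla, so its value is the identity of `μ_j`, regarded as a
morphism to a list of `j` letters. Joining it at the root produces the associator. -/
theorem arrow_eval_bracket {i j k p : ℕ} (hm : i + j + k = m) (hp : i + 1 + k = p)
    (hmn : (m : ℕ∞) ≤ n) (hpn : (p : ℕ∞) ≤ n) (h2 : 2 ≤ (segment i j m).card)
    (hlt : (segment i j m).card < m) (X : Fin m → C) :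
    (eval (bracket i j m) (corolla m) (fun x => Q.arr (Arrow.mk (𝟙 (X x)))) Finset.univ).arrow =
      Arrow.mk ((Q.α i j k hm hp hmn hpn).app X) := by
  let xs := (letters (a := 0) (b := i) (m := m) (by omega)).map X
  let ys := (letters (a := i) (b := j) (m := m) (by omega)).map X
  let zs := (letters (a := i + j) (b := k) (m := m) (by omega)).map X
  have hX : List.ofFn X = xs ++ ys ++ zs := by
    rw [List.ofFn_eq_map, finRange_eq_letters hm, List.map_append, List.map_append]
  have hl : (xs ++ ys ++ zs).length = m := (length_of_ofFn_eq hX)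
  have hj : 2 ≤ j := h2.trans (card_segment_le i j m)
  have hys : ys.length = j := by rw [List.length_map, length_letters]
  have hs : ∀ l : List (Fin m), (l.map fun x => ({x} : Finset (Fin m))).map
      (eval (bracket i j m) (corolla m) fun x => Q.arr (Arrow.mk (𝟙 (X x)))) =
        (idl (l.map X)).map Q.arr := by
    intro l
    rw [idl, List.map_map, List.map_map, List.map_map]
    exact List.map_congr_left fun x _ => eval_singleton _ _ _ x
  have hseg : ¬ (corolla m).IsEdge (segment i j m) := by
    intro h
    rcases mem_nodes.1 (h.mem_nodes h2) with h | h
    · rw [h, Finset.card_univ, Fintype.card_fin] at hlt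
      omega
    · simp [corolla] at h
  have hjoin := join_arr (Q := Q) (fs := idl ys) (by
    intro h
    have := congrArg List.length h
    rw [idl, List.length_map, hys] at this
    simp at this
    omega) (by
    rw [idl, List.length_map, hys]
    exact le_mid hm hmn)
  rw [arrow_eval _ _ _ (by simp; omega), children_bracket_univ hm h2 hlt, List.map_append,
    List.map_cons, hs, hs, eval_of_not_isEdge _ _ (by omega) hseg,
    children_bracket_segment (by omega) h2 hlt, hs]
  refine (arrow_join_middle xs ys zs (by rw [hl]; exact hmn) (hjoin.1.trans (Q.muA_id ys))
    (hjoin.2.1.trans (idl_right ys)) (hjoin.2.2.trans (congrArg Q.mu (idl_left ys)))).trans ?_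
  exact Q.alA_ofFn hX (by rw [List.length_map, length_letters]) hys

variable (Q) in
theorem mul_toAlgebra (k : ℕ) (h : (k : ℕ∞) ≤ n) : Q.toAlgebra.mul k h = Q.μ k h := by
  refine Arrow.functor_ext fun X Y f => ?_
  refine (Q.mk_act_map _).trans ((arrow_eval_corolla h _).trans ?_)
  exact Q.muA_ofFn h rfl

variable (Q) in
-- Brackets around fewer than two letters or around the whole word are corollas; there condition (i)
-- makes the given associator an identity, as the reconstructed one is. All other brackets are
-- genuine and fall under `arrow_eval_bracket`.
theorem toMonoidal_toAlgebra : Q.toAlgebra.toMonoidal = Q := by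
  refine ext_of_arrows Q.mul_toAlgebra ?_
  intro i j k m p hm hp hmn hpn X
  refine (Q.toAlgebra.mk_assoc_app hm hp hmn hpn (le_mid hm hmn) X).trans ?_
  have hid : PWord.bracket i j m = PWord.corolla m →
      Q.toAlgebra.app (leOfHom (Assoc.drop i j m hmn)) (AssocAlgebra.ids X) =
        Arrow.mk (𝟙 ((Q.μ m hmn).obj X)) := by
    intro e
    refine (Q.toAlgebra.app_ids_of_eq _ (Subtype.ext e) X).trans ?_
    rw [← Q.mul_toAlgebra m hmn]
    rfl
  rcases (by omega : j = 0 ∨ j = 1 ∨ 2 ≤ j) with rfl | rfl | hj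
  · rw [hid (bracket_eq_corolla (by omega)), Q.α_zero]
  · rw [hid (bracket_eq_corolla (by omega)), Q.α_one]
  by_cases hik : i = 0 ∧ k = 0
  · obtain ⟨rfl, rfl⟩ := hik
    obtain rfl : j = m := by omega
    rw [hid (bracket_all _), Q.α_all]
  · have hcard : (segment i j m).card = j := by
      rw [← shift_univ hm, card_shift, Finset.card_univ, Fintype.card_fin]
    exact (Q.mk_act_map _).trans
      (arrow_eval_bracket hm hp hmn hpn (by omega) (by omega) X)

end AnMonoidal

end Associahedral

theorem theorem2 (n : ℕ∞) (hn : 2 ≤ n) (C : Type u) [Category.{v} C] :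
    ∃ e : Associahedral.AssocAlgebra C n ≃ Associahedral.AnMonoidal C n,
      ∀ A : Associahedral.AssocAlgebra C n,
        (∀ (k : ℕ) (hk : (k : ℕ∞) ≤ n),
          (e A).μ k hk =
            CategoryTheory.Prod.sectR (Associahedral.Assoc.corolla k hk) (Fin k → C) ⋙ A.θ k) ∧
        (∀ (i j k m p : ℕ) (hm : i + j + k = m) (hp : i + 1 + k = p) (hmn : (m : ℕ∞) ≤ n)
          (hpn : (p : ℕ∞) ≤ n) (X : Fin m → C),
          Arrow.mk (((e A).α i j k hm hp hmn hpn).app X) =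
            Arrow.mk ((A.θ m).map
              (CategoryTheory.Prod.mkHom (Associahedral.Assoc.drop i j m hmn) (𝟙 X)))) := by
  have h1 : ((1 : ℕ) : ℕ∞) ≤ n := le_trans (by norm_num) hn
  have : Fact (((1 : ℕ) : ℕ∞) ≤ n) := ⟨h1⟩
  exact ⟨Equiv.ofBijective Associahedral.AssocAlgebra.toMonoidal
    ⟨Associahedral.AssocAlgebra.toMonoidal_injective h1,
      fun Q => ⟨Q.toAlgebra, Q.toMonoidal_toAlgebra⟩⟩,
    fun A => ⟨fun _ _ => rfl, fun _ _ _ _ _ hm hp hmn hpn X =>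
      A.mk_assoc_app hm hp hmn hpn (Associahedral.le_mid hm hmn) X⟩⟩
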